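/- Let $k$ be an algebraically closed field. Write $\mathrm{Aut}(\mathbb{A}^2_k)$ for the group (under composition) of polynomial automorphisms $f=(f_1,f_2)$ of the affine plane, $f_1,f_2\in k[x_1,x_2]$, and $\mathrm{SAut}(\mathbb{A}^2_k)$ for the subgroup of those with Jacobian determinant $\det(\partial f_i/\partial x_j)=1$. For an algebraic variety $A$ over $k$, a morphism $A\to\mathrm{Aut}(\mathbb{A}^2_k)$ is a map $F\colon A(k)\to \mathrm{Aut}(\mathbb{A}^2_k)$ given by an $A$-automorphism $(a,x)\mapsto (a,F(a)(x))$ of $A\times\mathbb{A}^2_k$. The Zariski topology on $\mathrm{Aut}(\mathbb{A}^2_k)$ is the one in which a set $C$ is closed if and only if $F^{-1}(C)$ is closed in $A$ for every algebraic variety $A$ over $k$ and every morphism $F\colon A\to\mathrm{Aut}(\mathbb{A}^2_k)$; $\mathrm{SAut}(\mathbb{A}^2_k)$ carries the subspace topology. Let $\mu\in k^*$ and $f=(\mu x_1,\mu^{-1}x_2)\in\mathrm{SAut}(\mathbb{A}^2_k)$. Then $$\{gfg^{-1}\mid g\in\mathrm{Aut}(\mathbb{A}^2_k)\}=\{gfg^{-1}\mid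 g\in\mathrm{SAut}(\mathbb{A}^2_k)\},$$ and this set is closed in $\mathrm{SAut}(\mathbb{A}^2_k)$. -/

import Mathlib

open CategoryTheory AlgebraicGeometry MvPolynomial

universe u

noncomputable section

/-- A polynomial endomorphism `(f₁, …, fₙ)` of affine `n`-space over `R`, given by its
coordinate polynomials `fᵢ ∈ R[x₁, …, xₙ]`. -/
@[ext]
structure PolyEnd (n : ℕ) (R : Type u) [CommRing R] where
  coord : Fin n → MvPolynomial (Fin n) R

namespace PolyEnd

variable {n : ℕ} {R : Type u} [CommRing R]

/-- The algebra endomorphism `f^*` of `R[x₁, …, xₙ]`, `q ↦ q(f₁, …, fₙ)`. -/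
def comap (f : PolyEnd n R) : MvPolynomial (Fin n) R →ₐ[R] MvPolynomial (Fin n) R :=
  bind₁ f.coord

/-- The monoid structure is composition of maps: `(f * g)(x) = f(g(x))`. -/
instance : Monoid (PolyEnd n R) where
  mul f g := ⟨fun i => g.comap (f.coord i)⟩
  one := ⟨fun i => X i⟩
  mul_assoc f g h := by
    ext1; funext i
    exact (bind₁_bind₁ g.coord h.coord (f.coord i))
  one_mul f := by
    ext1; funext i
    exact bind₁_X_right f.coord i
  mul_one f := by
    ext1; funext i
    exact DFunLike.congr_fun (aeval_X_left (σ := Fin n) (R := R)) (f.coord i)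

theorem coord_mul (f g : PolyEnd n R) (i : Fin n) :
    (f * g).coord i = g.comap (f.coord i) := rfl

theorem coord_one (i : Fin n) : (1 : PolyEnd n R).coord i = X i := rfl

/-- The Jacobian matrix `(∂fᵢ / ∂xⱼ)`. -/
def jacobianMatrix (f : PolyEnd n R) : Matrix (Fin n) (Fin n) (MvPolynomial (Fin n) R) :=
  Matrix.of fun i j => pderiv j (f.coord i)

/-- The Jacobian determinant `Jac(f)`. -/
def jac (f : PolyEnd n R) : MvPolynomial (Fin n) R := f.jacobianMatrix.det

theorem pderiv_comap (g : PolyEnd n R) (p : MvPolynomial (Fin n) R) (j : Fin n) :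
    pderiv j (g.comap p) = ∑ i, g.comap (pderiv i p) * pderiv j (g.coord i) := by
  induction p using MvPolynomial.induction_on with
  | C a => simp [comap]
  | add p q hp hq => simp [map_add, hp, hq, add_mul, Finset.sum_add_distrib]
  | mul_X p l hp =>
    have hX : g.comap (X l) = g.coord l := bind₁_X_right g.coord l
    simp only [map_mul, Derivation.leibniz, hp, hX, smul_eq_mul, map_add, add_mul,
      Finset.sum_add_distrib, pderiv_X, Pi.single_apply]
    congr 1
    · rw [Finset.sum_eq_single l]
      · simp
      · intro b _ hb
        simp [Ne.symm hb]
      · simp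
    · rw [Finset.mul_sum]
      exact Finset.sum_congr rfl fun i _ => by ring

theorem jac_mul (f g : PolyEnd n R) : (f * g).jac = g.comap f.jac * g.jac := by
  have h : (f * g).jacobianMatrix = g.comap.mapMatrix f.jacobianMatrix * g.jacobianMatrix := by
    ext1 i j
    simp only [jacobianMatrix, Matrix.of_apply, Matrix.mul_apply, coord_mul, pderiv_comap]
    rfl
  rw [jac, h, Matrix.det_mul, ← AlgHom.map_det]
  rfl

theorem jac_one : (1 : PolyEnd n R).jac = 1 := by
  have h : (1 : PolyEnd n R).jacobianMatrix = 1 := by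
    ext1 i j
    simp only [jacobianMatrix, Matrix.of_apply, coord_one, pderiv_X, Matrix.one_apply,
      Pi.single_apply]
  rw [jac, h, Matrix.det_one]

/-- The morphism of schemes `Spec R[x₁, …, xₙ] ⟶ Spec R[x₁, …, xₙ]` given by
`x ↦ (f₁(x), …, fₙ(x))`. -/
def toScheme (f : PolyEnd n R) :
    Spec (CommRingCat.of (MvPolynomial (Fin n) R)) ⟶
      Spec (CommRingCat.of (MvPolynomial (Fin n) R)) :=
  Spec.map (CommRingCat.ofHom f.comap.toRingHom)

end PolyEnd

/-- The group `Aut(𝔸ⁿ_R)`: the polynomial endomorphisms having a polynomial inverse. -/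
abbrev PolyAut (n : ℕ) (R : Type u) [CommRing R] : Type u := (PolyEnd n R)ˣ

/-- The group `SAut(𝔸ⁿ_R)` of polynomial automorphisms with Jacobian `1`. -/
def SAut (n : ℕ) (R : Type u) [CommRing R] : Subgroup (PolyAut n R) where
  carrier := {f | f.val.jac = 1}
  one_mem' := PolyEnd.jac_one
  mul_mem' {f g} hf hg := by
    simp only [Set.mem_ofPred_eq] at *
    rw [Units.val_mul, PolyEnd.jac_mul, hf, hg, map_one, one_mul]
  inv_mem' {f} hf := by
    simp only [Set.mem_ofPred_eq] at *
    have h : ((f * f⁻¹ : PolyAut n R) : PolyEnd n R).jac = 1 := by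
      rw [mul_inv_cancel]; exact PolyEnd.jac_one
    rwa [Units.val_mul, PolyEnd.jac_mul, hf, map_one, one_mul] at h

/-- Algebraic varieties over `k`: reduced, separated schemes of finite type over `k`
(not necessarily irreducible). -/
structure AlgVariety (k : Type u) [Field k] where
  scheme : Scheme.{u}
  str : scheme ⟶ Spec (CommRingCat.of k)
  isReduced : IsReduced scheme
  isSeparated : IsSeparated str
  locallyOfFiniteType : LocallyOfFiniteType str
  quasiCompact : QuasiCompact str

namespace AlgVariety

variable {k : Type u} [Field k]

/-- The `k`-rational points of a variety, as sections of the structure morphism. -/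
def Point (A : AlgVariety k) : Type u :=
  {a : Spec (CommRingCat.of k) ⟶ A.scheme // a ≫ A.str = 𝟙 _}

/-- The Zariski topology on `A(k)`: the topology induced by that of the scheme, through the map
sending a `k`-point to the underlying point of the scheme. -/
instance (A : AlgVariety k) : TopologicalSpace A.Point :=
  TopologicalSpace.induced (fun a => a.1 (IsLocalRing.closedPoint k)) inferInstance

/-- The structure morphism of affine `n`-space over `k`. -/
def affineStr (n : ℕ) (k : Type u) [Field k] :
    Spec (CommRingCat.of (MvPolynomial (Fin n) k)) ⟶ Spec (CommRingCat.of k) :=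
  Spec.map (CommRingCat.ofHom (MvPolynomial.C (σ := Fin n)))

/-- The product `A × 𝔸ⁿ` over `k`. -/
def prodAffine (A : AlgVariety k) (n : ℕ) : Scheme.{u} :=
  Limits.pullback A.str (affineStr n k)

/-- The projection `A × 𝔸ⁿ ⟶ A`. -/
def proj (A : AlgVariety k) (n : ℕ) : A.prodAffine n ⟶ A.scheme :=
  Limits.pullback.fst A.str (affineStr n k)

/-- The inclusion `𝔸ⁿ ⟶ A × 𝔸ⁿ`, `x ↦ (a, x)`, of the fibre over a `k`-point `a` of `A`. -/
def fibreIncl (A : AlgVariety k) (n : ℕ) (a : A.Point) :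
    Spec (CommRingCat.of (MvPolynomial (Fin n) k)) ⟶ A.prodAffine n :=
  Limits.pullback.lift (affineStr n k ≫ a.1) (𝟙 _) (by
    rw [Category.assoc, a.2, Category.comp_id, Category.id_comp])

/-- A map `F : A(k) → Aut(𝔸ⁿ_k)` is a morphism if it is given by an `A`-automorphism `φ` of
`A × 𝔸ⁿ`, that is, `φ(a, x) = (a, F(a)(x))` for every point `a` of `A`. -/
def IsMorphismToAut (A : AlgVariety k) (n : ℕ) (F : A.Point → PolyAut n k) : Prop :=
  ∃ φ : A.prodAffine n ≅ A.prodAffine n, φ.hom ≫ A.proj n = A.proj n ∧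
    ∀ a : A.Point, A.fibreIncl n a ≫ φ.hom = (F a).val.toScheme ≫ A.fibreIncl n a

end AlgVariety

/-- The Zariski topology on `Aut(𝔸ⁿ_k)`: a set is closed if and only if its preimage under every
morphism from an algebraic variety `A` to `Aut(𝔸ⁿ_k)` is closed in `A`. The subgroup
`SAut(𝔸ⁿ_k)` carries the subspace topology. -/
instance PolyAut.zariskiTopology (n : ℕ) (k : Type u) [Field k] :
    TopologicalSpace (PolyAut n k) :=
  TopologicalSpace.ofClosed
    {C | ∀ (A : AlgVariety k) (F : A.Point → PolyAut n k), A.IsMorphismToAut n F →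
      IsClosed (F ⁻¹' C)}
    (fun _ _ _ => by simp)
    (fun S hS A F hF => by
      rw [Set.preimage_sInter]
      exact isClosed_biInter fun C hC => hS hC A F hF)
    (fun C hC D hD A F hF => by
      rw [Set.preimage_union]
      exact (hC A F hF).union (hD A F hF))

/-- The diagonal automorphism `(μ x₁, μ⁻¹ x₂)` of the affine plane, as an element of `SAut`. -/
def diagSAut {R : Type u} [CommRing R] (μ : Rˣ) : SAut 2 R :=
  ⟨{ val := ⟨![C (μ : R) * X 0, C ((μ⁻¹ : Rˣ) : R) * X 1]⟩
     inv := ⟨![C ((μ⁻¹ : Rˣ) : R) * X 0, C (μ : R) * X 1]⟩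
     val_inv := by
      ext1; funext i
      fin_cases i <;>
        simp [PolyEnd.coord_mul, PolyEnd.coord_one, PolyEnd.comap, ← mul_assoc, ← C_mul]
     inv_val := by
      ext1; funext i
      fin_cases i <;>
        simp [PolyEnd.coord_mul, PolyEnd.coord_one, PolyEnd.comap, ← mul_assoc, ← C_mul] },
   by
    change PolyEnd.jac _ = 1
    simp [PolyEnd.jac, PolyEnd.jacobianMatrix, Matrix.det_fin_two, ← C_mul]⟩

end

/-!
Let `f = (μ x, μ⁻¹ y)`. An automorphism `g` has constant Jacobian `e`, and `g` may be replaced by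
`g ∘ (e⁻¹ x, y)` without changing `g f g⁻¹`; this gives the equality of the two conjugacy classes.
It remains to show that the conjugacy class `C` of `f` in `Aut(𝔸²)` is closed.

A morphism from a variety to `Aut(𝔸²)` is given, over an affine open `Spec B`, by an endomorphism of
the plane with coefficients in `B` (`AlgVariety.exists_polyEnd_of_isMorphismToAut`). So let `H₀` be
the specialization of such an endomorphism `h` at a `k`-point `ev₀` of `Spec B` every neighbourhood
of which contains a `k`-point at which `h` specializes to an element of `C`
(`PolyAut.IsLimitOfConj`). That `H₀` lies in `C` (`PolyAut.IsLimitOfConj.mem_conjDiag`) is seen in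
three steps.

* `H₀` is conjugate to some `(a x, a⁻¹ y)`. The members of the family have bounded degree `d`, and
  the elements `H` of `C` of degree at most `d` have a common annihilating polynomial with simple
  roots: `P(H^*)` kills `x` and `y` (`PolyAut.exists_rootsPoly`). This is a closed condition, so it
  holds for `H₀`. Hence the powers of `H₀` have bounded degree, and by the structure of `Aut(𝔸²)`
  as an amalgamated product `H₀` is conjugate to a triangular automorphism
  (`PolyAut.exists_conj_mem_triangular`), which is then diagonalized by lifting eigenvectors.
* If `μ ≠ 1` then `a ≠ 1`: the elements of `C` in the family have an eigenvector, in a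
  fixed finite-dimensional space of polynomials, with an eigenvalue from a finite set not containing
  `1`, and this too is a closed condition (`PolyAut.IsLimitOfConj.map_ne_one`).
* If `a ≠ 1`, the fixed point of `H₀` is nondegenerate, so it persists in a neighbourhood of `ev₀`:
  the scheme of nondegenerate fixed points is étale over `Spec B`, and étale maps are open. The
  trace of the Jacobian matrix at a fixed point of an element of `C` is `μ + μ⁻¹`. Therefore
  `a + a⁻¹ = μ + μ⁻¹` and `a = μ` or `a = μ⁻¹` (`PolyAut.IsLimitOfConj.add_inv_eq`).

The structure theorem (`PolyAut.affine_sup_triangular`: affine and triangular automorphisms generate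
`Aut(𝔸²)`) is proved in all characteristics as follows. Suppose the first component `F` of an
automorphism `(F, G)` has degrees `α` in `x` and `β` in `y`. The inverse automorphism, applied to
`(F, G + s)`, moves the plane along the fibres of `F` with parameter `s`; giving `s` a suitable
weight and passing to leading forms yields a nontrivial polynomial deformation
`(x + s X', y + s Y')` which preserves the leading form of `F` for the weights `(β, α)`, and every
divisor of it. Such a form is divisible by some `x^m - c y^n` with `m`, `n` coprime, whose invariance
forces `m = 1` or `n = 1`. An elementary automorphism then lowers the degree. Degrees are
multiplicative on reduced words in affine and triangular automorphisms
(`PolyAut.deg_mul_of_altWord`), which controls the degrees of powers.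
-/

noncomputable section

/-! ### Leading forms with respect to a rational weight -/

section Weights

variable {σ τ k : Type*} [CommRing k]

/-- All monomials of `p` have `w`-weight at most `d`. -/
def WeightLE (w : σ → ℚ) (d : ℚ) (p : MvPolynomial σ k) : Prop :=
  ∀ m, coeff m p ≠ 0 → Finsupp.weight w m ≤ d

theorem WeightLE.add {w : σ → ℚ} {d : ℚ} {p q : MvPolynomial σ k} (hp : WeightLE w d p)
    (hq : WeightLE w d q) : WeightLE w d (p + q) := by
  intro m hm
  by_cases h : coeff m p = 0
  · exact hq m (by simpa [h] using hm)
  · exact hp m h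

theorem WeightLE.C_mul {w : σ → ℚ} {d : ℚ} {p : MvPolynomial σ k} (hp : WeightLE w d p) (a : k) :
    WeightLE w d (C a * p) := by
  intro m hm
  exact hp m fun h => hm (by simp [h])

theorem WeightLE.mono {w : σ → ℚ} {d e : ℚ} {p : MvPolynomial σ k} (hp : WeightLE w d p)
    (h : d ≤ e) : WeightLE w e p := fun m hm => (hp m hm).trans h

theorem WeightLE.sum {ι : Type*} {w : σ → ℚ} {d : ℚ} {s : Finset ι} {p : ι → MvPolynomial σ k}
    (hp : ∀ i ∈ s, WeightLE w d (p i)) : WeightLE w d (∑ i ∈ s, p i) := by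
  classical
  induction s using Finset.induction_on with
  | empty => intro m hm; simp at hm
  | insert a s ha ih =>
    rw [Finset.sum_insert ha]
    exact (hp a (by simp)).add (ih fun i hi => hp i (by simp [hi]))

theorem WeightLE.mul {w : σ → ℚ} {d e : ℚ} {p q : MvPolynomial σ k} (hp : WeightLE w d p)
    (hq : WeightLE w e q) : WeightLE w (d + e) (p * q) := by
  classical
  intro m hm
  rw [coeff_mul] at hm
  obtain ⟨⟨i, j⟩, hij, h⟩ := Finset.exists_ne_zero_of_sum_ne_zero hm
  rw [Finset.HasAntidiagonal.mem_antidiagonal] at hij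
  rw [← hij, map_add]
  exact add_le_add (hp i (left_ne_zero_of_mul h)) (hq j (right_ne_zero_of_mul h))

theorem WeightLE.isWeightedHomogeneous {w : σ → ℚ} {d : ℚ} {p : MvPolynomial σ k}
    (hp : IsWeightedHomogeneous w p d) : WeightLE w d p := fun _ hm => (hp hm).le

theorem weightedHomogeneousComponent_mul_of_weightLE {w : σ → ℚ} {d e : ℚ}
    {p q : MvPolynomial σ k} (hp : WeightLE w d p) (hq : WeightLE w e q) :
    weightedHomogeneousComponent w (d + e) (p * q) =
      weightedHomogeneousComponent w d p * weightedHomogeneousComponent w e q := by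
  classical
  ext m
  rw [coeff_weightedHomogeneousComponent, coeff_mul, coeff_mul]
  rw [show (if Finsupp.weight w m = d + e then ∑ x ∈ Finset.HasAntidiagonal.antidiagonal m,
      coeff x.1 p * coeff x.2 q else 0) = ∑ x ∈ Finset.HasAntidiagonal.antidiagonal m,
      if Finsupp.weight w m = d + e then coeff x.1 p * coeff x.2 q else 0 by split_ifs <;> simp]
  refine Finset.sum_congr rfl fun ⟨i, j⟩ hij => ?_
  rw [Finset.HasAntidiagonal.mem_antidiagonal] at hij
  simp only [coeff_weightedHomogeneousComponent]
  by_cases hi : coeff i p = 0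
  · simp [hi]
  by_cases hj : coeff j q = 0
  · simp [hj]
  have h1 := hp i hi
  have h2 := hq j hj
  have h3 : Finsupp.weight w m = Finsupp.weight w i + Finsupp.weight w j := by
    rw [← hij, map_add]
  by_cases h4 : Finsupp.weight w i = d
  · by_cases h5 : Finsupp.weight w j = e
    · simp [h3, h4, h5]
    · simp [h3, h4, h5]
  · have h5 : Finsupp.weight w m ≠ d + e := fun h => h4 (by linarith)
    simp [h4, h5]

theorem weightedHomogeneousComponent_eq_zero_of_weightLE_of_lt {w : σ → ℚ} {d e : ℚ}
    {p : MvPolynomial σ k} (hp : WeightLE w d p) (h : d < e) :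
    weightedHomogeneousComponent w e p = 0 := by
  classical
  ext m
  rw [coeff_weightedHomogeneousComponent, coeff_zero]
  split_ifs with hm
  · by_contra h0
    have := hp m h0
    linarith
  · rfl

/-- Substitution of polynomials of weight at most `v i` for variables of weight `v i`. -/
theorem weightLE_aeval_monomial {v : τ → ℚ} {w : σ → ℚ} {P : τ → MvPolynomial σ k}
    (hP : ∀ i, WeightLE w (v i) (P i)) (m : τ →₀ ℕ) :
    WeightLE w (Finsupp.weight v m) (aeval P (monomial m (1 : k))) ∧
    weightedHomogeneousComponent w (Finsupp.weight v m) (aeval P (monomial m (1 : k))) =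
      aeval (fun i => weightedHomogeneousComponent w (v i) (P i)) (monomial m (1 : k)) := by
  classical
  have h1 : IsWeightedHomogeneous w (1 : MvPolynomial σ k) 0 := isWeightedHomogeneous_one _ _
  induction m using Finsupp.induction_linear with
  | zero =>
    have : (monomial (0 : τ →₀ ℕ) (1 : k)) = 1 := rfl
    rw [this, map_one (aeval _), map_one (aeval _), map_zero]
    exact ⟨.isWeightedHomogeneous h1, h1.weightedHomogeneousComponent_same⟩
  | add f g hf hg =>
    have : monomial (f + g) (1 : k) = monomial f 1 * monomial g 1 := by
      rw [monomial_mul, one_mul]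
    rw [this, map_mul (aeval _), map_mul (aeval _), map_add,
      weightedHomogeneousComponent_mul_of_weightLE hf.1 hg.1, hf.2, hg.2]
    exact ⟨hf.1.mul hg.1, rfl⟩
  | single i n =>
    induction n with
    | zero =>
      have : (monomial (Finsupp.single i 0 : τ →₀ ℕ) (1 : k)) = 1 := by
        rw [Finsupp.single_zero]; rfl
      rw [this, map_one (aeval _), map_one (aeval _), Finsupp.single_zero, map_zero]
      exact ⟨.isWeightedHomogeneous h1, h1.weightedHomogeneousComponent_same⟩
    | succ n ih =>
      have h2 : Finsupp.weight v (Finsupp.single i (n + 1)) =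
          Finsupp.weight v (Finsupp.single i n) + v i := by
        rw [Finsupp.weight_single, Finsupp.weight_single, succ_nsmul]
      have h3 : monomial (Finsupp.single i (n + 1)) (1 : k) =
          monomial (Finsupp.single i n) 1 * X i := by
        rw [X, monomial_mul, ← Finsupp.single_add, one_mul]
      rw [h2, h3, map_mul (aeval _), map_mul (aeval _), aeval_X, aeval_X,
        weightedHomogeneousComponent_mul_of_weightLE ih.1 (hP i), ih.2]
      exact ⟨ih.1.mul (hP i), rfl⟩

theorem aeval_eq_sum_monomial {A : Type*} [CommRing A] [Algebra k A] (P : τ → A)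
    (F : MvPolynomial τ k) :
    aeval P F = ∑ m ∈ F.support, coeff m F • aeval P (monomial m (1 : k)) := by
  conv_lhs => rw [F.as_sum, map_sum]
  refine Finset.sum_congr rfl fun m _ => ?_
  rw [← map_smul, smul_monomial, smul_eq_mul, mul_one]

theorem WeightLE.aeval {v : τ → ℚ} {w : σ → ℚ} {P : τ → MvPolynomial σ k} {d : ℚ}
    (hP : ∀ i, WeightLE w (v i) (P i)) {F : MvPolynomial τ k} (hF : WeightLE v d F) :
    WeightLE w d (aeval P F) := by
  rw [aeval_eq_sum_monomial]
  refine WeightLE.sum fun m hm => ?_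
  rw [smul_eq_C_mul]
  exact ((weightLE_aeval_monomial hP m).1.mono (hF m (mem_support_iff.mp hm))).C_mul _

/-- Taking leading forms commutes with substitution. -/
theorem weightedHomogeneousComponent_aeval {v : τ → ℚ} {w : σ → ℚ} {P : τ → MvPolynomial σ k}
    {d : ℚ} (hP : ∀ i, WeightLE w (v i) (P i)) {F : MvPolynomial τ k} (hF : WeightLE v d F) :
    weightedHomogeneousComponent w d (aeval P F) =
      aeval (fun i => weightedHomogeneousComponent w (v i) (P i))
        (weightedHomogeneousComponent v d F) := by
  classical
  conv_rhs => rw [F.as_sum, map_sum, map_sum]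
  rw [aeval_eq_sum_monomial P F, map_sum]
  refine Finset.sum_congr rfl fun m hm => ?_
  have h0 : monomial m (coeff m F) = coeff m F • monomial m (1 : k) := by
    rw [smul_monomial, smul_eq_mul, mul_one]
  rw [map_smul, h0, map_smul, map_smul]
  congr 1
  rcases (hF m (mem_support_iff.mp hm)).lt_or_eq with h | h
  · rw [weightedHomogeneousComponent_eq_zero_of_weightLE_of_lt (weightLE_aeval_monomial hP m).1 h,
      (isWeightedHomogeneous_monomial v m (1 : k) rfl).weightedHomogeneousComponent_ne _ h.ne',
      map_zero]
  · rw [← h, (weightLE_aeval_monomial hP m).2,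
      (isWeightedHomogeneous_monomial v m (1 : k) rfl).weightedHomogeneousComponent_same]

end Weights

/-! ### Degeneration of one-parameter families preserving a polynomial -/

section Degeneration

variable {σ k : Type*} [Fintype σ] [CommRing k]

/-- The weight on `k[x, s]` extending the weight `w` on `k[x]` and giving `s` weight `-θ`. -/
def optionWeight (w : σ → ℚ) (θ : ℚ) : Option σ → ℚ := fun o => o.elim (-θ) w

theorem weight_optionWeight (w : σ → ℚ) (θ : ℚ) (m : Option σ →₀ ℕ) :
    Finsupp.weight (optionWeight w θ) m =
      Finsupp.weight (optionWeight w 0) m - m none * θ := by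
  rw [Finsupp.weight_eq_sum, Finsupp.weight_eq_sum, Fintype.sum_option, Fintype.sum_option]
  simp [optionWeight]
  ring

/-- If the family `x + s Z(x, s)` of substitutions, not constant in `s`, preserves `F`, then some
family of the same kind preserves the leading form of `F` for any given weight. It is the leading
form of the given family for the largest weight `-θ` of `s` that involves `s`. -/
theorem exists_degeneration {F : MvPolynomial σ k} {Z : σ → MvPolynomial (Option σ) k}
    (hZ : Z ≠ 0) (hF : aeval (fun i => X (some i) + X none * Z i) F = rename some F)
    {w : σ → ℚ} {d : ℚ} (hd : WeightLE w d F) :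
    ∃ Z' : σ → MvPolynomial (Option σ) k, Z' ≠ 0 ∧
      aeval (fun i => X (some i) + X none * Z' i) (weightedHomogeneousComponent w d F) =
        rename some (weightedHomogeneousComponent w d F) := by
  classical
  let val : (Σ _ : σ, Option σ →₀ ℕ) → ℚ := fun x =>
    (Finsupp.weight (optionWeight w 0) x.2 - w x.1) / (x.2 none + 1)
  let T : Finset (Σ _ : σ, Option σ →₀ ℕ) := Finset.univ.sigma fun i => (Z i).support
  have hT : T.Nonempty := by
    obtain ⟨i, hi⟩ := Function.ne_iff.mp hZ
    obtain ⟨m, hm⟩ := support_nonempty.mpr hi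
    exact ⟨⟨i, m⟩, by simpa [T] using hm⟩
  obtain ⟨⟨i₀, m₀⟩, h₀, hmax⟩ := T.exists_max_image val hT
  set θ := val ⟨i₀, m₀⟩ with hθ
  have hpos : ∀ m : Option σ →₀ ℕ, (0 : ℚ) < m none + 1 := fun m => by positivity
  have hle : ∀ i, WeightLE (optionWeight w θ) (w i + θ) (Z i) := by
    intro i m hm
    have := hmax ⟨i, m⟩ (by simpa [T] using hm)
    rw [div_le_iff₀ (hpos m)] at this
    rw [weight_optionWeight]
    simp only at this
    linarith
  have hX : ∀ o : Option σ, IsWeightedHomogeneous (optionWeight w θ) (X o : MvPolynomial _ k)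
      (optionWeight w θ o) := fun o => isWeightedHomogeneous_X _ _ _
  have hs : ∀ i, WeightLE (optionWeight w θ) (w i) (X none * Z i) := fun i => by
    have := (WeightLE.isWeightedHomogeneous (hX none)).mul (hle i)
    simpa [optionWeight] using this
  have hP : ∀ i, WeightLE (optionWeight w θ) (w i) (X (some i) + X none * Z i) := fun i =>
    (WeightLE.isWeightedHomogeneous (hX (some i))).add (hs i)
  have hcomp : ∀ i, weightedHomogeneousComponent (optionWeight w θ) (w i)
      (X (some i) + X none * Z i) =
      X (some i) + X none * weightedHomogeneousComponent (optionWeight w θ) (w i + θ) (Z i) := by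
    intro i
    rw [map_add]
    congr 1
    · exact (hX (some i)).weightedHomogeneousComponent_same
    · have := weightedHomogeneousComponent_mul_of_weightLE
        (WeightLE.isWeightedHomogeneous (hX none)) (hle i)
      rw [(hX none).weightedHomogeneousComponent_same] at this
      rw [← this]
      congr 1
      simp [optionWeight]
  refine ⟨fun i => weightedHomogeneousComponent (optionWeight w θ) (w i + θ) (Z i), ?_, ?_⟩
  · intro h
    have h1 := congr_fun h i₀
    have h2 := congr_arg (coeff m₀) h1
    rw [coeff_weightedHomogeneousComponent, if_pos] at h2
    · have : coeff m₀ (Z i₀) ≠ 0 := by simpa [T] using h₀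
      exact this (by simpa using h2)
    · rw [weight_optionWeight]
      have := hpos m₀
      simp only [val] at hθ
      field_simp at hθ
      linarith
  · have h1 := weightedHomogeneousComponent_aeval hP hd
    simp only [hcomp] at h1
    rw [← h1, hF]
    have h2 := weightedHomogeneousComponent_aeval (v := w) (w := optionWeight w θ)
      (P := fun i => (X (some i) : MvPolynomial (Option σ) k))
      (fun i => WeightLE.isWeightedHomogeneous (hX (some i))) hd
    have h3 : ∀ i, weightedHomogeneousComponent (optionWeight w θ) (w i)
      (X (some i) : MvPolynomial (Option σ) k) = X (some i) := fun i =>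
        (hX (some i)).weightedHomogeneousComponent_same
    simp only [h3] at h2
    have h4 : (rename some : MvPolynomial σ k →ₐ[k] MvPolynomial (Option σ) k) =
        aeval fun i => X (some i) := by
      ext i : 1
      simp
    rwa [h4]

end Degeneration

theorem optionEquivLeft_rename_some {σ k : Type*} [CommRing k] (p : MvPolynomial σ k) :
    optionEquivLeft k σ (rename some p) = Polynomial.C p := by
  have : (optionEquivLeft k σ).toAlgHom.comp (rename some) =
      (Polynomial.CAlgHom (R := k) (A := MvPolynomial σ k)) := by
    ext i : 1
    simp [optionEquivLeft_X_some]
  exact DFunLike.congr_fun this p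

theorem aeval_coeff_zero {σ k : Type*} [CommRing k]
    {P : σ → Polynomial (MvPolynomial σ k)} (h0 : ∀ i, (P i).coeff 0 = X i)
    (p : MvPolynomial σ k) : (aeval P p).coeff 0 = p := by
  have : ((Polynomial.aeval (0 : MvPolynomial σ k)).restrictScalars k).comp (aeval P) =
      AlgHom.id k _ := by
    ext i : 1
    simp [← Polynomial.coeff_zero_eq_eval_zero, h0]
  have h := DFunLike.congr_fun this p
  simpa [← Polynomial.coeff_zero_eq_eval_zero] using h

/-- If a one-parameter family `P(s)` preserves `F`, it preserves every factor of `F`, because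
degrees in `s` are additive. -/
theorem aeval_eq_C_of_dvd {σ k : Type*} [Field k] {P : σ → Polynomial (MvPolynomial σ k)}
    (h0 : ∀ i, (P i).coeff 0 = X i) {F r : MvPolynomial σ k} (hF : F ≠ 0)
    (hP : aeval P F = Polynomial.C F) (hr : r ∣ F) : aeval P r = Polynomial.C r := by
  have h1 : aeval P r ∣ Polynomial.C F := hP ▸ map_dvd (aeval P) hr
  have h2 : (aeval P r).natDegree = 0 := by
    have := Polynomial.natDegree_le_of_dvd h1 (by simpa using hF)
    simpa using this
  rw [Polynomial.eq_C_of_natDegree_eq_zero h2, aeval_coeff_zero h0]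

namespace PolyAut

variable {n : ℕ} {k : Type u} [CommRing k]

theorem comap_coord_inv (g : PolyAut n k) (i : Fin n) :
    bind₁ g.val.coord ((g⁻¹).val.coord i) = X i :=
  congr_arg (fun h : PolyEnd n k => h.coord i) g.inv_val

theorem comap_inv_coord (g : PolyAut n k) (i : Fin n) :
    bind₁ (g⁻¹).val.coord (g.val.coord i) = X i :=
  congr_arg (fun h : PolyEnd n k => h.coord i) g.val_inv

end PolyAut

/-- The component `F` of an automorphism `(F, G)` is invariant under the translations of `G`. Hence
each leading form of `F` is invariant under a nonconstant one-parameter family. -/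
theorem exists_family_leadingForm {k : Type u} [Field k] (g : PolyAut 2 k) {w : Fin 2 → ℚ} {d : ℚ}
    (hd : WeightLE w d (g.val.coord 0)) :
    ∃ P : Fin 2 → Polynomial (MvPolynomial (Fin 2) k), (∀ i, (P i).coeff 0 = X i) ∧
      (¬ ∀ i, P i = Polynomial.C (X i)) ∧
      aeval P (weightedHomogeneousComponent w d (g.val.coord 0)) =
        Polynomial.C (weightedHomogeneousComponent w d (g.val.coord 0)) := by
  set F := g.val.coord 0 with hF
  set G := g.val.coord 1 with hG
  let E := optionEquivLeft k (Fin 2)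
  let Q : Fin 2 → Polynomial (MvPolynomial (Fin 2) k) :=
    ![Polynomial.C F, Polynomial.C G + Polynomial.X]
  let P : Fin 2 → Polynomial (MvPolynomial (Fin 2) k) := fun i => aeval Q ((g⁻¹).val.coord i)
  have hP0 : ∀ i, (P i).coeff 0 = X i := by
    intro i
    have h1 : ((Polynomial.aeval (0 : MvPolynomial (Fin 2) k)).restrictScalars k).comp (aeval Q) =
        bind₁ g.val.coord := by
      ext j : 1
      fin_cases j <;> simp [Q, hF, hG]
    have h2 := DFunLike.congr_fun h1 ((g⁻¹).val.coord i)
    rw [PolyAut.comap_coord_inv] at h2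
    simpa [← Polynomial.coeff_zero_eq_eval_zero] using h2
  have hPg : ∀ j, aeval P (g.val.coord j) = Q j := by
    intro j
    have := aeval_bind₁ Q (g⁻¹).val.coord (g.val.coord j)
    rw [PolyAut.comap_inv_coord, aeval_X] at this
    exact this.symm
  let Z : Fin 2 → MvPolynomial (Option (Fin 2)) k := fun i => E.symm (P i).divX
  have hPZ : ∀ i, E (X (some i) + X none * Z i) = P i := by
    intro i
    rw [map_add, map_mul, optionEquivLeft_X_some, optionEquivLeft_X_none, AlgEquiv.apply_symm_apply]
    conv_rhs => rw [← Polynomial.X_mul_divX_add (P i), hP0]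
    ring
  have hE : ∀ (W : Fin 2 → MvPolynomial (Option (Fin 2)) k) (p : MvPolynomial (Fin 2) k),
      E (aeval W p) = aeval (fun i => E (W i)) p := by
    intro W p
    exact DFunLike.congr_fun (comp_aeval W E.toAlgHom) p
  have hZF : aeval (fun i => X (some i) + X none * Z i) F = rename some F := by
    apply E.injective
    rw [hE, optionEquivLeft_rename_some]
    simp only [hPZ]
    exact hPg 0
  have hZ : Z ≠ 0 := by
    intro h
    have h1 : ∀ i, P i = Polynomial.C (X i) := by
      intro i
      rw [← hPZ i, h]
      simp [E, optionEquivLeft_X_some]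
    have h2 := hPg 1
    have h3 : aeval P G = Polynomial.C G := by
      have : aeval P = (Polynomial.CAlgHom (R := k) (A := MvPolynomial (Fin 2) k)) := by
        ext j : 1
        simp [h1]
      rw [this]; rfl
    rw [← hG, h3] at h2
    have h4 := congr_arg (fun q => Polynomial.coeff q 1) h2
    simp [Q] at h4
  obtain ⟨Z', hZ', hZF'⟩ := exists_degeneration hZ hZF hd
  refine ⟨fun i => E (X (some i) + X none * Z' i), ?_, ?_, ?_⟩
  · intro i
    simp [E, optionEquivLeft_X_some, optionEquivLeft_X_none]
  · intro h
    apply hZ'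
    funext i
    have h1 : E (X (some i) + X none * Z' i) = Polynomial.C (X i) := h i
    rw [map_add, map_mul, optionEquivLeft_X_some, optionEquivLeft_X_none, add_eq_left] at h1
    have h2 : E (Z' i) = 0 := by
      rcases mul_eq_zero.mp h1 with h | h
      · exact absurd h Polynomial.X_ne_zero
      · exact h
    simpa using h2
  · rw [← hE, hZF', optionEquivLeft_rename_some]

/-! ### Polynomial solutions of `A ^ m - c B ^ n = r` -/

section MasonStothers

variable {R : Type*} [CommRing R] [IsDomain R]

/-- If the characteristic does not divide `m n`, the derivatives of a solution vanish: otherwise the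
derivative of the equation shows that `B ^ (n - 1)` divides `A'` and `A ^ (m - 1)` divides `B'`, up
to constants, which is impossible for reasons of degree. -/
theorem derivative_eq_zero_of_pow_sub_pow_eq_C {A B : Polynomial R} {c r : R} (hc : c ≠ 0)
    (hr : r ≠ 0) {m n : ℕ} (hm : 2 ≤ m) (hn : 2 ≤ n) (hmR : (m : R) ≠ 0) (hnR : (n : R) ≠ 0)
    (h : A ^ m - Polynomial.C c * B ^ n = Polynomial.C r) :
    Polynomial.derivative A = 0 ∧ Polynomial.derivative B = 0 := by
  obtain ⟨m, rfl⟩ := Nat.exists_eq_add_of_le' (by omega : 1 ≤ m)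
  obtain ⟨n, rfl⟩ := Nat.exists_eq_add_of_le' (by omega : 1 ≤ n)
  have hd := congr_arg Polynomial.derivative h
  simp only [Polynomial.derivative_sub, Polynomial.derivative_C_mul, Polynomial.derivative_C,
    Polynomial.derivative_pow_succ] at hd
  set M : R := ((m + 1 : ℕ) : R) with hM
  set N : R := ((n + 1 : ℕ) : R) with hN
  have hM' : (m : R) + 1 = M := by simp [hM]
  have hN' : (n : R) + 1 = N := by simp [hN]
  rw [hM', hN'] at hd
  set A' := Polynomial.derivative A
  set B' := Polynomial.derivative B
  have e1 : Polynomial.C (M * r) * A' =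
      B ^ n * (Polynomial.C c * (Polynomial.C N * A * B' - Polynomial.C M * B * A')) := by
    rw [map_mul, ← h]
    linear_combination A * hd
  have e2 : Polynomial.C (c * N * r) * B' =
      A ^ m * (Polynomial.C c * (Polynomial.C N * A * B' - Polynomial.C M * B * A')) := by
    rw [map_mul, map_mul, ← h]
    linear_combination Polynomial.C c * B * hd
  have key : ∀ {U V W : Polynomial R} {a : R} {l : ℕ}, a ≠ 0 → V ≠ 0 →
      Polynomial.C a * V = U ^ l * W → l * U.natDegree ≤ V.natDegree := by
    intro U V W a l ha hV hUV
    have h1 : U ^ l ∣ Polynomial.C a * V := ⟨W, hUV⟩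
    have h2 := Polynomial.natDegree_le_of_dvd h1 (mul_ne_zero (by simpa using ha) hV)
    rwa [Polynomial.natDegree_pow, Polynomial.natDegree_C_mul ha] at h2
  have lt : ∀ {U : Polynomial R}, Polynomial.derivative U ≠ 0 →
      (Polynomial.derivative U).natDegree < U.natDegree := by
    intro U hU
    refine Polynomial.natDegree_derivative_lt fun h0 => hU ?_
    rw [Polynomial.eq_C_of_natDegree_eq_zero h0, Polynomial.derivative_C]
  have hMr : M * r ≠ 0 := mul_ne_zero hmR hr
  have hNr : c * N * r ≠ 0 := mul_ne_zero (mul_ne_zero hc hnR) hr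
  by_cases hA : A' = 0
  · refine ⟨hA, ?_⟩
    by_contra hB
    have h0 : B ^ n * B' = 0 := by
      rw [hA] at hd
      have : Polynomial.C (c * N) * (B ^ n * B') = 0 := by
        rw [map_mul]; linear_combination -hd
      rcases mul_eq_zero.mp this with h1 | h1
      · exact absurd (by simpa using h1) (mul_ne_zero hc hnR)
      · exact h1
    rcases mul_eq_zero.mp h0 with h1 | h1
    · have : B = 0 := eq_zero_of_pow_eq_zero h1
      exact hB (by simp [B', this])
    · exact hB h1
  · exfalso
    by_cases hB : B' = 0
    · have h0 : Polynomial.C M * (A ^ m * A') = 0 := by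
        rw [hB] at hd; linear_combination hd
      rcases mul_eq_zero.mp h0 with h1 | h1
      · exact absurd (by simpa using h1) hmR
      · rcases mul_eq_zero.mp h1 with h1 | h1
        · have : A = 0 := eq_zero_of_pow_eq_zero h1
          exact hA (by simp [A', this])
        · exact hA h1
    · have i1 := key hMr hA e1
      have i2 := key hNr hB e2
      have i3 : A'.natDegree < A.natDegree := lt hA
      have i4 : B'.natDegree < B.natDegree := lt hB
      have i5 : B.natDegree ≤ n * B.natDegree := Nat.le_mul_of_pos_left _ (by omega)
      have i6 : A.natDegree ≤ m * A.natDegree := Nat.le_mul_of_pos_left _ (by omega)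
      omega

/-- Solutions of `A ^ m - c B ^ n = r` are constant if the characteristic does not divide `m n`.
If both derivatives vanish, `A` and `B` are polynomials in `s ^ p`, and the degree drops. -/
theorem natDegree_eq_zero_of_pow_sub_pow_eq_C {c r : R} (hc : c ≠ 0) (hr : r ≠ 0) {m n : ℕ}
    (hm : 2 ≤ m) (hn : 2 ≤ n) (hmR : (m : R) ≠ 0) (hnR : (n : R) ≠ 0) (d : ℕ) :
    ∀ A B : Polynomial R, A.natDegree + B.natDegree = d →
      A ^ m - Polynomial.C c * B ^ n = Polynomial.C r → A.natDegree + B.natDegree = 0 := by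
  induction d using Nat.strong_induction_on with
  | _ d ih =>
    intro A B hd h
    obtain ⟨hA, hB⟩ := derivative_eq_zero_of_pow_sub_pow_eq_C hc hr hm hn hmR hnR h
    obtain ⟨p, hp⟩ := CharP.exists R
    rcases CharP.char_is_prime_or_zero R p with hpp | rfl
    · have := Fact.mk hpp
      rw [← Polynomial.expand_contract p hA hpp.ne_zero,
        ← Polynomial.expand_contract p hB hpp.ne_zero] at h hd ⊢
      rw [Polynomial.natDegree_expand, Polynomial.natDegree_expand, ← add_mul] at hd ⊢
      rw [← Polynomial.expand_C p c, ← map_pow, ← map_pow, ← map_mul, ← map_sub,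
        ← Polynomial.expand_C p r] at h
      have h1 := Polynomial.expand_injective hpp.pos h
      by_contra h0
      have h2 : 0 < (Polynomial.contract p A).natDegree + (Polynomial.contract p B).natDegree :=
        Nat.pos_of_ne_zero fun h => h0 (by rw [h, zero_mul])
      have h3 := ih _ (by rw [← hd]; exact lt_mul_of_one_lt_right h2 hpp.one_lt) _ _ rfl h1
      omega
    · have := CharP.charP_to_charZero R
      have h1 := Polynomial.derivative_eq_zero.mp hA
      have h2 := Polynomial.derivative_eq_zero.mp hB
      omega

end MasonStothers

/-- The derivation of `R[s]` acting on coefficients by a derivation of `R`. -/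
def coeffDerivation {k R : Type*} [CommRing k] [CommRing R] [Algebra k R] (D : Derivation k R R) :
    Derivation k (Polynomial R) (Polynomial R) :=
  PolynomialModule.equivPolynomialSelf.compDer D.mapCoeffs

theorem coeffDerivation_C {k R : Type*} [CommRing k] [CommRing R] [Algebra k R]
    (D : Derivation k R R) (r : R) : coeffDerivation D (Polynomial.C r) = Polynomial.C (D r) := by
  ext i
  have : (coeffDerivation D (Polynomial.C r)).coeff i = D ((Polynomial.C r).coeff i) := rfl
  rw [this, Polynomial.coeff_C, Polynomial.coeff_C]
  split_ifs <;> simp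

/-- The case in which the characteristic divides `n`: differentiate in a variable of the coefficient
ring on which only `A ^ m` depends. -/
theorem natDegree_eq_zero_of_pow_sub_pow_eq_C_of_derivation {k R : Type*} [CommRing k] [CommRing R]
    [IsDomain R] [Algebra k R] (D : Derivation k R R) {A B : Polynomial R} {a b : k} {x r : R}
    {m n : ℕ} (hm : 2 ≤ m) (hn : (n : R) = 0) (hma : algebraMap k R a * (m : R) ≠ 0) (hx : x ≠ 0)
    (hr : D r = algebraMap k R a * m * x ^ (m - 1))
    (h : Polynomial.C (algebraMap k R a) * A ^ m + Polynomial.C (algebraMap k R b) * B ^ n =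
      Polynomial.C r) : A.natDegree = 0 := by
  have h1 := congr_arg (coeffDerivation D) h
  have hn' : ((n : ℕ) : Polynomial R) = 0 := by
    rw [← Polynomial.C_eq_natCast, hn, Polynomial.C_0]
  rw [map_add, Derivation.leibniz, Derivation.leibniz, coeffDerivation_C, coeffDerivation_C,
    coeffDerivation_C, D.map_algebraMap, D.map_algebraMap, Derivation.leibniz_pow,
    Derivation.leibniz_pow, hr] at h1
  simp only [map_zero, add_zero, smul_eq_mul, nsmul_eq_mul, hn', zero_mul, mul_zero]
    at h1
  have h2 : A ∣ Polynomial.C (algebraMap k R a * m * x ^ (m - 1)) := by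
    rw [← h1]
    exact Dvd.dvd.mul_left (Dvd.dvd.mul_left (Dvd.dvd.mul_right
      (dvd_pow_self A (by omega)) _) _) _
  have h3 := Polynomial.natDegree_le_of_dvd h2
    (Polynomial.C_ne_zero.mpr (mul_ne_zero hma (pow_ne_zero _ hx)))
  rwa [Polynomial.natDegree_C, Nat.le_zero] at h3

/-- A binomial `x ^ m - c y ^ n` with coprime `m, n ≥ 2` is not invariant under a nonconstant
one-parameter family of substitutions. -/
theorem eq_one_or_eq_one_of_family {k : Type*} [Field k]
    {P : Fin 2 → Polynomial (MvPolynomial (Fin 2) k)} (h0 : ∀ i, (P i).coeff 0 = X i)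
    (hne : ¬ ∀ i, P i = Polynomial.C (X i)) {c : k} (hc : c ≠ 0) {m n : ℕ} (hm : 1 ≤ m)
    (hn : 1 ≤ n) (hmn : m.Coprime n)
    (h : aeval P (X 0 ^ m - C c * X 1 ^ n) = Polynomial.C (X 0 ^ m - C c * X 1 ^ n)) :
    m = 1 ∨ n = 1 := by
  by_contra! hcon
  have hm2 : 2 ≤ m := by omega
  have hn2 : 2 ≤ n := by omega
  set r : MvPolynomial (Fin 2) k := X 0 ^ m - C c * X 1 ^ n with hr
  have hr0 : r ≠ 0 := by
    intro h1
    have := congr_arg (aeval (![1, 0] : Fin 2 → k)) h1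
    simp [hr, show n ≠ 0 by omega] at this
  have h1 : P 0 ^ m - Polynomial.C (C c) * P 1 ^ n = Polynomial.C r := by
    rw [← h]
    simp only [hr, map_sub, map_mul, map_pow, aeval_X, algHom_C]
    rfl
  have hcast : ∀ l : ℕ, ((l : ℕ) : MvPolynomial (Fin 2) k) = 0 ↔ (l : k) = 0 := by
    intro l
    rw [← map_natCast (C : k →+* MvPolynomial (Fin 2) k) l, map_eq_zero_iff _ (C_injective _ _)]
  have hnot : ¬ ((m : k) = 0 ∧ (n : k) = 0) := by
    rintro ⟨h2, h3⟩
    have h4 := (CharP.cast_eq_zero_iff k (ringChar k) m).mp h2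
    have h5 := (CharP.cast_eq_zero_iff k (ringChar k) n).mp h3
    have h6 : ringChar k = 1 := Nat.dvd_one.mp (hmn ▸ Nat.dvd_gcd h4 h5)
    exact CharP.ringChar_ne_one h6
  have hconst : (P 0).natDegree = 0 ∧ (P 1).natDegree = 0 → False := by
    rintro ⟨h2, h3⟩
    apply hne
    intro i
    have : (P i).natDegree = 0 := by fin_cases i; exacts [h2, h3]
    rw [Polynomial.eq_C_of_natDegree_eq_zero this, h0]
  have hCc : (C c : MvPolynomial (Fin 2) k) ≠ 0 := by simpa using hc
  have h01 : (P 0).natDegree = 0 → (P 1).natDegree = 0 := by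
    intro h2
    have h3 : Polynomial.C (C c) * P 1 ^ n = Polynomial.C ((P 0).coeff 0 ^ m - r) := by
      rw [map_sub, ← h1, map_pow, ← Polynomial.eq_C_of_natDegree_eq_zero h2]; ring
    have h4 := congr_arg Polynomial.natDegree h3
    rw [Polynomial.natDegree_C_mul hCc, Polynomial.natDegree_pow, Polynomial.natDegree_C] at h4
    exact (mul_eq_zero.mp h4).resolve_left (by omega)
  have h10 : (P 1).natDegree = 0 → (P 0).natDegree = 0 := by
    intro h2
    have h3 : P 0 ^ m = Polynomial.C (C c * (P 1).coeff 0 ^ n + r) := by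
      rw [map_add, ← h1, map_mul, map_pow, ← Polynomial.eq_C_of_natDegree_eq_zero h2]; ring
    have h4 := congr_arg Polynomial.natDegree h3
    rw [Polynomial.natDegree_pow, Polynomial.natDegree_C] at h4
    exact (mul_eq_zero.mp h4).resolve_left (by omega)
  by_cases hn0 : (n : k) = 0
  · have hm0 : (m : k) ≠ 0 := fun h => hnot ⟨h, hn0⟩
    have h2 := natDegree_eq_zero_of_pow_sub_pow_eq_C_of_derivation (k := k)
      (pderiv (R := k) (0 : Fin 2)) (A := P 0) (B := P 1) (a := 1) (b := -c) (x := X 0) (r := r)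
      hm2 ((hcast n).mpr hn0) (by rw [map_one, one_mul]; exact fun h => hm0 ((hcast m).mp h))
      (X_ne_zero _)
      (by simp [hr, Derivation.leibniz, Derivation.leibniz_pow])
      (by rw [← h1]; simp [algebraMap_eq]; ring)
    exact hconst ⟨h2, h01 h2⟩
  · by_cases hm0 : (m : k) = 0
    · have h2 := natDegree_eq_zero_of_pow_sub_pow_eq_C_of_derivation (k := k)
        (pderiv (R := k) (1 : Fin 2)) (A := P 1) (B := P 0) (a := -c) (b := 1) (x := X 1) (r := r)
        hn2 ((hcast m).mpr hm0)
        (mul_ne_zero (by rw [algebraMap_eq, map_neg]; exact neg_ne_zero.mpr hCc)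
          fun h => hn0 ((hcast n).mp h))
        (X_ne_zero _)
        (by simp [hr, Derivation.leibniz, Derivation.leibniz_pow, algebraMap_eq]; ring)
        (by rw [← h1]; simp [algebraMap_eq]; ring)
      exact hconst ⟨h10 h2, h2⟩
    · have h2 := natDegree_eq_zero_of_pow_sub_pow_eq_C hCc hr0 hm2 hn2
        (fun h => hm0 ((hcast m).mp h)) (fun h => hn0 ((hcast n).mp h)) _ (P 0) (P 1) rfl h1
      exact hconst ⟨by omega, by omega⟩

/-! ### The leading form of a component of an automorphism of the plane -/

theorem X_pow_dvd_of_forall_le {σ k : Type*} [CommRing k] {p : MvPolynomial σ k} {i : σ} {j : ℕ}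
    (h : ∀ m ∈ p.support, j ≤ m i) : (X i : MvPolynomial σ k) ^ j ∣ p := by
  rw [p.as_sum]
  refine Finset.dvd_sum fun m hm => ?_
  rw [X_pow_eq_monomial]
  refine ⟨monomial (m - Finsupp.single i j) (coeff m p), ?_⟩
  rw [monomial_mul, one_mul, add_tsub_cancel_of_le (Finsupp.single_le_iff.mpr (h m hm))]

theorem weight_fin_two (a b : ℚ) (m : Fin 2 →₀ ℕ) :
    Finsupp.weight ![a, b] m = m 0 * a + m 1 * b := by
  rw [Finsupp.weight_eq_sum]
  simp

/-- A combination of the monomials `a ^ i b ^ (g - i)` whose dehomogenization has the root `c` is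
divisible by `a - c b`. -/
theorem sub_dvd_sum_of_isRoot {k R : Type*} [CommRing k] [CommRing R] [Algebra k R] (q : ℕ → k)
    (g : ℕ) {c : k} (hc : ∑ i ∈ Finset.range (g + 1), q i * c ^ i = 0) (a b : R) :
    a - algebraMap k R c * b ∣
      ∑ i ∈ Finset.range (g + 1), algebraMap k R (q i) * (a ^ i * b ^ (g - i)) := by
  have h1 : ∑ i ∈ Finset.range (g + 1), algebraMap k R (q i) * (a ^ i * b ^ (g - i)) =
      ∑ i ∈ Finset.range (g + 1), algebraMap k R (q i) * b ^ (g - i) *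
        (a ^ i - (algebraMap k R c * b) ^ i) := by
    have h2 : ∑ i ∈ Finset.range (g + 1), algebraMap k R (q i) * b ^ (g - i) *
        (algebraMap k R c * b) ^ i = 0 := by
      have : ∀ i ∈ Finset.range (g + 1), algebraMap k R (q i) * b ^ (g - i) *
          (algebraMap k R c * b) ^ i = algebraMap k R (q i * c ^ i) * b ^ g := by
        intro i hi
        have hi' : g = (g - i) + i := by have := Finset.mem_range.mp hi; omega
        conv_rhs => rw [hi', pow_add]
        rw [map_mul, map_pow, mul_pow]
        ring
      rw [Finset.sum_congr rfl this, ← Finset.sum_mul, ← map_sum, hc, map_zero, zero_mul]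
    rw [← sub_zero (∑ i ∈ Finset.range (g + 1), algebraMap k R (q i) * (a ^ i * b ^ (g - i))),
      ← h2, ← Finset.sum_sub_distrib]
    exact Finset.sum_congr rfl fun i _ => by ring
  rw [h1]
  exact Finset.dvd_sum fun i _ => Dvd.dvd.mul_left (sub_dvd_pow_sub_pow _ _ _) _

theorem exists_mem_support_of_not_X_dvd {σ k : Type*} [CommRing k] {p : MvPolynomial σ k} {i : σ}
    (h : ¬ (X i : MvPolynomial σ k) ∣ p) : ∃ m ∈ p.support, m i = 0 := by
  by_contra! hcon
  refine h ?_
  have := X_pow_dvd_of_forall_le (p := p) (i := i) (j := 1) fun m hm =>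
    Nat.one_le_iff_ne_zero.mpr (hcon m hm)
  simpa using this

theorem exists_mem_support_degreeOf {σ k : Type*} [CommRing k] {p : MvPolynomial σ k}
    (hp : p ≠ 0) (i : σ) : ∃ m ∈ p.support, m i = degreeOf i p := by
  classical
  rw [degreeOf_eq_sup]
  obtain ⟨m, hm, h⟩ := Finset.exists_mem_eq_sup p.support (support_nonempty.mpr hp) fun m => m i
  exact ⟨m, hm, h.symm⟩

/-- The Newton polygon of a component of an automorphism of the plane is a triangle, and the leading
form along its hypotenuse is divisible by a binomial that is linear in one of the variables. -/
theorem exists_binomial_dvd_leadingForm {k : Type u} [Field k] [IsAlgClosed k] (g : PolyAut 2 k)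
    {α β : ℕ} (hα : degreeOf 0 (g.val.coord 0) = α) (hβ : degreeOf 1 (g.val.coord 0) = β)
    (hα1 : 1 ≤ α) (hβ1 : 1 ≤ β) :
    WeightLE ![(β : ℚ), (α : ℚ)] (α * β) (g.val.coord 0) ∧
    ∃ (m n : ℕ) (c : k), 1 ≤ m ∧ 1 ≤ n ∧ α * n = β * m ∧ (m = 1 ∨ n = 1) ∧ c ≠ 0 ∧
      X 0 ^ m - C c * X 1 ^ n ∣
        weightedHomogeneousComponent ![(β : ℚ), (α : ℚ)] (α * β) (g.val.coord 0) := by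
  classical
  set F := g.val.coord 0 with hF
  have hF0 : F ≠ 0 := by rintro h; rw [h] at hα; simp at hα; omega
  have hαQ : (1 : ℚ) ≤ α := by exact_mod_cast hα1
  have hβQ : (1 : ℚ) ≤ β := by exact_mod_cast hβ1
  set w : Fin 2 → ℚ := ![(β : ℚ), (α : ℚ)] with hw
  obtain ⟨m₀, hm₀, hmax⟩ := F.support.exists_max_image (fun m => Finsupp.weight w m)
    (support_nonempty.mpr hF0)
  have hle : ∀ {m : Fin 2 →₀ ℕ}, m ∈ F.support → m 0 ≤ α ∧ m 1 ≤ β := fun {m} hm =>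
    ⟨hα ▸ monomial_le_degreeOf 0 hm, hβ ▸ monomial_le_degreeOf 1 hm⟩
  obtain ⟨s, hs, hs0⟩ := exists_mem_support_degreeOf hF0 0
  obtain ⟨t, ht, ht1⟩ := exists_mem_support_degreeOf hF0 1
  rw [hα] at hs0
  rw [hβ] at ht1
  -- The leading form is not divisible by both variables, so it involves the power of a variable.
  have hd : Finsupp.weight w m₀ = α * β := by
    set d := Finsupp.weight w m₀ with hd
    have hWd : WeightLE w d F := fun m hm => hmax m (mem_support_iff.mpr hm)
    obtain ⟨P, hP0, hPne, hP⟩ := exists_family_leadingForm g hWd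
    rw [← hF] at hP
    set F' := weightedHomogeneousComponent w d F with hF'
    have hF'0 : F' ≠ 0 := by
      intro h
      have := congr_arg (coeff m₀) h
      rw [hF', coeff_weightedHomogeneousComponent, if_pos hd.symm] at this
      exact mem_support_iff.mp hm₀ (by simpa using this)
    have hex : ∃ i : Fin 2, ¬ (X i : MvPolynomial (Fin 2) k) ∣ F' := by
      by_contra! hcon
      refine hPne fun i => ?_
      have := aeval_eq_C_of_dvd hP0 hF'0 hP (hcon i)
      rwa [aeval_X] at this
    obtain ⟨i, hi⟩ := hex
    obtain ⟨m, hm, hmi⟩ := exists_mem_support_of_not_X_dvd hi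
    rw [hF', support_weightedHomogeneousComponent, Finset.mem_filter] at hm
    have h1 := hle hm.1
    have h2 := hmax s hs
    have h3 := hmax t ht
    have h4 := hm.2
    rw [hw, weight_fin_two] at h4
    simp only [hw, weight_fin_two] at h2 h3
    rw [hs0] at h2
    rw [ht1] at h3
    have h5 : (m 0 : ℚ) ≤ α := by exact_mod_cast h1.1
    have h6 : (m 1 : ℚ) ≤ β := by exact_mod_cast h1.2
    have h7 : (0 : ℚ) ≤ s 1 * α := by positivity
    fin_cases i
    · have h0 : (m 0 : ℚ) = 0 := by exact_mod_cast hmi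
      nlinarith
    · have h0 : (m 1 : ℚ) = 0 := by exact_mod_cast hmi
      nlinarith
  have hW : WeightLE w (α * β) F := fun m hm => hd ▸ hmax m (mem_support_iff.mpr hm)
  refine ⟨hW, ?_⟩
  obtain ⟨P, hP0, hPne, hP⟩ := exists_family_leadingForm g hW
  rw [← hF] at hP
  set F' := weightedHomogeneousComponent w (α * β) F with hF'
  have hF'0 : F' ≠ 0 := by
    intro h
    have := congr_arg (coeff m₀) h
    rw [hF', coeff_weightedHomogeneousComponent, if_pos hd] at this
    exact mem_support_iff.mp hm₀ (by simpa using this)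
  have hs1 : s 1 = 0 := by
    have h2 := hW s (mem_support_iff.mp hs)
    rw [hw, weight_fin_two, hs0] at h2
    have h3 : (s 1 : ℚ) * α ≤ 0 := by linarith
    have h4 : (s 1 : ℚ) ≤ 0 := by nlinarith
    exact_mod_cast le_antisymm h4 (by positivity)
  have ht0 : t 0 = 0 := by
    have h2 := hW t (mem_support_iff.mp ht)
    rw [hw, weight_fin_two, ht1] at h2
    have h3 : (t 0 : ℚ) * β ≤ 0 := by linarith
    have h4 : (t 0 : ℚ) ≤ 0 := by nlinarith
    exact_mod_cast le_antisymm h4 (by positivity)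
  -- The leading form is a form of degree `g'` in `x ^ m` and `y ^ n`.
  obtain ⟨g', m, n, hg', hmn, hαm, hβn⟩ := Nat.exists_coprime' (Nat.gcd_pos_of_pos_left β hα1)
  have hm1 : 1 ≤ m := Nat.pos_of_ne_zero (by rintro rfl; omega)
  have hn1 : 1 ≤ n := Nat.pos_of_ne_zero (by rintro rfl; omega)
  let e : ℕ → (Fin 2 →₀ ℕ) := fun i => Finsupp.single 0 (m * i) + Finsupp.single 1 (n * (g' - i))
  have he0 : ∀ i, e i 0 = m * i := fun i => by simp [e]
  have he1 : ∀ i, e i 1 = n * (g' - i) := fun i => by simp [e]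
  let q : ℕ → k := fun i => coeff (e i) F
  have hF'sum : F' = ∑ i ∈ Finset.range (g' + 1), monomial (e i) (q i) := by
    ext μ
    rw [coeff_sum, hF', coeff_weightedHomogeneousComponent]
    simp only [coeff_monomial]
    split_ifs with hμ
    · have h1 : μ 0 * n + μ 1 * m = g' * m * n := by
        rw [hw, weight_fin_two, hαm, hβn] at hμ
        have hg'' : (0 : ℚ) < g' := by exact_mod_cast hg'
        push_cast at hμ
        have : (μ 0 : ℚ) * n + μ 1 * m = g' * m * n := by
          apply mul_left_cancel₀ hg''.ne'
          linear_combination hμ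
        exact_mod_cast this
      have h2 : m ∣ μ 0 := by
        have : m ∣ μ 0 * n := by
          rw [← Nat.dvd_add_left (Dvd.intro_left (μ 1) rfl : m ∣ μ 1 * m), h1]
          exact ⟨g' * n, by ring⟩
        exact hmn.dvd_of_dvd_mul_right this
      obtain ⟨i₀, hi₀⟩ := h2
      have h3 : i₀ * n + μ 1 = g' * n := by
        apply Nat.eq_of_mul_eq_mul_left hm1
        rw [hi₀] at h1
        linarith [h1]
      have h4 : i₀ ≤ g' := by
        by_contra! hlt
        have := Nat.mul_lt_mul_of_pos_right hlt hn1
        omega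
      have h5 : e i₀ = μ := by
        ext j
        fin_cases j
        · exact (he0 _).trans hi₀.symm
        · refine (he1 _).trans ?_
          rw [mul_comm, Nat.sub_mul]
          simp only [Fin.mk_one]
          omega
      rw [Finset.sum_eq_single i₀]
      · rw [if_pos h5, ← h5]
      · intro j _ hj
        rw [if_neg]
        intro h6
        have h7 := he0 j
        rw [h6, hi₀] at h7
        exact hj (Nat.eq_of_mul_eq_mul_left hm1 h7).symm
      · intro h6
        exact absurd (Finset.mem_range.mpr (by omega)) h6
    · symm
      refine Finset.sum_eq_zero fun i hi => if_neg ?_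
      rintro rfl
      apply hμ
      rw [hw, weight_fin_two, he0, he1, hαm, hβn]
      have : i ≤ g' := by have := Finset.mem_range.mp hi; omega
      push_cast [this]
      ring
  let Q : Polynomial k := ∑ i ∈ Finset.range (g' + 1), Polynomial.C (q i) * Polynomial.X ^ i
  have hQc : ∀ i ≤ g', Q.coeff i = q i := by
    intro i hi
    simp only [Q, Polynomial.finsetSum_coeff, Polynomial.coeff_C_mul_X_pow]
    rw [Finset.sum_ite_eq, if_pos (Finset.mem_range.mpr (by omega))]
  have hes : e g' = s := by
    ext j
    fin_cases j
    · exact (he0 _).trans (by rw [← hαm]; exact hs0.symm)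
    · exact (he1 _).trans (by rw [Nat.sub_self, mul_zero]; exact hs1.symm)
  have het : e 0 = t := by
    ext j
    fin_cases j
    · exact (he0 _).trans ht0.symm
    · exact (he1 _).trans (by rw [Nat.sub_zero, ← hβn]; exact ht1.symm)
  have hQg : Q.coeff g' ≠ 0 := by
    rw [hQc _ le_rfl]; simp only [q]; rw [hes]; exact mem_support_iff.mp hs
  have hQ0 : Q.coeff 0 ≠ 0 := by
    rw [hQc _ (Nat.zero_le _)]; simp only [q]; rw [het]; exact mem_support_iff.mp ht
  have hQdeg : Q.degree ≠ 0 := by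
    intro h
    have h1 : Q.natDegree = 0 := Polynomial.natDegree_eq_of_degree_eq_some h
    have h2 := Polynomial.le_natDegree_of_ne_zero hQg
    omega
  -- The leading form involves the powers of both variables, so its dehomogenization `Q` has a
  -- nonzero root.
  obtain ⟨c, hc⟩ := IsAlgClosed.exists_root Q hQdeg
  have hc0 : c ≠ 0 := by
    rintro rfl
    rw [Polynomial.IsRoot, ← Polynomial.coeff_zero_eq_eval_zero] at hc
    exact hQ0 hc
  have hcsum : ∑ i ∈ Finset.range (g' + 1), q i * c ^ i = 0 := by
    have : Q.eval c = 0 := hc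
    simpa [Q, Polynomial.eval_finsetSum] using this
  have hdvd : X 0 ^ m - C c * X 1 ^ n ∣ F' := by
    have h1 := sub_dvd_sum_of_isRoot (R := MvPolynomial (Fin 2) k) q g' hcsum (X 0 ^ m) (X 1 ^ n)
    rw [algebraMap_eq] at h1
    convert h1 using 1
    rw [hF'sum]
    refine Finset.sum_congr rfl fun i _ => ?_
    rw [← pow_mul, ← pow_mul, X_pow_eq_monomial, X_pow_eq_monomial, monomial_mul, C_mul_monomial]
    simp [e]
  refine ⟨m, n, c, hm1, hn1, by rw [hαm, hβn]; ring, ?_, hc0, hdvd⟩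
  exact eq_one_or_eq_one_of_family hP0 hPne hc0 hm1 hn1 hmn
    (aeval_eq_C_of_dvd hP0 hF'0 hP hdvd)

/-! ### Triangular and affine automorphisms -/

namespace PolyAut

variable {k : Type u}

theorem ext_coord {n : ℕ} [CommRing k] {f g : PolyAut n k}
    (h : ∀ i, f.val.coord i = g.val.coord i) : f = g :=
  Units.ext (PolyEnd.ext (funext h))

theorem coord_mul {n : ℕ} [CommRing k] (f g : PolyAut n k) (i : Fin n) :
    (f * g).val.coord i = bind₁ g.val.coord (f.val.coord i) := rfl

theorem coord_one {n : ℕ} [CommRing k] (i : Fin n) :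
    (1 : PolyAut n k).val.coord i = X i := rfl

variable (k) in
/-- The automorphism `(y, x)`. -/
def swap [CommRing k] : PolyAut 2 k where
  val := ⟨![X 1, X 0]⟩
  inv := ⟨![X 1, X 0]⟩
  val_inv := by
    ext1; funext i
    fin_cases i <;> simp [PolyEnd.coord_mul, PolyEnd.coord_one, PolyEnd.comap]
  inv_val := by
    ext1; funext i
    fin_cases i <;> simp [PolyEnd.coord_mul, PolyEnd.coord_one, PolyEnd.comap]

theorem bind₁_aeval_X [CommRing k] {σ τ : Type*} (Q : σ → MvPolynomial τ k) (i : σ)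
    (p : Polynomial k) :
    bind₁ Q (Polynomial.aeval (X i : MvPolynomial σ k) p) = Polynomial.aeval (Q i) p := by
  rw [← Polynomial.aeval_algHom_apply, bind₁_X_right]

/-- The elementary automorphism `(x, y + p(x))`. -/
def shear [CommRing k] (p : Polynomial k) : PolyAut 2 k where
  val := ⟨![X 0, X 1 + Polynomial.aeval (X 0) p]⟩
  inv := ⟨![X 0, X 1 - Polynomial.aeval (X 0) p]⟩
  val_inv := by
    ext1; funext i
    fin_cases i
    · simp [PolyEnd.coord_mul, PolyEnd.coord_one, PolyEnd.comap]
    · simp [PolyEnd.coord_mul, PolyEnd.coord_one, PolyEnd.comap, bind₁_aeval_X]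
  inv_val := by
    ext1; funext i
    fin_cases i
    · simp [PolyEnd.coord_mul, PolyEnd.coord_one, PolyEnd.comap]
    · simp [PolyEnd.coord_mul, PolyEnd.coord_one, PolyEnd.comap, bind₁_aeval_X]

theorem coord_swap [CommRing k] : (swap k).val.coord = ![X 1, X 0] := rfl

theorem coord_shear [CommRing k] (p : Polynomial k) :
    (shear p).val.coord = ![X 0, X 1 + Polynomial.aeval (X 0) p] := rfl

theorem coord_ne_C {n : ℕ} [CommRing k] [Nontrivial k] (f : PolyAut n k) (i : Fin n) (c : k) :
    f.val.coord i ≠ C c := by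
  intro h
  have h1 := comap_inv_coord f i
  rw [h, bind₁_C_right] at h1
  have h2 := congr_arg (coeff (Finsupp.single i 1)) h1
  rw [coeff_X, coeff_C, if_neg] at h2
  · exact zero_ne_one (h2.trans (if_pos rfl))
  · intro h3
    have := DFunLike.congr_fun h3 i
    simp at this

variable [Field k]

variable (k) in
/-- The group of triangular automorphisms, which are those of the form `(a x + c, b y + p(x))`. It
suffices to require that the first component has this form; see `coord_of_coord_zero`. -/
def triangular : Subgroup (PolyAut 2 k) where
  carrier := {f | ∃ a c : k, f.val.coord 0 = C a * X 0 + C c}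
  one_mem' := ⟨1, 0, by simp [PolyEnd.coord_one]⟩
  mul_mem' := by
    rintro f g ⟨a, c, hf⟩ ⟨a', c', hg⟩
    refine ⟨a * a', a * c' + c, ?_⟩
    rw [coord_mul, hf, map_add, map_mul, bind₁_C_right, bind₁_C_right, bind₁_X_right, hg, C_mul,
      C_add, C_mul]
    ring
  inv_mem' := by
    rintro f ⟨a, c, hf⟩
    have ha : a ≠ 0 := by
      rintro rfl
      exact coord_ne_C f 0 c (by rw [hf]; simp)
    refine ⟨a⁻¹, -(a⁻¹ * c), ?_⟩
    have h := comap_inv_coord f 0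
    rw [hf, map_add, map_mul, bind₁_C_right, bind₁_C_right, bind₁_X_right] at h
    have h1 : (C a⁻¹ : MvPolynomial (Fin 2) k) * C a = 1 := by
      rw [← C_mul, inv_mul_cancel₀ ha, C_1]
    rw [C_neg, C_mul, ← h]
    linear_combination (-(f⁻¹).val.coord 0) * h1

/-- An automorphism whose first component is a polynomial in `x` has the form
`(a x + c, b y + p(x))`. -/
theorem coord_of_coord_zero {g : PolyAut 2 k} {f : Polynomial k}
    (hf : g.val.coord 0 = Polynomial.aeval (X 0) f) :
    ∃ (a c b : k) (p : Polynomial k), a ≠ 0 ∧ b ≠ 0 ∧ g.val.coord 0 = C a * X 0 + C c ∧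
      g.val.coord 1 = C b * X 1 + Polynomial.aeval (X 0) p := by
  let ε : MvPolynomial (Fin 2) k →ₐ[k] Polynomial (Polynomial k) :=
    aeval ![Polynomial.C Polynomial.X, Polynomial.X]
  let η : Polynomial (Polynomial k) →+* MvPolynomial (Fin 2) k :=
    Polynomial.eval₂RingHom (Polynomial.aeval (X 0 : MvPolynomial (Fin 2) k)).toRingHom (X 1)
  have hηε : ∀ q, η (ε q) = q := by
    have : (η.comp ε.toRingHom) = RingHom.id _ := by
      refine MvPolynomial.ringHom_ext (fun r => ?_) fun i => ?_
      · simp [η, ε, Polynomial.algebraMap_apply, algebraMap_eq]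
      · fin_cases i <;> simp [η, ε]
    exact fun q => DFunLike.congr_fun this q
  have hεF : ε (g.val.coord 0) = Polynomial.C f := by
    rw [hf, ← Polynomial.aeval_algHom_apply]
    have : ε (X 0) = Polynomial.CAlgHom (R := k) (Polynomial.X) := by simp [ε]
    rw [this, Polynomial.aeval_algHom_apply, Polynomial.aeval_X_left_apply]
    rfl
  set G' := ε (g.val.coord 1) with hG'
  have hcomp : ∀ q, ε (bind₁ g.val.coord q) =
      ((ε q).map (Polynomial.compRingHom f)).comp G' := by
    intro q
    rw [Polynomial.comp, Polynomial.eval₂_map]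
    have : ε.toRingHom.comp (bind₁ g.val.coord).toRingHom =
        (Polynomial.eval₂RingHom (Polynomial.C.comp (Polynomial.compRingHom f)) G').comp
          ε.toRingHom := by
      refine MvPolynomial.ringHom_ext (fun r => ?_) fun i => ?_
      · simp [ε, Polynomial.algebraMap_apply]
      · fin_cases i
        · simpa [ε] using hεF
        · simp [ε, hG']
    exact DFunLike.congr_fun this q
  have hx : (((ε ((g⁻¹).val.coord 0)).map (Polynomial.compRingHom f)).comp G') =
      Polynomial.C Polynomial.X := by
    rw [← hcomp, comap_coord_inv]; simp [ε]
  have hy : (((ε ((g⁻¹).val.coord 1)).map (Polynomial.compRingHom f)).comp G') =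
      Polynomial.X := by
    rw [← hcomp, comap_coord_inv]; simp [ε]
  set A := ε ((g⁻¹).val.coord 0)
  set B := ε ((g⁻¹).val.coord 1)
  have hyd := congr_arg Polynomial.natDegree hy
  rw [Polynomial.natDegree_comp, Polynomial.natDegree_X, mul_eq_one] at hyd
  have hxd := congr_arg Polynomial.natDegree hx
  rw [Polynomial.natDegree_comp, Polynomial.natDegree_C, hyd.2, mul_one] at hxd
  have hfdeg : f.natDegree = 1 := by
    rw [Polynomial.eq_C_of_natDegree_eq_zero hxd, Polynomial.C_comp, Polynomial.coeff_map] at hx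
    have h1 := congr_arg Polynomial.natDegree (Polynomial.C_injective hx)
    rw [Polynomial.coe_compRingHom_apply, Polynomial.natDegree_comp, Polynomial.natDegree_X,
      mul_eq_one] at h1
    exact h1.2
  have hlead : IsUnit G'.leadingCoeff := by
    have h1 := congr_arg Polynomial.leadingCoeff hy
    rw [Polynomial.leadingCoeff_comp (by omega), hyd.1, pow_one,
      Polynomial.leadingCoeff_X] at h1
    exact IsUnit.of_mul_eq_one_right _ h1
  obtain ⟨b, hb, hb'⟩ := Polynomial.isUnit_iff.mp hlead
  rw [Polynomial.leadingCoeff, hyd.2] at hb'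
  have hG'eq : G' = Polynomial.C (Polynomial.C b) * Polynomial.X + Polynomial.C (G'.coeff 0) := by
    rw [hb']
    exact Polynomial.eq_X_add_C_of_natDegree_le_one hyd.2.le
  refine ⟨f.coeff 1, f.coeff 0, b, G'.coeff 0, ?_, hb.ne_zero, ?_, ?_⟩
  · intro h
    have : f.leadingCoeff = 0 := by rw [Polynomial.leadingCoeff, hfdeg, h]
    rw [Polynomial.leadingCoeff_eq_zero] at this
    simp [this] at hfdeg
  · conv_lhs => rw [hf, Polynomial.eq_X_add_C_of_natDegree_le_one hfdeg.le]
    simp [algebraMap_eq]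
  · conv_lhs => rw [← hηε (g.val.coord 1), ← hG', hG'eq]
    simp [η, algebraMap_eq]

theorem coord_of_mem_triangular {g : PolyAut 2 k} (hg : g ∈ triangular k) :
    ∃ (a c b : k) (p : Polynomial k), a ≠ 0 ∧ b ≠ 0 ∧ g.val.coord 0 = C a * X 0 + C c ∧
      g.val.coord 1 = C b * X 1 + Polynomial.aeval (X 0) p := by
  obtain ⟨a, c, h⟩ := hg
  refine coord_of_coord_zero (f := Polynomial.C a * Polynomial.X + Polynomial.C c) ?_
  rw [h]
  simp [algebraMap_eq]

/-- The polynomials `a x + b y + c`. -/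
def IsAffinePoly (p : MvPolynomial (Fin 2) k) : Prop :=
  ∃ a b c : k, p = C a * X 0 + C b * X 1 + C c

theorem IsAffinePoly.bind₁ {p : MvPolynomial (Fin 2) k} {Q : Fin 2 → MvPolynomial (Fin 2) k}
    (hp : IsAffinePoly p) (hQ : ∀ i, IsAffinePoly (Q i)) :
    IsAffinePoly (MvPolynomial.bind₁ Q p) := by
  obtain ⟨a, b, c, rfl⟩ := hp
  obtain ⟨a₀, b₀, c₀, h₀⟩ := hQ 0
  obtain ⟨a₁, b₁, c₁, h₁⟩ := hQ 1
  refine ⟨a * a₀ + b * a₁, a * b₀ + b * b₁, a * c₀ + b * c₁ + c, ?_⟩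
  simp only [map_add, map_mul, bind₁_C_right, bind₁_X_right, h₀, h₁]
  ring

theorem isAffinePoly_X (i : Fin 2) : IsAffinePoly (X i : MvPolynomial (Fin 2) k) := by
  fin_cases i
  · exact ⟨1, 0, 0, by simp⟩
  · exact ⟨0, 1, 0, by simp⟩

variable (k) in
/-- The group of affine automorphisms. -/
def affine : Subgroup (PolyAut 2 k) where
  carrier := {f | (∀ i, IsAffinePoly (f.val.coord i)) ∧ ∀ i, IsAffinePoly ((f⁻¹).val.coord i)}
  one_mem' := by
    refine ⟨isAffinePoly_X, ?_⟩
    rw [inv_one]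
    exact isAffinePoly_X
  mul_mem' := by
    rintro f g ⟨hf, hf'⟩ ⟨hg, hg'⟩
    refine ⟨fun i => (hf i).bind₁ hg, fun i => ?_⟩
    rw [mul_inv_rev]
    exact (hg' i).bind₁ hf'
  inv_mem' := by
    rintro f ⟨hf, hf'⟩
    exact ⟨hf', by rwa [inv_inv]⟩

theorem swap_mem_affine : swap k ∈ affine k := by
  refine ⟨fun i => ?_, fun i => ?_⟩ <;> fin_cases i
  exacts [isAffinePoly_X 1, isAffinePoly_X 0, isAffinePoly_X 1, isAffinePoly_X 0]

theorem shear_mem_triangular (p : Polynomial k) : shear p ∈ triangular k :=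
  ⟨1, 0, by simp [shear]⟩

end PolyAut

/-! ### The theorem of Jung and van der Kulk -/

theorem exists_eq_aeval_X_of_degreeOf_eq_zero {k : Type*} [CommRing k]
    {F : MvPolynomial (Fin 2) k} {i j : Fin 2} (hij : i ≠ j) (h : degreeOf j F = 0) :
    ∃ f : Polynomial k, F = Polynomial.aeval (X i) f := by
  refine ⟨∑ m ∈ F.support, Polynomial.C (coeff m F) * Polynomial.X ^ (m i), ?_⟩
  conv_lhs => rw [F.as_sum]
  rw [map_sum]
  refine Finset.sum_congr rfl fun m hm => ?_
  have hmj : m j = 0 := Nat.le_zero.mp (h ▸ monomial_le_degreeOf j hm)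
  have hm' : m = Finsupp.single i (m i) := by
    ext l
    by_cases hl : l = i
    · subst hl; simp
    · have : l = j := by omega
      subst this
      simp [hmj, hij.symm]
  rw [map_mul, Polynomial.aeval_C, map_pow, Polynomial.aeval_X, algebraMap_eq]
  conv_lhs => rw [hm', ← mul_one (coeff _ F), ← C_mul_monomial, ← X_pow_eq_monomial]
  rw [← hm']

/-- A weighted homogeneous substitution that makes the leading form along the hypotenuse of the
Newton triangle divisible by a variable makes the triangle smaller. -/
theorem degreeOf_add_degreeOf_aeval_lt {k : Type*} [Field k] {F : MvPolynomial (Fin 2) k}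
    {P : Fin 2 → MvPolynomial (Fin 2) k} {α β : ℕ} (hα : 1 ≤ α) (hβ : 1 ≤ β)
    (hP : ∀ i, IsWeightedHomogeneous ![(β : ℚ), (α : ℚ)] (P i) (![(β : ℚ), (α : ℚ)] i))
    (hF : WeightLE ![(β : ℚ), (α : ℚ)] (α * β) F) (i : Fin 2)
    (hi : X i ∣ aeval P (weightedHomogeneousComponent ![(β : ℚ), (α : ℚ)] (α * β) F)) :
    degreeOf 0 (aeval P F) + degreeOf 1 (aeval P F) < α + β := by
  classical
  set w : Fin 2 → ℚ := ![(β : ℚ), (α : ℚ)] with hw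
  have hαQ : (1 : ℚ) ≤ α := by exact_mod_cast hα
  have hβQ : (1 : ℚ) ≤ β := by exact_mod_cast hβ
  have hP' : ∀ i, WeightLE w (w i) (P i) := fun i => .isWeightedHomogeneous (hP i)
  have h1 : WeightLE w (α * β) (aeval P F) := WeightLE.aeval hP' hF
  have h2 := weightedHomogeneousComponent_aeval hP' hF
  simp only [(hP _).weightedHomogeneousComponent_same] at h2
  rw [← h2] at hi
  have hle : ∀ m ∈ (aeval P F).support, m 0 ≤ α ∧ m 1 ≤ β := by
    intro m hm
    have h3 := h1 m (mem_support_iff.mp hm)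
    rw [hw, weight_fin_two] at h3
    have h4 : (0 : ℚ) ≤ m 0 * β := by positivity
    have h5 : (0 : ℚ) ≤ m 1 * α := by positivity
    have h6 : (m 0 : ℚ) ≤ α := by nlinarith
    have h7 : (m 1 : ℚ) ≤ β := by nlinarith
    exact ⟨by exact_mod_cast h6, by exact_mod_cast h7⟩
  have hdvd : ∀ m ∈ (aeval P F).support, Finsupp.weight w m = α * β → m i ≠ 0 := by
    intro m hm hmw hmi
    obtain ⟨q, hq⟩ := hi
    have h3 := congr_arg (coeff m) hq
    rw [coeff_weightedHomogeneousComponent, if_pos hmw, coeff_X_mul', if_neg (by simpa using hmi)]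
      at h3
    exact mem_support_iff.mp hm h3
  have hα' : degreeOf 0 (aeval P F) ≤ α := degreeOf_le_iff.mpr fun m hm => (hle m hm).1
  have hβ' : degreeOf 1 (aeval P F) ≤ β := degreeOf_le_iff.mpr fun m hm => (hle m hm).2
  fin_cases i
  · have : degreeOf 1 (aeval P F) < β := by
      refine (degreeOf_lt_iff (by omega)).mpr fun m hm => lt_of_le_of_ne (hle m hm).2 fun h => ?_
      have h3 := h1 m (mem_support_iff.mp hm)
      rw [hw, weight_fin_two, h] at h3
      have h4 : (m 0 : ℚ) * β ≤ 0 := by linarith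
      have h5 : (m 0 : ℚ) ≤ 0 := by nlinarith
      have h6 : m 0 = 0 := by exact_mod_cast le_antisymm h5 (by positivity)
      exact hdvd m hm (by rw [hw, weight_fin_two, h, h6]; push_cast; ring) h6
    omega
  · have : degreeOf 0 (aeval P F) < α := by
      refine (degreeOf_lt_iff (by omega)).mpr fun m hm => lt_of_le_of_ne (hle m hm).1 fun h => ?_
      have h3 := h1 m (mem_support_iff.mp hm)
      rw [hw, weight_fin_two, h] at h3
      have h4 : (m 1 : ℚ) * α ≤ 0 := by linarith
      have h5 : (m 1 : ℚ) ≤ 0 := by nlinarith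
      have h6 : m 1 = 0 := by exact_mod_cast le_antisymm h5 (by positivity)
      exact hdvd m hm (by rw [hw, weight_fin_two, h, h6]; push_cast; ring) h6
    omega

namespace PolyAut

variable {k : Type u} [Field k]

theorem mem_affine_sup_triangular_of_mul_mem {g h : PolyAut 2 k}
    (hh : h ∈ affine k ⊔ triangular k) (hgh : g * h ∈ affine k ⊔ triangular k) :
    g ∈ affine k ⊔ triangular k := by
  have := mul_mem hgh (inv_mem hh)
  rwa [mul_inv_cancel_right] at this

/-- The theorem of Jung and van der Kulk: the automorphism group of the affine plane is generated
by the affine and the triangular automorphisms. -/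
theorem affine_sup_triangular [IsAlgClosed k] : affine k ⊔ triangular k = ⊤ := by
  have hswap : swap k ∈ affine k ⊔ triangular k := Subgroup.mem_sup_left swap_mem_affine
  have hshear : ∀ p : Polynomial k, shear p ∈ affine k ⊔ triangular k := fun p =>
    Subgroup.mem_sup_right (shear_mem_triangular p)
  suffices h : ∀ (N : ℕ) (g : PolyAut 2 k),
      degreeOf 0 (g.val.coord 0) + degreeOf 1 (g.val.coord 0) = N →
      g ∈ affine k ⊔ triangular k from
    eq_top_iff.mpr fun g _ => h _ g rfl
  intro N
  induction N using Nat.strong_induction_on with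
  | _ N ih =>
    intro g hN
    by_cases hβ : degreeOf 1 (g.val.coord 0) = 0
    · obtain ⟨f, hf⟩ := exists_eq_aeval_X_of_degreeOf_eq_zero (by decide : (0 : Fin 2) ≠ 1) hβ
      obtain ⟨a, c, b, p, -, -, h0, -⟩ := coord_of_coord_zero hf
      exact Subgroup.mem_sup_right ⟨a, c, h0⟩
    by_cases hα : degreeOf 0 (g.val.coord 0) = 0
    · obtain ⟨f, hf⟩ := exists_eq_aeval_X_of_degreeOf_eq_zero (by decide : (1 : Fin 2) ≠ 0) hα
      have h1 : (g * swap k).val.coord 0 = Polynomial.aeval (X 0) f := by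
        rw [coord_mul, hf, bind₁_aeval_X]
        rfl
      obtain ⟨a, c, b, p, -, -, h0, -⟩ := coord_of_coord_zero h1
      exact mem_affine_sup_triangular_of_mul_mem hswap (Subgroup.mem_sup_right ⟨a, c, h0⟩)
    have hα1 := Nat.one_le_iff_ne_zero.mpr hα
    have hβ1 := Nat.one_le_iff_ne_zero.mpr hβ
    obtain ⟨hW, m, n, c, hm, hn, hmn, hor, hc, hdvd⟩ :=
      exists_binomial_dvd_leadingForm g rfl rfl hα1 hβ1
    set α := degreeOf 0 (g.val.coord 0)
    set β := degreeOf 1 (g.val.coord 0)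
    have hmnQ : (α : ℚ) * n = β * m := by exact_mod_cast hmn
    have hX : ∀ i : Fin 2, IsWeightedHomogeneous ![(β : ℚ), (α : ℚ)]
        (X i : MvPolynomial (Fin 2) k) (![(β : ℚ), (α : ℚ)] i) :=
      fun i => isWeightedHomogeneous_X _ _ _
    have hXpow : ∀ (i : Fin 2) (l : ℕ) (a : k) (e : ℚ), l • (![(β : ℚ), (α : ℚ)] i) = e →
        IsWeightedHomogeneous ![(β : ℚ), (α : ℚ)]
          (C a * X i ^ l : MvPolynomial (Fin 2) k) e :=
      fun i l a e he => ((hX i).pow l).C_mul a |> fun h => he ▸ h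
    rcases hor with rfl | rfl
    · -- The substitution `x ↦ x + c y ^ n` turns the factor `x - c y ^ n` into `x`.
      have hlt := degreeOf_add_degreeOf_aeval_lt (P := ![X 0 + C c * X 1 ^ n, X 1]) hα1 hβ1
        (by
          intro i
          fin_cases i
          · exact (hX 0).add (hXpow 1 n c β (by simp; push_cast at hmnQ; linarith))
          · exact hX 1) hW 0
        (by
          refine dvd_trans ?_ (map_dvd _ hdvd)
          simp [algebraMap_eq])
      refine mem_affine_sup_triangular_of_mul_mem
        (mul_mem (mul_mem hswap (hshear (Polynomial.C c * Polynomial.X ^ n))) hswap)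
        (ih _ (hN ▸ hlt) _ ?_)
      have : ((swap k * shear (Polynomial.C c * Polynomial.X ^ n) * swap k).val.coord) =
          ![X 0 + C c * X 1 ^ n, X 1] := by
        funext i
        rw [coord_mul, coord_mul, coord_swap, coord_shear]
        fin_cases i <;> simp [algebraMap_eq]
      rw [coord_mul, this]
      rfl
    · -- The substitution `y ↦ y + c⁻¹ x ^ m` turns the factor `x ^ m - c y` into `-c y`.
      have hlt := degreeOf_add_degreeOf_aeval_lt (P := ![X 0, X 1 + C c⁻¹ * X 0 ^ m]) hα1 hβ1
        (by
          intro i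
          fin_cases i
          · exact hX 0
          · exact (hX 1).add (hXpow 0 m c⁻¹ α (by simp; push_cast at hmnQ; linarith))) hW 1
        (by
          refine dvd_trans ?_ (map_dvd _ hdvd)
          refine ⟨-C c, ?_⟩
          have hcc : (C c : MvPolynomial (Fin 2) k) * C c⁻¹ = 1 := by
            rw [← C_mul, mul_inv_cancel₀ hc, C_1]
          simp only [map_sub, map_mul, map_pow, aeval_X, algHom_C, algebraMap_eq,
            Matrix.cons_val_zero, Matrix.cons_val_one, pow_one]
          linear_combination (-X 0 ^ m) * hcc)
      refine mem_affine_sup_triangular_of_mul_mem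
        (hshear (Polynomial.C c⁻¹ * Polynomial.X ^ m)) (ih _ (hN ▸ hlt) _ ?_)
      have : ((shear (Polynomial.C c⁻¹ * Polynomial.X ^ m)).val.coord) =
          ![X 0, X 1 + C c⁻¹ * X 0 ^ m] := by
        funext i
        rw [coord_shear]
        fin_cases i <;> simp [algebraMap_eq]
      rw [coord_mul, this]
      rfl

end PolyAut

/-! ### Alternating words in two subgroups -/

section Words

variable {G : Type*} [Group G] (H : Bool → Subgroup G)

/-- `AltWord H n i j g` means that `g` is a product of `n ≥ 1` factors taken alternately from
`H true \ H false` and `H false \ H true`, the first of them in `H i` and the last in `H j`. -/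
inductive AltWord : ℕ → Bool → Bool → G → Prop
  | single {i : Bool} {g : G} (h : g ∈ H i) (h' : g ∉ H (!i)) : AltWord 1 i i g
  | cons {n : ℕ} {i j : Bool} {c w : G} (h : c ∈ H i) (h' : c ∉ H (!i))
      (hw : AltWord n (!i) j w) : AltWord (n + 1) i j (c * w)

variable {H}

theorem AltWord.append {n m : ℕ} {i j l : Bool} {g g' : G} (hg : AltWord H n i j g)
    (hg' : AltWord H m (!j) l g') : AltWord H (n + m) i l (g * g') := by
  induction hg with
  | single h h' => rw [add_comm]; exact .cons h h' hg'
  | cons h h' _ ih =>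
    rw [mul_assoc, add_right_comm]
    exact .cons h h' (ih hg')

theorem AltWord.inv {n : ℕ} {i j : Bool} {g : G} (hg : AltWord H n i j g) :
    AltWord H n j i g⁻¹ := by
  induction hg with
  | single h h' => exact .single (inv_mem h) fun h1 => h' (by simpa using inv_mem h1)
  | @cons n i j c w h h' _ ih =>
    rw [mul_inv_rev]
    have hs : AltWord H 1 (!(!i)) i c⁻¹ := by
      rw [Bool.not_not]
      exact .single (inv_mem h) fun h1 => h' (by simpa using inv_mem h1)
    exact ih.append hs

theorem forall_mem_of_mem_of_mem_not {i : Bool} {g : G} (h : g ∈ H i) (h' : g ∈ H (!i)) :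
    ∀ l, g ∈ H l := by
  intro l
  rcases eq_or_ne l i with rfl | hl
  · exact h
  · exact Bool.eq_not.mpr hl ▸ h'

/-- A letter times an element of both subgroups is a letter. -/
theorem mul_mem_and_notMem {i : Bool} {b c : G} (hb : ∀ i, b ∈ H i) (h : c ∈ H i)
    (h' : c ∉ H (!i)) : b * c ∈ H i ∧ b * c ∉ H (!i) :=
  ⟨mul_mem (hb i) h, fun h1 => h' (by simpa using mul_mem (inv_mem (hb (!i))) h1)⟩

theorem AltWord.mul_left {n : ℕ} {i j : Bool} {b g : G} (hg : AltWord H n i j g)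
    (hb : ∀ i, b ∈ H i) : AltWord H n i j (b * g) := by
  cases hg with
  | single h h' => exact .single (mul_mem_and_notMem hb h h').1 (mul_mem_and_notMem hb h h').2
  | cons h h' hw =>
    rw [← mul_assoc]
    exact .cons (mul_mem_and_notMem hb h h').1 (mul_mem_and_notMem hb h h').2 hw

theorem AltWord.mul_right {n : ℕ} {i j : Bool} {b g : G} (hg : AltWord H n i j g)
    (hb : ∀ i, b ∈ H i) : AltWord H n i j (g * b) := by
  have := (hg.inv.mul_left fun i => inv_mem (hb i)).inv
  simpa using this

/-- Splitting off the last letter of a word. -/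
theorem AltWord.exists_snoc {n : ℕ} {i j : Bool} {g : G} (hg : AltWord H n i j g) :
    (n = 1 ∧ g ∈ H j) ∨
      ∃ m w c, n = m + 1 ∧ AltWord H m i (!j) w ∧ c ∈ H j ∧ c ∉ H (!j) ∧ g = w * c := by
  have h := hg.inv
  generalize hg' : g⁻¹ = g' at h
  cases h with
  | single h h' =>
    refine Or.inl ⟨rfl, ?_⟩
    rw [← hg'] at h
    simpa using h
  | @cons m _ _ c w h h' hw =>
    refine Or.inr ⟨m, w⁻¹, c⁻¹, rfl, hw.inv, inv_mem h,
      fun h1 => h' (by simpa using inv_mem h1), ?_⟩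
    rw [← mul_inv_rev, ← hg', inv_inv]

theorem exists_altWord_mul {i : Bool} {x g : G} (hx : x ∈ H i)
    (hg : (∀ i, g ∈ H i) ∨ ∃ n i j, AltWord H n i j g) :
    (∀ i, x * g ∈ H i) ∨ ∃ n i j, AltWord H n i j (x * g) := by
  have hsingle : ∀ {y : G}, y ∈ H i → (∀ i, y ∈ H i) ∨ ∃ n i j, AltWord H n i j y := by
    intro y hy
    by_cases hy' : y ∈ H (!i)
    · exact Or.inl (forall_mem_of_mem_of_mem_not hy hy')
    · exact Or.inr ⟨_, _, _, .single hy hy'⟩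
  rcases hg with hg | ⟨n, l, j, hg⟩
  · exact hsingle (mul_mem hx (hg i))
  · by_cases hl : l = i
    · subst hl
      cases hg with
      | single h h' => exact hsingle (mul_mem hx h)
      | @cons n _ _ c w h h' hw =>
        rw [← mul_assoc]
        by_cases hxc : x * c ∈ H (!l)
        · exact Or.inr ⟨_, _, _,
            hw.mul_left (forall_mem_of_mem_of_mem_not (mul_mem hx h) hxc)⟩
        · exact Or.inr ⟨_, _, _, .cons (mul_mem hx h) hxc hw⟩
    · have hl' : l = !i := Bool.eq_not.mpr hl
      subst hl'
      by_cases hx' : x ∈ H (!i)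
      · exact Or.inr ⟨_, _, _, hg.mul_left (forall_mem_of_mem_of_mem_not hx hx')⟩
      · exact Or.inr ⟨_, _, _, .cons hx hx' hg⟩

theorem exists_altWord (hH : H true ⊔ H false = ⊤) (g : G) :
    (∀ i, g ∈ H i) ∨ ∃ n i j, AltWord H n i j g := by
  have hg : g ∈ H true ⊔ H false := hH ▸ Subgroup.mem_top g
  rw [Subgroup.sup_eq_closure] at hg
  induction hg using Subgroup.closure_induction_left with
  | one => exact Or.inl fun i => one_mem _
  | mul_left x hx y _ ih =>
    rcases hx with hx | hx
    · exact exists_altWord_mul hx ih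
    · exact exists_altWord_mul hx ih
  | inv_mul_cancel x hx y _ ih =>
    rcases hx with hx | hx
    · exact exists_altWord_mul (inv_mem hx) ih
    · exact exists_altWord_mul (inv_mem hx) ih

/-- An element conjugate into one of the subgroups is in one of them, or is a reduced conjugate of
an element of one of them. -/
theorem exists_reduced_conj (hH : H true ⊔ H false = ⊤) {i : Bool} {c : G} (hc : c ∈ H i) (g : G) :
    (∃ i, g * c * g⁻¹ ∈ H i) ∨
      ∃ n i j w c', AltWord H n i j w ∧ c' ∈ H (!j) ∧ c' ∉ H j ∧ g * c * g⁻¹ = w * c' * w⁻¹ := by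
  rcases exists_altWord hH g with hg | ⟨n, l, j, hg⟩
  · exact Or.inl ⟨i, mul_mem (mul_mem (hg i) hc) (inv_mem (hg i))⟩
  · induction n using Nat.strong_induction_on generalizing i j g c with
    | _ n ih =>
      by_cases hcj : c ∈ H j
      · rcases hg.exists_snoc with ⟨-, hgj⟩ | ⟨m, w, d, rfl, hw, hd, hd', rfl⟩
        · exact Or.inl ⟨j, mul_mem (mul_mem hgj hcj) (inv_mem hgj)⟩
        · have := ih m (by omega) (mul_mem (mul_mem hd hcj) (inv_mem hd)) w _ hw
          have he : w * d * c * (w * d)⁻¹ = w * (d * c * d⁻¹) * w⁻¹ := by group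
          rwa [he]
      · refine Or.inr ⟨n, l, j, g, c, hg, ?_, hcj, rfl⟩
        have : i = !j := Bool.eq_not.mpr fun h => hcj (h ▸ hc)
        exact this ▸ hc

/-- Every element is conjugate into one of the subgroups or to a cyclically reduced word. -/
theorem exists_conj_mem_or_cyclically_reduced (hH : H true ⊔ H false = ⊤) (h : G) :
    ∃ g, (∃ i, g * h * g⁻¹ ∈ H i) ∨ ∃ n i, AltWord H n i (!i) (g * h * g⁻¹) := by
  rcases exists_altWord hH h with hh | ⟨n, i, j, hh⟩
  · exact ⟨1, Or.inl ⟨true, by simpa using hh true⟩⟩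
  · induction n using Nat.strong_induction_on generalizing i j h with
    | _ n ih =>
      by_cases hij : j = i
      · subst hij
        cases hh with
        | single h h' => exact ⟨1, Or.inl ⟨_, by simpa using h⟩⟩
        | @cons m _ _ c w hc hc' hw =>
          -- Conjugating by the first letter `c` merges it with the last letter.
          suffices hs : (∀ i, w * c ∈ H i) ∨ ∃ n' < m + 1, ∃ i' j', AltWord H n' i' j' (w * c) by
            have he : ∀ g : G, g * (w * c) * g⁻¹ = (g * c⁻¹) * (c * w) * (g * c⁻¹)⁻¹ := by
              intro g; group
            rcases hs with hs | ⟨n', hn', i', j', hs⟩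
            · exact ⟨1 * c⁻¹, by rw [← he]; exact Or.inl ⟨true, by simpa using hs true⟩⟩
            · obtain ⟨g, hg⟩ := ih n' hn' _ _ _ hs
              exact ⟨g * c⁻¹, by rwa [← he]⟩
          rcases hw.exists_snoc with ⟨rfl, hwj⟩ | ⟨m', w', d, rfl, hw', hd, hd', rfl⟩
          · have hm : w * c ∈ H j := mul_mem hwj hc
            by_cases hm' : w * c ∈ H (!j)
            · exact Or.inl (forall_mem_of_mem_of_mem_not hm hm')
            · exact Or.inr ⟨1, by omega, _, _, .single hm hm'⟩
          · rw [mul_assoc]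
            have hm : d * c ∈ H j := mul_mem hd hc
            by_cases hm' : d * c ∈ H (!j)
            · exact Or.inr ⟨m', by omega, _, _,
                hw'.mul_right (forall_mem_of_mem_of_mem_not hm hm')⟩
            · refine Or.inr ⟨m' + 1, by omega, _, _, hw'.append (l := j) ?_⟩
              simpa using AltWord.single hm hm'
      · have : j = !i := Bool.eq_not.mpr hij
        subst this
        exact ⟨1, Or.inr ⟨n, i, by simpa using hh⟩⟩

end Words

/-! ### Degrees of automorphisms -/

theorem totalDegree_bind₁_le {σ τ k : Type*} [CommRing k] {Q : σ → MvPolynomial τ k} {D : ℕ}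
    (hQ : ∀ i, (Q i).totalDegree ≤ D) (p : MvPolynomial σ k) :
    (bind₁ Q p).totalDegree ≤ p.totalDegree * D := by
  conv_lhs => rw [p.as_sum, map_sum]
  refine totalDegree_finsetSum_le fun m hm => ?_
  rw [bind₁_monomial]
  refine (totalDegree_mul _ _).trans ?_
  rw [totalDegree_C, zero_add]
  refine (totalDegree_finsetProd _ _).trans ?_
  calc ∑ i ∈ m.support, (Q i ^ m i).totalDegree ≤ ∑ i ∈ m.support, m i * D :=
        Finset.sum_le_sum fun i _ =>
          (totalDegree_pow _ _).trans (Nat.mul_le_mul_left _ (hQ i))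
    _ = (∑ i ∈ m.support, m i) * D := by rw [Finset.sum_mul]
    _ ≤ p.totalDegree * D := Nat.mul_le_mul_right _ (le_totalDegree hm)

theorem totalDegree_pow_of_field {σ k : Type*} [Field k] (q : MvPolynomial σ k) (n : ℕ) :
    (q ^ n).totalDegree = n * q.totalDegree := by
  by_cases hq : q = 0
  · subst hq
    cases n <;> simp
  induction n with
  | zero => simp
  | succ n ih => rw [pow_succ, totalDegree_mul_of_isDomain (pow_ne_zero _ hq) hq, ih]; ring

theorem totalDegree_C_mul {σ k : Type*} [Field k] {a : k} (ha : a ≠ 0) (q : MvPolynomial σ k) :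
    (C a * q).totalDegree = q.totalDegree := by
  by_cases hq : q = 0
  · simp [hq]
  rw [totalDegree_mul_of_isDomain (by simpa using ha) hq, totalDegree_C, zero_add]

theorem totalDegree_aeval_le {σ k : Type*} [Field k] (q : MvPolynomial σ k) (p : Polynomial k) :
    (Polynomial.aeval q p).totalDegree ≤ p.natDegree * q.totalDegree := by
  rw [Polynomial.aeval_eq_sum_range]
  refine totalDegree_finsetSum_le fun i hi => (totalDegree_smul_le _ _).trans ?_
  rw [totalDegree_pow_of_field]
  exact Nat.mul_le_mul_right _ (by have := Finset.mem_range.mp hi; omega)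

theorem totalDegree_aeval {σ k : Type*} [Field k] (q : MvPolynomial σ k) (p : Polynomial k) :
    (Polynomial.aeval q p).totalDegree = p.natDegree * q.totalDegree := by
  rcases Nat.eq_zero_or_pos (p.natDegree * q.totalDegree) with h0 | h0
  · exact le_antisymm (totalDegree_aeval_le q p) (by omega)
  have hp : 0 < p.natDegree := Nat.pos_of_mul_pos_right h0
  have hq : 0 < q.totalDegree := Nat.pos_of_mul_pos_left h0
  have hlead : p.leadingCoeff ≠ 0 := by
    rw [Ne, Polynomial.leadingCoeff_eq_zero]; rintro rfl; simp at hp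
  have h1 : (C p.leadingCoeff * q ^ p.natDegree).totalDegree = p.natDegree * q.totalDegree := by
    rw [totalDegree_C_mul hlead, totalDegree_pow_of_field]
  have h2 : (Polynomial.aeval q p.eraseLead).totalDegree < p.natDegree * q.totalDegree := by
    refine (totalDegree_aeval_le _ _).trans_lt (Nat.mul_lt_mul_of_pos_right ?_ hq)
    have := Polynomial.eraseLead_natDegree_le p
    omega
  conv_lhs => rw [← p.eraseLead_add_C_mul_X_pow]
  rw [map_add, map_mul, map_pow, Polynomial.aeval_C, Polynomial.aeval_X, algebraMap_eq,
    totalDegree_add_eq_right_of_totalDegree_lt (by rwa [h1]), h1]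

namespace PolyAut

/-- The degree of an automorphism of the plane: the larger of the degrees of its components. -/
def deg {k : Type u} [CommRing k] (f : PolyAut 2 k) : ℕ :=
  max (f.val.coord 0).totalDegree (f.val.coord 1).totalDegree

variable {k : Type u} [Field k]

theorem totalDegree_coord_le_deg (f : PolyAut 2 k) (i : Fin 2) :
    (f.val.coord i).totalDegree ≤ f.deg := by
  fin_cases i
  exacts [le_max_left _ _, le_max_right _ _]

theorem totalDegree_coord_pos (f : PolyAut 2 k) (i : Fin 2) : 0 < (f.val.coord i).totalDegree := by
  refine Nat.pos_of_ne_zero fun h => ?_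
  exact coord_ne_C f i _ (totalDegree_eq_zero_iff_eq_C.mp h)

theorem deg_mul_le (f g : PolyAut 2 k) : (f * g).deg ≤ f.deg * g.deg := by
  refine max_le ?_ ?_ <;>
    exact (totalDegree_bind₁_le (totalDegree_coord_le_deg g) _).trans
      (Nat.mul_le_mul_right _ (totalDegree_coord_le_deg f _))

theorem IsAffinePoly.totalDegree_bind₁_le {p : MvPolynomial (Fin 2) k} (hp : IsAffinePoly p)
    {Q : Fin 2 → MvPolynomial (Fin 2) k} {D : ℕ} (hQ : ∀ i, (Q i).totalDegree ≤ D) :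
    (MvPolynomial.bind₁ Q p).totalDegree ≤ D := by
  obtain ⟨a, b, c, rfl⟩ := hp
  simp only [map_add, map_mul, bind₁_C_right, bind₁_X_right]
  refine (totalDegree_add _ _).trans (max_le ((totalDegree_add _ _).trans (max_le ?_ ?_)) ?_)
  · exact (totalDegree_mul _ _).trans (by rw [totalDegree_C, zero_add]; exact hQ 0)
  · exact (totalDegree_mul _ _).trans (by rw [totalDegree_C, zero_add]; exact hQ 1)
  · rw [totalDegree_C]; exact Nat.zero_le _

theorem deg_mul_le_of_mem_affine {a : PolyAut 2 k} (ha : a ∈ affine k) (g : PolyAut 2 k) :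
    (a * g).deg ≤ g.deg :=
  max_le ((ha.1 0).totalDegree_bind₁_le (totalDegree_coord_le_deg g))
    ((ha.1 1).totalDegree_bind₁_le (totalDegree_coord_le_deg g))

theorem deg_one : (1 : PolyAut 2 k).deg = 1 := by
  rw [deg, coord_one, coord_one, totalDegree_X, totalDegree_X, max_self]

theorem one_le_deg (f : PolyAut 2 k) : 1 ≤ f.deg :=
  (totalDegree_coord_pos f 0).trans_le (totalDegree_coord_le_deg f 0)

theorem deg_eq_one_of_mem_affine {a : PolyAut 2 k} (ha : a ∈ affine k) : a.deg = 1 := by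
  refine le_antisymm ?_ (one_le_deg a)
  have := deg_mul_le_of_mem_affine ha 1
  rwa [mul_one, deg_one] at this

/-- A triangular automorphism that is not affine has the form `(a x + c, b y + p(x))` with
`deg p ≥ 2`. -/
theorem coord_of_mem_triangular_of_notMem_affine {t : PolyAut 2 k} (ht : t ∈ triangular k)
    (ht' : t ∉ affine k) :
    ∃ (a c b : k) (p : Polynomial k), 2 ≤ p.natDegree ∧ t.val.coord 0 = C a * X 0 + C c ∧
      t.val.coord 1 = C b * X 1 + Polynomial.aeval (X 0) p := by
  obtain ⟨a, c, b, p, ha, hb, h0, h1⟩ := coord_of_mem_triangular ht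
  refine ⟨a, c, b, p, ?_, h0, h1⟩
  by_contra hp
  apply ht'
  have hp' : p = Polynomial.C (p.coeff 1) * Polynomial.X + Polynomial.C (p.coeff 0) :=
    Polynomial.eq_X_add_C_of_natDegree_le_one (by omega)
  set p₁ := p.coeff 1
  set p₀ := p.coeff 0
  have hpa : ∀ q : MvPolynomial (Fin 2) k, Polynomial.aeval q p = C p₁ * q + C p₀ := by
    intro q; rw [hp']; simp [algebraMap_eq]
  obtain ⟨a', c', h0'⟩ := (triangular k).inv_mem ht
  refine ⟨fun i => ?_, fun i => ?_⟩
  · fin_cases i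
    · exact ⟨a, 0, c, by simp [h0]⟩
    · exact ⟨p₁, b, p₀, by simp only [Fin.mk_one, h1, hpa]; ring⟩
  · fin_cases i
    · exact ⟨a', 0, c', by simp [h0']⟩
    · have h := comap_inv_coord t 1
      rw [h1, map_add, map_mul, bind₁_C_right, bind₁_X_right, bind₁_aeval_X, hpa, h0'] at h
      have hbb : (C b⁻¹ : MvPolynomial (Fin 2) k) * C b = 1 := by
        rw [← C_mul, inv_mul_cancel₀ hb, C_1]
      refine ⟨-(b⁻¹ * (p₁ * a')), b⁻¹, -(b⁻¹ * (p₁ * c' + p₀)), ?_⟩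
      simp only [Fin.mk_one, C_neg, C_mul, C_add]
      linear_combination (-(t⁻¹).val.coord 1) * hbb + C b⁻¹ * h

variable (k) in
/-- The two factors of the amalgamated product structure. -/
def affineTriangular : Bool → Subgroup (PolyAut 2 k)
  | true => affine k
  | false => triangular k

/-- The shape of the degrees of the components of a word. If the first letter is affine (`true`),
the first component has the degree of the word; if it is triangular (`false`), the first component
has smaller degree than the second. -/
def LeadsWith : Bool → PolyAut 2 k → Prop
  | true, w => (w.val.coord 0).totalDegree = w.deg
  | false, w => (w.val.coord 0).totalDegree < (w.val.coord 1).totalDegree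

theorem letter_mul {i : Bool} {c w : PolyAut 2 k} (hc : c ∈ affineTriangular k i)
    (hc' : c ∉ affineTriangular k (!i)) (hw : LeadsWith (!i) w) :
    (c * w).deg = c.deg * w.deg ∧ LeadsWith i (c * w) := by
  cases i
  · obtain ⟨a, e, b, p, hp, h0, h1⟩ := coord_of_mem_triangular_of_notMem_affine hc hc'
    have hw' : (w.val.coord 0).totalDegree = w.deg := hw
    have hpos := one_le_deg w
    have key : ∀ w : PolyAut 2 k, (w.val.coord 0).totalDegree = w.deg →
        ((c * w).val.coord 0).totalDegree ≤ w.deg ∧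
        ((c * w).val.coord 1).totalDegree = p.natDegree * w.deg := by
      intro w hw'
      have hpos := one_le_deg w
      refine ⟨?_, ?_⟩
      · rw [coord_mul, h0]
        exact IsAffinePoly.totalDegree_bind₁_le ⟨a, 0, e, by simp⟩ (totalDegree_coord_le_deg w)
      · rw [coord_mul, h1, map_add, map_mul, bind₁_C_right, bind₁_X_right, bind₁_aeval_X]
        have h2 : (Polynomial.aeval (w.val.coord 0) p).totalDegree = p.natDegree * w.deg := by
          rw [totalDegree_aeval, hw']
        rw [totalDegree_add_eq_right_of_totalDegree_lt, h2]
        rw [h2]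
        refine ((totalDegree_mul _ _).trans ?_).trans_lt
          (by nlinarith : w.deg < p.natDegree * w.deg)
        rw [totalDegree_C, zero_add]
        exact totalDegree_coord_le_deg w 1
    obtain ⟨k0, k1⟩ := key w hw'
    have hlt : ((c * w).val.coord 0).totalDegree < ((c * w).val.coord 1).totalDegree := by
      rw [k1]; nlinarith
    refine ⟨?_, hlt⟩
    obtain ⟨j0, j1⟩ := key 1 (by rw [deg_one, coord_one, totalDegree_X])
    rw [mul_one, deg_one] at j0
    rw [mul_one, deg_one, mul_one] at j1
    have hdc : c.deg = p.natDegree := by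
      rw [deg, j1]; exact max_eq_right (by omega)
    rw [hdc, deg, k1, max_eq_right]
    rw [← k1]; exact hlt.le
  · have hca : c ∈ affine k := hc
    have hct : c ∉ triangular k := hc'
    obtain ⟨a, b, e, h0⟩ := hca.1 0
    have hb : b ≠ 0 := by
      rintro rfl
      exact hct ⟨a, e, by simpa using h0⟩
    have hw' : (w.val.coord 0).totalDegree < (w.val.coord 1).totalDegree := hw
    have hdw : w.deg = (w.val.coord 1).totalDegree := max_eq_right hw'.le
    have k0 : ((c * w).val.coord 0).totalDegree = w.deg := by
      rw [coord_mul, h0]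
      simp only [map_add, map_mul, bind₁_C_right, bind₁_X_right]
      have h2 : (C b * w.val.coord 1).totalDegree = w.deg := by rw [totalDegree_C_mul hb, hdw]
      have h3 : (C a * w.val.coord 0).totalDegree < w.deg := by
        refine (totalDegree_mul _ _).trans_lt ?_
        rw [totalDegree_C, zero_add, hdw]
        exact hw'
      have h4 : (C a * w.val.coord 0 + C b * w.val.coord 1).totalDegree = w.deg := by
        rw [totalDegree_add_eq_right_of_totalDegree_lt (by rwa [h2]), h2]
      rw [totalDegree_add_eq_left_of_totalDegree_lt, h4]
      rw [h4, totalDegree_C]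
      exact one_le_deg w
    have hd : (c * w).deg = w.deg :=
      le_antisymm (deg_mul_le_of_mem_affine hca w) (k0 ▸ totalDegree_coord_le_deg _ 0)
    refine ⟨by rw [hd, deg_eq_one_of_mem_affine hca, one_mul], ?_⟩
    exact k0.trans hd.symm

theorem leadsWith_letter {i : Bool} {c : PolyAut 2 k} (hc : c ∈ affineTriangular k i)
    (hc' : c ∉ affineTriangular k (!i)) : LeadsWith i c := by
  cases i
  · have := (letter_mul hc hc' (w := 1) (show _ = _ by rw [deg_one, coord_one, totalDegree_X])).2
    rwa [mul_one] at this
  · have h1 : c.deg = 1 := deg_eq_one_of_mem_affine hc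
    exact le_antisymm (totalDegree_coord_le_deg c 0) (h1 ▸ totalDegree_coord_pos c 0)

theorem leadsWith_of_altWord {n : ℕ} {i j : Bool} {g : PolyAut 2 k}
    (hg : AltWord (affineTriangular k) n i j g) : LeadsWith i g := by
  induction hg with
  | single h h' => exact leadsWith_letter h h'
  | cons h h' _ ih => exact (letter_mul h h' ih).2

/-- Degrees are multiplicative on alternating words. -/
theorem deg_mul_of_altWord {n : ℕ} {i j : Bool} {g w : PolyAut 2 k}
    (hg : AltWord (affineTriangular k) n i j g) (hw : LeadsWith (!j) w) :
    (g * w).deg = g.deg * w.deg ∧ LeadsWith i (g * w) := by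
  induction hg with
  | single h h' => exact letter_mul h h' hw
  | cons h h' hv ih =>
    obtain ⟨h1, h2⟩ := ih hw
    rw [mul_assoc, (letter_mul h h' h2).1, h1, (letter_mul h h' (leadsWith_of_altWord hv)).1,
      mul_assoc]
    exact ⟨rfl, (letter_mul h h' h2).2⟩

theorem two_le_deg_of_altWord {n : ℕ} {i : Bool} {g : PolyAut 2 k}
    (hg : AltWord (affineTriangular k) n i (!i) g) : 2 ≤ g.deg := by
  have key : ∀ {n j} {g : PolyAut 2 k}, AltWord (affineTriangular k) n false j g → 2 ≤ g.deg := by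
    intro n j g hg
    have h1 := leadsWith_of_altWord hg
    have h2 := totalDegree_coord_pos g 0
    have h3 := totalDegree_coord_le_deg g 1
    have h4 : (g.val.coord 0).totalDegree < (g.val.coord 1).totalDegree := h1
    omega
  cases i
  · exact key hg
  · -- The last letter is triangular, so the inverse word starts with a triangular letter.
    generalize hj : (!true) = j at hg
    cases hg with
    | single h h' => simp at hj
    | @cons n _ _ c w h h' hw =>
      rw [(letter_mul h h' (leadsWith_of_altWord hw)).1]
      have h1 := key hw
      have h2 := one_le_deg c
      nlinarith

end PolyAut

/-! ### Degrees of powers -/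

namespace PolyAut

variable {k : Type u} [Field k]

theorem deg_pow_le_of_mem_triangular {t : PolyAut 2 k} (ht : t ∈ triangular k) (m : ℕ) :
    (t ^ m).deg ≤ t.deg := by
  obtain ⟨a, c, b, p, -, hb, h0, h1⟩ := coord_of_mem_triangular ht
  have hp : p.natDegree ≤ t.deg := by
    rcases le_or_gt p.natDegree 1 with h | h
    · exact h.trans (one_le_deg t)
    · have h2 : (Polynomial.aeval (X 0 : MvPolynomial (Fin 2) k) p).totalDegree = p.natDegree := by
        rw [totalDegree_aeval, totalDegree_X, mul_one]
      have h3 := totalDegree_coord_le_deg t 1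
      rwa [h1, totalDegree_add_eq_right_of_totalDegree_lt, h2] at h3
      rwa [h2, totalDegree_C_mul hb, totalDegree_X]
  have key : ∀ m, ∃ (a c b : k) (p : Polynomial k), p.natDegree ≤ t.deg ∧
      (t ^ m).val.coord 0 = C a * X 0 + C c ∧
      (t ^ m).val.coord 1 = C b * X 1 + Polynomial.aeval (X 0) p := by
    intro m
    induction m with
    | zero => exact ⟨1, 0, 1, 0, by simp, by simp [PolyEnd.coord_one], by simp [PolyEnd.coord_one]⟩
    | succ m ih =>
      obtain ⟨a', c', b', p', hp', h0', h1'⟩ := ih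
      refine ⟨a * a', a * c' + c, b * b',
        Polynomial.C b * p' + p.comp (Polynomial.C a' * Polynomial.X + Polynomial.C c'), ?_, ?_, ?_⟩
      · refine (Polynomial.natDegree_add_le _ _).trans (max_le ?_ ?_)
        · exact (Polynomial.natDegree_C_mul_le _ _).trans hp'
        · refine Polynomial.natDegree_comp_le.trans ?_
          refine (Nat.mul_le_mul_left _ (Polynomial.natDegree_linear_le)).trans ?_
          rwa [mul_one]
      · rw [pow_succ', coord_mul, h0, map_add, map_mul, bind₁_C_right, bind₁_C_right, bind₁_X_right,
          h0', C_mul, C_add, C_mul]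
        ring
      · rw [pow_succ', coord_mul, h1, map_add, map_mul, bind₁_C_right, bind₁_X_right, bind₁_aeval_X,
          h0', h1', map_add (Polynomial.aeval _), map_mul (Polynomial.aeval _), Polynomial.aeval_C,
          Polynomial.aeval_comp, map_add (Polynomial.aeval _), map_mul (Polynomial.aeval _),
          Polynomial.aeval_C, Polynomial.aeval_C, Polynomial.aeval_X, C_mul]
        simp only [algebraMap_eq]
        ring
  obtain ⟨a', c', b', p', hp', h0', h1'⟩ := key m
  refine max_le ?_ ?_
  · rw [h0']
    refine (totalDegree_add _ _).trans (max_le ((totalDegree_mul _ _).trans ?_) ?_)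
    · rw [totalDegree_C, totalDegree_X, zero_add]; exact one_le_deg t
    · rw [totalDegree_C]; exact Nat.zero_le _
  · rw [h1']
    refine (totalDegree_add _ _).trans (max_le ((totalDegree_mul _ _).trans ?_) ?_)
    · rw [totalDegree_C, totalDegree_X, zero_add]; exact one_le_deg t
    · rwa [totalDegree_aeval, totalDegree_X, mul_one]

theorem deg_pow_le_of_mem {i : Bool} {c : PolyAut 2 k} (hc : c ∈ affineTriangular k i) (m : ℕ) :
    (c ^ m).deg ≤ c.deg := by
  cases i
  · exact deg_pow_le_of_mem_triangular hc m
  · have hc' : c ∈ affine k := hc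
    rw [deg_eq_one_of_mem_affine ((affine k).pow_mem hc' m)]
    exact one_le_deg c

theorem deg_pow_of_altWord {n : ℕ} {i : Bool} {g : PolyAut 2 k}
    (hg : AltWord (affineTriangular k) n i (!i) g) (m : ℕ) :
    (g ^ (m + 1)).deg = g.deg ^ (m + 1) ∧ LeadsWith i (g ^ (m + 1)) := by
  induction m with
  | zero => simpa using leadsWith_of_altWord hg
  | succ m ih =>
    have := deg_mul_of_altWord hg (w := g ^ (m + 1)) (by rw [Bool.not_not]; exact ih.2)
    rw [pow_succ' g, pow_succ' g.deg, this.1, ih.1]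
    exact ⟨rfl, this.2⟩

variable [IsAlgClosed k]

theorem affineTriangular_sup : affineTriangular k true ⊔ affineTriangular k false = ⊤ :=
  affine_sup_triangular

/-- The powers of an automorphism that is conjugate to a triangular one do not have larger degree:
this holds for triangular automorphisms, and degrees are multiplicative on a reduced
conjugate `w c w⁻¹`. -/
theorem deg_pow_conj_le {i : Bool} {c : PolyAut 2 k} (hc : c ∈ affineTriangular k i)
    (g : PolyAut 2 k) (m : ℕ) : ((g * c * g⁻¹) ^ m).deg ≤ (g * c * g⁻¹).deg := by
  rcases exists_reduced_conj affineTriangular_sup hc g with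
    ⟨i, hi⟩ | ⟨n, i, j, w, c', hw, hc1, hc2, h⟩
  · exact deg_pow_le_of_mem hi m
  · rw [h, conj_pow]
    have h1 : AltWord (affineTriangular k) 1 (!j) (!j) c' :=
      .single hc1 (by rwa [Bool.not_not])
    have h2 := deg_mul_of_altWord h1 (w := w⁻¹) (by
      rw [Bool.not_not]; exact leadsWith_of_altWord hw.inv)
    have h3 := deg_mul_of_altWord hw h2.2
    rw [mul_assoc w c', h3.1, h2.1, mul_assoc w]
    refine (deg_mul_le _ _).trans (Nat.mul_le_mul_left _ ((deg_mul_le _ _).trans ?_))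
    exact Nat.mul_le_mul_right _ (deg_pow_le_of_mem hc1 m)

/-- An affine automorphism is conjugate to a triangular one: a linear form that is an eigenvector
serves as a coordinate. -/
theorem exists_conj_mem_triangular_of_mem_affine {c : PolyAut 2 k} (hc : c ∈ affine k) :
    ∃ g : PolyAut 2 k, g * c * g⁻¹ ∈ triangular k := by
  obtain ⟨a, b, e, h0⟩ := hc.1 0
  obtain ⟨a', b', e', h1⟩ := hc.1 1
  by_cases hb : b = 0
  · exact ⟨1, a, e, by simpa [hb] using h0⟩
  obtain ⟨v, hv⟩ := IsAlgClosed.exists_root (Polynomial.C b * Polynomial.X ^ 2 +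
    Polynomial.C (b' - a) * Polynomial.X + Polynomial.C (-a'))
    (by rw [Polynomial.degree_quadratic hb]; decide)
  have hv' : b * v ^ 2 + (b' - a) * v - a' = 0 := by
    simpa [Polynomial.IsRoot, sub_eq_add_neg] using hv
  set s : PolyAut 2 k := swap k * shear (Polynomial.C v * Polynomial.X) with hs
  have hs0 : s.val.coord 0 = X 1 + C v * X 0 := by
    rw [hs, coord_mul, coord_swap, coord_shear]
    simp [algebraMap_eq]
  refine ⟨s, b * v + b', e' + v * e, ?_⟩
  have h2 : bind₁ c.val.coord (s.val.coord 0) =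
      C (b * v + b') * s.val.coord 0 + C (e' + v * e) := by
    rw [hs0, map_add, map_mul, bind₁_C_right, bind₁_X_right, bind₁_X_right, h0, h1]
    have h3 : (C (a * v + a') : MvPolynomial (Fin 2) k) = C ((b * v + b') * v) := by
      congr 1; linear_combination -hv'
    simp only [C_add, C_mul] at h3 ⊢
    linear_combination X 0 * h3
  rw [coord_mul, coord_mul, h2, map_add, map_mul, bind₁_C_right, bind₁_C_right, comap_inv_coord]

/-- An automorphism whose powers have bounded degree is conjugate to a triangular one. -/
theorem exists_conj_mem_triangular {h : PolyAut 2 k} {D : ℕ} (hD : ∀ m, (h ^ m).deg ≤ D) :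
    ∃ g : PolyAut 2 k, g * h * g⁻¹ ∈ triangular k := by
  obtain ⟨g, ⟨i, hi⟩ | ⟨n, i, hw⟩⟩ := exists_conj_mem_or_cyclically_reduced
    affineTriangular_sup h
  · cases i
    · exact ⟨g, hi⟩
    · obtain ⟨g', hg'⟩ := exists_conj_mem_triangular_of_mem_affine hi
      refine ⟨g' * g, ?_⟩
      convert hg' using 1
      group
  · exfalso
    set N := g.deg * D * (g⁻¹).deg with hN
    have h1 := (deg_pow_of_altWord hw N).1
    have h2 : ((g * h * g⁻¹) ^ (N + 1)).deg ≤ N := by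
      rw [conj_pow]
      exact (deg_mul_le _ _).trans (Nat.mul_le_mul_right _ ((deg_mul_le _ _).trans
        (Nat.mul_le_mul_left _ (hD _))))
    have h3 := Nat.pow_le_pow_left (two_le_deg_of_altWord hw) (N + 1)
    have h4 : N + 1 < 2 ^ (N + 1) := Nat.lt_two_pow_self
    omega

end PolyAut

/-! ### Sums of eigenvectors -/

section Eigenvectors

/-- The polynomial with simple roots `Λ`. -/
def rootsPoly {k : Type*} [CommRing k] (Λ : Finset k) : Polynomial k :=
  ∏ l ∈ Λ, (Polynomial.X - Polynomial.C l)

theorem rootsPoly_monic {k : Type*} [CommRing k] (Λ : Finset k) : (rootsPoly Λ).Monic :=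
  Polynomial.monic_prod_of_monic _ _ fun l _ => Polynomial.monic_X_sub_C l

theorem eval_rootsPoly {k : Type*} [CommRing k] (Λ : Finset k) (b : k) :
    (rootsPoly Λ).eval b = ∏ l ∈ Λ, (b - l) := by
  simp [rootsPoly, Polynomial.eval_prod]

theorem eval_rootsPoly_eq_zero {k : Type*} [Field k] {Λ : Finset k} {b : k} :
    (rootsPoly Λ).eval b = 0 ↔ b ∈ Λ := by
  simp [eval_rootsPoly, Finset.prod_eq_zero_iff, sub_eq_zero]

theorem rootsPoly_eq_mul {k : Type*} [Field k] [DecidableEq k] {Λ : Finset k} {b : k}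
    (hb : b ∈ Λ) : rootsPoly Λ = (Polynomial.X - Polynomial.C b) * rootsPoly (Λ.erase b) :=
  (Finset.mul_prod_erase Λ _ hb).symm

variable {k V : Type*} [Field k] [AddCommGroup V] [Module k V]

theorem mem_iSup_eigenspace {φ : Module.End k V} {Λ : Finset k} {z : V}
    (hz : Polynomial.aeval φ (rootsPoly Λ) z = 0) : z ∈ ⨆ b, φ.eigenspace b := by
  classical
  suffices h : LinearMap.ker (Polynomial.aeval φ (rootsPoly Λ)) ≤ ⨆ b, φ.eigenspace b from h hz
  clear hz
  induction Λ using Finset.induction_on with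
  | empty => simp [rootsPoly, Module.End.one_eq_id]
  | insert a s ha ih =>
    have hc : IsCoprime (Polynomial.X - Polynomial.C a) (rootsPoly s) :=
      IsCoprime.prod_right fun l hl =>
        Polynomial.isCoprime_X_sub_C_of_isUnit_sub (by
          rw [isUnit_iff_ne_zero, sub_ne_zero]; rintro rfl; exact ha hl)
    rw [rootsPoly, Finset.prod_insert ha]
    rw [← rootsPoly, ← Polynomial.sup_ker_aeval_eq_ker_aeval_mul_of_coprime φ hc]
    refine sup_le ?_ ih
    refine le_trans ?_ (le_iSup _ a)
    intro x hx
    rw [Module.End.mem_eigenspace_iff]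
    simpa [sub_eq_zero, Module.algebraMap_end_apply] using hx

theorem exists_aeval_rootsPoly_eq_zero {φ : Module.End k V} {z : V}
    (hz : z ∈ ⨆ b, φ.eigenspace b) : ∃ Λ : Finset k, Polynomial.aeval φ (rootsPoly Λ) z = 0 := by
  classical
  have hdvd : ∀ {Λ Λ' : Finset k} {z : V}, Λ ⊆ Λ' → Polynomial.aeval φ (rootsPoly Λ) z = 0 →
      Polynomial.aeval φ (rootsPoly Λ') z = 0 := by
    intro Λ Λ' z hΛ h
    have : rootsPoly Λ' = rootsPoly (Λ' \ Λ) * rootsPoly Λ := (Finset.prod_sdiff hΛ).symm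
    rw [this, map_mul, Module.End.mul_apply, h, map_zero]
  induction hz using Submodule.iSup_induction' with
  | mem b x hx =>
    refine ⟨{b}, ?_⟩
    rw [Module.End.mem_eigenspace_iff] at hx
    simp [rootsPoly, hx, Module.algebraMap_end_apply]
  | zero => exact ⟨∅, map_zero _⟩
  | add x y _ _ hx hy =>
    obtain ⟨Λ, hΛ⟩ := hx
    obtain ⟨Λ', hΛ'⟩ := hy
    refine ⟨Λ ∪ Λ', ?_⟩
    rw [map_add, hdvd Finset.subset_union_left hΛ, hdvd Finset.subset_union_right hΛ', add_zero]

/-- An eigenvector modulo an invariant subspace `U` lifts to an eigenvector, if it is a sum of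
eigenvectors. -/
theorem exists_add_mem_eigenspace {φ : Module.End k V} {U : Submodule k V}
    (hU : ∀ u ∈ U, φ u ∈ U) {z : V} {b : k} (hzU : z ∉ U) (hb : φ z - b • z ∈ U)
    (hz : z ∈ ⨆ b, φ.eigenspace b) : ∃ u ∈ U, φ (z + u) = b • (z + u) := by
  classical
  obtain ⟨Λ, hΛ⟩ := exists_aeval_rootsPoly_eq_zero hz
  have key : ∀ Q : Polynomial k, Polynomial.aeval φ Q z - Q.eval b • z ∈ U := by
    intro Q
    induction Q using Polynomial.induction_on' with
    | add p q hp hq =>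
      have := U.add_mem hp hq
      rw [map_add, LinearMap.add_apply, Polynomial.eval_add, add_smul]
      convert this using 1
      abel
    | monomial n a =>
      have h : (φ ^ n) z - b ^ n • z ∈ U := by
        induction n with
        | zero => simp
        | succ n ih =>
          have h1 := U.add_mem (hU _ ih) (U.smul_mem (b ^ n) hb)
          convert h1 using 1
          rw [pow_succ', Module.End.mul_apply, map_sub, map_smul, pow_succ, mul_smul, smul_sub]
          abel
      have := U.smul_mem a h
      rw [Polynomial.aeval_monomial, Polynomial.eval_monomial, Module.End.mul_apply,
        Module.algebraMap_end_apply, mul_smul, ← smul_sub]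
      exact this
  have hbΛ : b ∈ Λ := by
    rw [← eval_rootsPoly_eq_zero]
    by_contra hne
    have h1 := key (rootsPoly Λ)
    rw [hΛ, zero_sub, U.neg_mem_iff, U.smul_mem_iff hne] at h1
    exact hzU h1
  set Q := rootsPoly (Λ.erase b) with hQ
  have hQb : Q.eval b ≠ 0 := by
    rw [Ne, hQ, eval_rootsPoly_eq_zero]; exact Finset.notMem_erase b Λ
  refine ⟨(Q.eval b)⁻¹ • (Polynomial.aeval φ Q z - Q.eval b • z), U.smul_mem _ (key Q), ?_⟩
  rw [smul_sub, inv_smul_smul₀ hQb, add_sub_cancel, map_smul, smul_comm b]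
  congr 1
  rw [rootsPoly_eq_mul hbΛ, map_mul, Module.End.mul_apply] at hΛ
  simpa [sub_eq_zero, Module.algebraMap_end_apply] using hΛ

/-- For an endomorphism of algebras, sums of eigenvectors are closed under products. -/
theorem mul_mem_iSup_eigenspace {R : Type*} [CommRing R] [Algebra k R] {φ : R →ₐ[k] R} {p q : R}
    (hp : p ∈ ⨆ b, Module.End.eigenspace φ.toLinearMap b)
    (hq : q ∈ ⨆ b, Module.End.eigenspace φ.toLinearMap b) :
    p * q ∈ ⨆ b, Module.End.eigenspace φ.toLinearMap b := by
  induction hp using Submodule.iSup_induction' with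
  | zero => rw [zero_mul]; exact zero_mem _
  | add x y _ _ hx hy => rw [add_mul]; exact add_mem hx hy
  | mem b x hx =>
    induction hq using Submodule.iSup_induction' with
    | zero => rw [mul_zero]; exact zero_mem _
    | add y z _ _ hy hz => rw [mul_add]; exact add_mem hy hz
    | mem c y hy =>
      refine Submodule.mem_iSup_of_mem (b * c) ?_
      rw [Module.End.mem_eigenspace_iff] at *
      rw [AlgHom.toLinearMap_apply] at *
      rw [map_mul, hx, hy, smul_mul_smul_comm]

theorem iSup_eigenspace_eq_top {σ : Type*} {φ : MvPolynomial σ k →ₐ[k] MvPolynomial σ k}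
    (h : ∀ i, X i ∈ ⨆ b, Module.End.eigenspace φ.toLinearMap b) :
    ⨆ b, Module.End.eigenspace φ.toLinearMap b = ⊤ := by
  refine (Submodule.eq_top_iff').mpr fun p => ?_
  induction p using MvPolynomial.induction_on with
  | C a =>
    refine Submodule.mem_iSup_of_mem 1 ?_
    rw [Module.End.mem_eigenspace_iff, one_smul]
    exact φ.commutes a
  | add p q hp hq => exact add_mem hp hq
  | mul_X p i hp => exact mul_mem_iSup_eigenspace hp (h i)

end Eigenvectors

/-! ### Automorphisms that act semisimply on polynomials -/

namespace PolyEnd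

variable {n : ℕ} {R : Type u} [CommRing R]

/-- The linear endomorphism `q ↦ q(f₁, …, fₙ)` of the space of polynomials. -/
def pullback (f : PolyEnd n R) : Module.End R (MvPolynomial (Fin n) R) := f.comap.toLinearMap

theorem pullback_apply (f : PolyEnd n R) (q : MvPolynomial (Fin n) R) :
    f.pullback q = bind₁ f.coord q := rfl

theorem pullback_X (f : PolyEnd n R) (i : Fin n) : f.pullback (X i) = f.coord i :=
  bind₁_X_right _ _

theorem pullback_mul (f g : PolyEnd n R) : (f * g).pullback = g.pullback * f.pullback :=
  LinearMap.ext fun q => (bind₁_bind₁ f.coord g.coord q).symm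

theorem pullback_one : (1 : PolyEnd n R).pullback = 1 :=
  LinearMap.ext fun q => DFunLike.congr_fun (aeval_X_left (σ := Fin n) (R := R)) q

theorem pullback_pow (f : PolyEnd n R) (m : ℕ) : (f ^ m).pullback = f.pullback ^ m := by
  induction m with
  | zero => rw [pow_zero, pow_zero, pullback_one]
  | succ m ih => rw [pow_succ, pullback_mul, ih, pow_succ']

theorem pullback_pow_X (f : PolyEnd n R) (m : ℕ) (i : Fin n) :
    (f.pullback ^ m) (X i) = (f ^ m).coord i := by
  rw [← pullback_pow, pullback_X]

end PolyEnd

namespace PolyAut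

section
variable {k : Type u} [Field k]

theorem exists_jac_eq_C {n : ℕ} (g : PolyAut n k) : ∃ e : k, e ≠ 0 ∧ g.val.jac = C e := by
  have h : g.val.comap (g⁻¹).val.jac * g.val.jac = 1 := by
    rw [← PolyEnd.jac_mul, ← Units.val_mul, inv_mul_cancel, Units.val_one, PolyEnd.jac_one]
  have hu : IsUnit g.val.jac := IsUnit.of_mul_eq_one_right _ h
  obtain ⟨e, he, h⟩ := MvPolynomial.isUnit_iff_eq_C_of_isReduced.mp hu
  exact ⟨e, he.ne_zero, h⟩

/-- The automorphism `(a x, b y)`. -/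
def diag (a b : kˣ) : PolyAut 2 k where
  val := ⟨![C (a : k) * X 0, C (b : k) * X 1]⟩
  inv := ⟨![C ((a⁻¹ : kˣ) : k) * X 0, C ((b⁻¹ : kˣ) : k) * X 1]⟩
  val_inv := by
    ext1; funext i
    fin_cases i <;>
      simp [PolyEnd.coord_mul, PolyEnd.coord_one, PolyEnd.comap, ← mul_assoc, ← C_mul]
  inv_val := by
    ext1; funext i
    fin_cases i <;>
      simp [PolyEnd.coord_mul, PolyEnd.coord_one, PolyEnd.comap, ← mul_assoc, ← C_mul]

theorem coe_diagSAut (a : kˣ) : (diagSAut a : PolyAut 2 k) = diag a a⁻¹ :=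
  ext_coord fun _ => rfl

theorem coord_diag (a b : kˣ) :
    (diag a b).val.coord = ![C (a : k) * X 0, C (b : k) * X 1] := rfl

theorem jac_diag (a b : kˣ) : (diag a b).val.jac = C ((a : k) * b) := by
  simp [PolyEnd.jac, PolyEnd.jacobianMatrix, Matrix.det_fin_two, coord_diag]

theorem totalDegree_aeval_pullback_le {h : PolyAut 2 k} {D : ℕ} (hD : ∀ m, (h ^ m).deg ≤ D)
    (Q : Polynomial k) (i : Fin 2) :
    (Polynomial.aeval h.val.pullback Q (X i)).totalDegree ≤ D := by
  rw [Polynomial.aeval_eq_sum_range, LinearMap.sum_apply]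
  refine totalDegree_finsetSum_le fun m _ => ?_
  rw [LinearMap.smul_apply, PolyEnd.pullback_pow_X]
  refine (totalDegree_smul_le _ _).trans ?_
  have := totalDegree_coord_le_deg (h ^ m) i
  rw [Units.val_pow_eq_pow_val] at this
  exact this.trans (hD m)

/-- If `h^*` is annihilated by a fixed polynomial on the coordinate functions, then the powers of
`h` have bounded degree. -/
theorem exists_deg_pow_le {h : PolyAut 2 k} {P : Polynomial k} (hP : P.Monic)
    (hh : ∀ i, Polynomial.aeval h.val.pullback P (X i) = 0) : ∃ D, ∀ m, (h ^ m).deg ≤ D := by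
  refine ⟨(Finset.range (P.natDegree + 1)).sup fun m => (h ^ m).deg, fun m => ?_⟩
  have key : ∀ i, ((h ^ m).val.coord i).totalDegree ≤
      (Finset.range (P.natDegree + 1)).sup fun m => (h ^ m).deg := by
    intro i
    rw [Units.val_pow_eq_pow_val, ← PolyEnd.pullback_pow_X, ← Polynomial.aeval_X_pow (R := k),
      ← Polynomial.modByMonic_add_div (Polynomial.X ^ m) P, map_add,
      mul_comm P, map_mul, LinearMap.add_apply, Module.End.mul_apply, hh, map_zero, add_zero,
      Polynomial.aeval_eq_sum_range, LinearMap.sum_apply]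
    refine totalDegree_finsetSum_le fun t ht => ?_
    rw [LinearMap.smul_apply, PolyEnd.pullback_pow_X]
    refine (totalDegree_smul_le _ _).trans ?_
    have h1 := totalDegree_coord_le_deg (h ^ t) i
    rw [Units.val_pow_eq_pow_val] at h1
    refine h1.trans (Finset.le_sup (f := fun m => (h ^ m).deg) ?_)
    have h2 := Polynomial.natDegree_modByMonic_le (Polynomial.X ^ m) hP
    have h3 := Finset.mem_range.mp ht
    exact Finset.mem_range.mpr (by omega)
  exact max_le (key 0) (key 1)

variable [IsAlgClosed k]

/-- An automorphism whose pull-back is annihilated on the coordinate functions by a polynomial with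
simple roots is conjugate to a diagonal one. -/
theorem exists_mul_eq_diag_mul {h : PolyAut 2 k} {Λ : Finset k}
    (hh : ∀ i, Polynomial.aeval h.val.pullback (rootsPoly Λ) (X i) = 0) :
    ∃ (g : PolyAut 2 k) (a b : kˣ), g * h = diag a b * g := by
  obtain ⟨D, hD⟩ := exists_deg_pow_le (rootsPoly_monic Λ) hh
  obtain ⟨g, hg⟩ := exists_conj_mem_triangular hD
  obtain ⟨a, c, b, p, ha, hb, h0, h1⟩ := coord_of_mem_triangular hg
  have hgh : ∀ i, h.val.pullback (g.val.coord i) =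
      bind₁ g.val.coord ((g * h * g⁻¹).val.coord i) := by
    intro i
    rw [← coord_mul, inv_mul_cancel_right]
    rfl
  have htop : ∀ q, q ∈ ⨆ b, Module.End.eigenspace h.val.pullback b := by
    intro q
    have := iSup_eigenspace_eq_top (φ := h.val.comap) fun i => mem_iSup_eigenspace (hh i)
    exact this ▸ Submodule.mem_top
  have e0 : h.val.pullback (g.val.coord 0) = a • g.val.coord 0 + C c := by
    rw [hgh, h0]; simp [smul_eq_C_mul]
  have e1 : h.val.pullback (g.val.coord 1) =
      b • g.val.coord 1 + Polynomial.aeval (g.val.coord 0) p := by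
    rw [hgh, h1, map_add, bind₁_aeval_X]; simp [smul_eq_C_mul]
  obtain ⟨u, ⟨e, rfl⟩, hu⟩ := exists_add_mem_eigenspace (φ := h.val.pullback) (b := a)
    (U := LinearMap.range (Algebra.linearMap k (MvPolynomial (Fin 2) k)))
    (z := g.val.coord 0) (by
      rintro _ ⟨e, rfl⟩
      exact ⟨e, (h.val.comap.commutes e).symm⟩) (by
      rintro ⟨e, he⟩
      exact coord_ne_C g 0 e he.symm) ⟨c, by rw [e0, add_sub_cancel_left]; rfl⟩ (htop _)
  obtain ⟨u', ⟨q, rfl⟩, hu'⟩ := exists_add_mem_eigenspace (φ := h.val.pullback) (b := b)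
    (U := LinearMap.range (Polynomial.aeval (R := k) (g.val.coord 0)).toLinearMap)
    (z := g.val.coord 1) (by
      rintro _ ⟨q, rfl⟩
      refine ⟨q.comp (Polynomial.C a * Polynomial.X + Polynomial.C c), ?_⟩
      rw [AlgHom.toLinearMap_apply, AlgHom.toLinearMap_apply, PolyEnd.pullback_apply,
        ← Polynomial.aeval_algHom_apply, ← PolyEnd.pullback_apply, e0, Polynomial.aeval_comp]
      simp [algebraMap_eq, smul_eq_C_mul]) (by
      rintro ⟨q, hq⟩
      have h2 := congr_arg (bind₁ (g⁻¹).val.coord) hq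
      rw [AlgHom.toLinearMap_apply, ← Polynomial.aeval_algHom_apply, comap_inv_coord,
        comap_inv_coord] at h2
      have h3 := congr_arg (degreeOf 1) h2
      have h4 : degreeOf 1 (Polynomial.aeval (X 0 : MvPolynomial (Fin 2) k) q) = 0 := by
        rw [← Nat.le_zero, Polynomial.aeval_eq_sum_range]
        refine (degreeOf_sum_le _ _ _).trans (Finset.sup_le fun m _ => ?_)
        rw [smul_eq_C_mul]
        refine (degreeOf_C_mul_le _ _ _).trans ((degreeOf_pow_le _ _ _).trans ?_)
        rw [degreeOf_X_of_ne (by decide), mul_zero]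
      rw [h4, degreeOf_X_self] at h3
      exact zero_ne_one h3) ⟨p, by rw [e1, add_sub_cancel_left]; rfl⟩ (htop _)
  -- The automorphism `(x + e, y + q(x))`.
  set s : PolyAut 2 k := swap k * shear (Polynomial.C e) * swap k * shear q with hs
  have hs0 : s.val.coord 0 = X 0 + C e := by
    rw [hs, coord_mul, coord_mul, coord_mul]
    simp [coord_swap, coord_shear, algebraMap_eq]
  have hs1 : s.val.coord 1 = X 1 + Polynomial.aeval (X 0) q := by
    rw [hs, coord_mul, coord_mul, coord_mul]
    simp [coord_swap, coord_shear]
  have hsg0 : (s * g).val.coord 0 = g.val.coord 0 + C e := by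
    rw [coord_mul, hs0]; simp
  have hsg1 : (s * g).val.coord 1 = g.val.coord 1 + Polynomial.aeval (g.val.coord 0) q := by
    rw [coord_mul, hs1, map_add, bind₁_aeval_X]; simp
  refine ⟨s * g, Units.mk0 a ha, Units.mk0 b hb, ext_coord fun i => ?_⟩
  rw [coord_mul (s * g), ← PolyEnd.pullback_apply, coord_mul (diag _ _), coord_diag]
  fin_cases i
  · simp only [Fin.zero_eta, Matrix.cons_val_zero, map_mul, bind₁_C_right, bind₁_X_right]
    rw [hsg0]
    exact hu.trans (smul_eq_C_mul _ _)
  · simp only [Fin.mk_one, Matrix.cons_val_one, Matrix.cons_val_fin_one, map_mul, bind₁_C_right,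
      bind₁_X_right]
    rw [hsg1]
    exact hu'.trans (smul_eq_C_mul _ _)

theorem exists_eq_conj_diagSAut {h : PolyAut 2 k} {Λ : Finset k}
    (hh : ∀ i, Polynomial.aeval h.val.pullback (rootsPoly Λ) (X i) = 0) (hj : h.val.jac = 1) :
    ∃ (g : PolyAut 2 k) (a : kˣ), h = g * (diagSAut a : PolyAut 2 k) * g⁻¹ := by
  obtain ⟨g, a, b, hg⟩ := exists_mul_eq_diag_mul hh
  obtain ⟨e, he, hge⟩ := exists_jac_eq_C g
  have h1 : (g * h).val.jac = C e := by
    rw [Units.val_mul, PolyEnd.jac_mul, hj, hge, mul_one]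
    exact bind₁_C_right _ _
  have h2 : (diag a b * g).val.jac = C ((a : k) * b * e) := by
    rw [Units.val_mul, PolyEnd.jac_mul, hge, jac_diag, C_mul (a := (a : k) * b)]
    congr 1
    exact bind₁_C_right _ _
  rw [hg, h2] at h1
  have h3 : (a : k) * b = 1 := mul_right_cancel₀ he (by rw [one_mul]; exact C_injective _ _ h1)
  have h4 : b = a⁻¹ := by
    rw [eq_inv_iff_mul_eq_one, mul_comm]; exact Units.ext h3
  refine ⟨g⁻¹, a, ?_⟩
  rw [coe_diagSAut, ← h4, inv_inv, mul_assoc, ← hg, inv_mul_cancel_left]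

end

end PolyAut

/-! ### The eigenvalues of conjugates of bounded degree -/

namespace PolyAut

variable {k : Type u} [Field k]

/-- The eigenvalue of the monomial `x^m` under `q ↦ q(μ x, μ⁻¹ y)`. -/
def diagChar (μ : kˣ) (m : Fin 2 →₀ ℕ) : kˣ := μ ^ ((m 0 : ℤ) - m 1)

theorem coeff_pullback_diagSAut (μ : kˣ) (m : Fin 2 →₀ ℕ) (q : MvPolynomial (Fin 2) k) :
    coeff m ((diagSAut μ : PolyAut 2 k).val.pullback q) = diagChar μ m * coeff m q := by
  classical
  induction q using MvPolynomial.induction_on' with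
  | add p q hp hq => rw [map_add, coeff_add, hp, hq, coeff_add, mul_add]
  | monomial s a =>
    have h1 : (diagSAut μ : PolyAut 2 k).val.pullback (monomial s a) =
        monomial s ((diagChar μ s : k) * a) := by
      have hs : ∏ i ∈ s.support, ![C (μ : k) * X 0, C ((μ⁻¹ : kˣ) : k) * X 1] i ^ s i =
          ∏ i, ![C (μ : k) * X 0, C ((μ⁻¹ : kˣ) : k) * (X 1 : MvPolynomial (Fin 2) k)] i ^ s i :=
        Finset.prod_subset (Finset.subset_univ _) fun i _ hi => by
          rw [Finsupp.notMem_support_iff.mp hi, pow_zero]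
      rw [PolyEnd.pullback_apply, bind₁_monomial, coe_diagSAut, coord_diag, hs,
        Fin.prod_univ_two, monomial_eq (s := s),
        Finsupp.prod_fintype _ _ (by simp), Fin.prod_univ_two]
      simp only [Matrix.cons_val_zero, Matrix.cons_val_one, Matrix.cons_val_fin_one, mul_pow,
        ← C_pow]
      have h2 : (diagChar μ s : k) = (μ : k) ^ s 0 * ((μ⁻¹ : kˣ) : k) ^ s 1 := by
        rw [diagChar, zpow_sub, zpow_natCast, zpow_natCast, ← inv_pow]
        simp
      rw [h2, C_mul, C_mul]
      ring
    rw [h1, coeff_monomial, coeff_monomial]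
    split_ifs with h
    · rw [h]
    · rw [mul_zero]

theorem coeff_aeval_pullback_diagSAut (μ : kˣ) (Q : Polynomial k) (m : Fin 2 →₀ ℕ)
    (q : MvPolynomial (Fin 2) k) :
    coeff m (Polynomial.aeval (diagSAut μ : PolyAut 2 k).val.pullback Q q) =
      Q.eval (diagChar μ m : k) * coeff m q := by
  induction Q using Polynomial.induction_on' with
  | add p q hp hq => rw [map_add, LinearMap.add_apply, coeff_add, hp, hq, Polynomial.eval_add,
      add_mul]
  | monomial n a =>
    rw [Polynomial.aeval_monomial, Polynomial.eval_monomial, Module.End.mul_apply,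
      Module.algebraMap_end_apply, coeff_smul, smul_eq_mul, mul_assoc]
    congr 1
    induction n with
    | zero => simp
    | succ n ih =>
      rw [pow_succ', Module.End.mul_apply, coeff_pullback_diagSAut, ih, pow_succ']
      ring

theorem aeval_pullback_conj (f g : PolyAut 2 k) (Q : Polynomial k) (i : Fin 2) :
    Polynomial.aeval (g * f * g⁻¹).val.pullback Q (X i) =
      (g⁻¹).val.pullback (Polynomial.aeval f.val.pullback Q (g.val.coord i)) := by
  induction Q using Polynomial.induction_on' with
  | add p q hp hq =>
    rw [map_add, LinearMap.add_apply, hp, hq, map_add, LinearMap.add_apply, map_add]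
  | monomial n a =>
    rw [Polynomial.aeval_monomial, Polynomial.aeval_monomial, Module.End.mul_apply,
      Module.algebraMap_end_apply, Module.End.mul_apply, Module.algebraMap_end_apply, map_smul,
      PolyEnd.pullback_pow_X, ← Units.val_pow_eq_pow_val, conj_pow, ← PolyEnd.pullback_X,
      Units.val_mul, Units.val_mul, PolyEnd.pullback_mul, PolyEnd.pullback_mul,
      Units.val_pow_eq_pow_val, PolyEnd.pullback_pow, Module.End.mul_apply, Module.End.mul_apply,
      PolyEnd.pullback_X]

theorem le_totalDegree_bind₁ {h : PolyAut 2 k} {w : MvPolynomial (Fin 2) k} (hw : w ≠ 0) {i : Fin 2}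
    {j : ℕ} (hj : ∀ m ∈ w.support, j ≤ m i) : j ≤ (bind₁ h.val.coord w).totalDegree := by
  obtain ⟨q, rfl⟩ := X_pow_dvd_of_forall_le hj
  have hinj : Function.Injective (bind₁ h.val.coord) := by
    refine Function.LeftInverse.injective (g := bind₁ (h⁻¹).val.coord) fun p => ?_
    have := DFunLike.congr_fun (PolyEnd.pullback_mul h.val (h⁻¹).val) p
    rw [← Units.val_mul, mul_inv_cancel, Units.val_one, PolyEnd.pullback_one] at this
    exact this.symm
  have hne := (map_ne_zero_iff _ hinj).mpr hw
  rw [map_mul] at hne ⊢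
  rw [totalDegree_mul_of_isDomain (left_ne_zero_of_mul hne) (right_ne_zero_of_mul hne), map_pow,
    bind₁_X_right, totalDegree_pow_of_field]
  have := totalDegree_coord_pos h i
  nlinarith

variable [IsAlgClosed k]

/-- The eigenvalues `μ ^ j` that occur in the components of `g` have `|j| ≤ deg (g f g⁻¹)`, if `μ`
has infinite order. -/
theorem natAbs_le_of_mem_support {μ : kˣ} (hμ : ¬ IsOfFinOrder μ) (g : PolyAut 2 k) {i : Fin 2}
    {m : Fin 2 →₀ ℕ} (hm : m ∈ (g.val.coord i).support) :
    ((m 0 : ℤ) - m 1).natAbs ≤ (g * (diagSAut μ : PolyAut 2 k) * g⁻¹).deg := by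
  classical
  set f : PolyAut 2 k := (diagSAut μ : PolyAut 2 k) with hf
  -- `R` selects the part of `g.val.coord i` of the same weight as `m`.
  set R := rootsPoly (((g.val.coord i).support.image fun m' => (diagChar μ m' : k)).erase
    (diagChar μ m : k)) with hR
  set w := Polynomial.aeval f.val.pullback R (g.val.coord i) with hw
  have hf' : f ∈ affineTriangular k false := ⟨μ, 0, by rw [hf, coe_diagSAut, coord_diag]; simp⟩
  have hdeg : (bind₁ (g⁻¹).val.coord w).totalDegree ≤ (g * f * g⁻¹).deg := by
    have := totalDegree_aeval_pullback_le (deg_pow_conj_le hf' g) R i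
    rwa [aeval_pullback_conj] at this
  have hw0 : w ≠ 0 := by
    intro h0
    have h1 := coeff_aeval_pullback_diagSAut μ R m (g.val.coord i)
    rw [← hf, ← hw, h0, coeff_zero] at h1
    refine (mul_ne_zero ?_ (mem_support_iff.mp hm)) h1.symm
    rw [Ne, hR, eval_rootsPoly_eq_zero]
    exact Finset.notMem_erase _ _
  have hsupp : ∀ m' ∈ w.support, (m' 0 : ℤ) - m' 1 = (m 0 : ℤ) - m 1 := by
    intro m' hm'
    rw [mem_support_iff, hw, hf, coeff_aeval_pullback_diagSAut] at hm'
    have h1 := left_ne_zero_of_mul hm'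
    rw [Ne, hR, eval_rootsPoly_eq_zero, Finset.mem_erase, not_and] at h1
    have h2 : (diagChar μ m' : k) = diagChar μ m := by
      by_contra hne
      exact h1 hne (Finset.mem_image_of_mem _ (mem_support_iff.mpr (right_ne_zero_of_mul hm')))
    exact injective_zpow_iff_not_isOfFinOrder.mpr hμ (Units.ext h2)
  rcases le_total (m 1) (m 0) with h | h
  · refine le_trans ?_ hdeg
    refine le_totalDegree_bind₁ hw0 (i := 0) fun m' hm' => ?_
    have := hsupp m' hm'
    omega
  · refine le_trans ?_ hdeg
    refine le_totalDegree_bind₁ hw0 (i := 1) fun m' hm' => ?_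
    have := hsupp m' hm'
    omega

/-- The conjugates `h` of `(μ x, μ⁻¹ y)` of bounded degree have an annihilating polynomial with
simple roots in common. -/
theorem exists_rootsPoly (μ : kˣ) (d : ℕ) : ∃ Λ : Finset k, ∀ g : PolyAut 2 k,
    (g * (diagSAut μ : PolyAut 2 k) * g⁻¹).deg ≤ d → ∀ i,
      Polynomial.aeval (g * (diagSAut μ : PolyAut 2 k) * g⁻¹).val.pullback (rootsPoly Λ) (X i) =
        0 := by
  classical
  suffices h : ∃ Λ : Finset k, ∀ g : PolyAut 2 k,
      (g * (diagSAut μ : PolyAut 2 k) * g⁻¹).deg ≤ d → ∀ i, ∀ m ∈ (g.val.coord i).support,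
        (diagChar μ m : k) ∈ Λ by
    obtain ⟨Λ, hΛ⟩ := h
    refine ⟨Λ, fun g hg i => ?_⟩
    rw [aeval_pullback_conj]
    suffices hz : Polynomial.aeval (diagSAut μ : PolyAut 2 k).val.pullback (rootsPoly Λ)
        (g.val.coord i) = 0 by rw [hz, map_zero]
    ext m
    rw [coeff_aeval_pullback_diagSAut, coeff_zero]
    by_cases hm : m ∈ (g.val.coord i).support
    · rw [eval_rootsPoly_eq_zero.mpr (hΛ g hg i m hm), zero_mul]
    · rw [notMem_support_iff.mp hm, mul_zero]
  by_cases hμ : IsOfFinOrder μ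
  · have hfin : (Set.range fun j : ℤ => ((μ ^ j : kˣ) : k)).Finite := by
      have h1 : (Subgroup.zpowers μ : Set kˣ).Finite := finite_zpowers.mpr hμ
      refine (h1.image Units.val).subset ?_
      rintro _ ⟨j, rfl⟩
      exact ⟨_, ⟨j, rfl⟩, rfl⟩
    exact ⟨hfin.toFinset, fun g _ i m _ => hfin.mem_toFinset.mpr ⟨_, rfl⟩⟩
  · refine ⟨(Finset.Icc (-d : ℤ) d).image fun j => ((μ ^ j : kˣ) : k), fun g hg i m hm => ?_⟩
    have := natAbs_le_of_mem_support hμ g hm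
    exact Finset.mem_image.mpr ⟨_, Finset.mem_Icc.mpr (by omega), rfl⟩

end PolyAut

/-! ### Families of endomorphisms and their specializations -/

theorem totalDegree_map_le {σ R S : Type*} [CommSemiring R] [CommSemiring S] (φ : R →+* S)
    (p : MvPolynomial σ R) : (MvPolynomial.map φ p).totalDegree ≤ p.totalDegree :=
  Finset.sup_mono (support_map_subset φ p)

namespace PolyEnd

variable {n : ℕ} {B C : Type u} [CommRing B] [CommRing C]

/-- The specialization of a family of endomorphisms along a homomorphism of rings. -/
def map (φ : B →+* C) (h : PolyEnd n B) : PolyEnd n C := ⟨fun i => MvPolynomial.map φ (h.coord i)⟩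

theorem coord_map (φ : B →+* C) (h : PolyEnd n B) (i : Fin n) :
    (h.map φ).coord i = MvPolynomial.map φ (h.coord i) := rfl

theorem map_pullback (φ : B →+* C) (h : PolyEnd n B) (q : MvPolynomial (Fin n) B) :
    MvPolynomial.map φ (h.pullback q) = (h.map φ).pullback (MvPolynomial.map φ q) :=
  MvPolynomial.map_bind₁ _ _ _

theorem map_pullback_pow (φ : B →+* C) (h : PolyEnd n B) (t : ℕ) (q : MvPolynomial (Fin n) B) :
    MvPolynomial.map φ ((h.pullback ^ t) q) =
      ((h.map φ).pullback ^ t) (MvPolynomial.map φ q) := by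
  induction t with
  | zero => rfl
  | succ t ih => rw [pow_succ', pow_succ', Module.End.mul_apply, Module.End.mul_apply,
      map_pullback, ih]

theorem map_aeval_pullback (φ : B →+* C) (h : PolyEnd n B) (P : Polynomial B)
    (q : MvPolynomial (Fin n) B) :
    MvPolynomial.map φ (Polynomial.aeval h.pullback P q) =
      Polynomial.aeval (h.map φ).pullback (P.map φ) (MvPolynomial.map φ q) := by
  induction P using Polynomial.induction_on' with
  | add p q hp hq => simp only [map_add, LinearMap.add_apply, hp, hq, Polynomial.map_add]
  | monomial m a =>
    rw [Polynomial.map_monomial, Polynomial.aeval_monomial, Polynomial.aeval_monomial,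
      Module.End.mul_apply, Module.End.mul_apply, Module.algebraMap_end_apply,
      Module.algebraMap_end_apply, smul_eq_C_mul, smul_eq_C_mul, map_mul, map_C,
      map_pullback_pow]

theorem jacobianMatrix_map (φ : B →+* C) (h : PolyEnd n B) :
    (h.map φ).jacobianMatrix = (MvPolynomial.map φ).mapMatrix h.jacobianMatrix := by
  ext1 i j
  simp only [jacobianMatrix, Matrix.of_apply, RingHom.mapMatrix_apply, Matrix.map_apply, coord_map]
  exact pderiv_map

theorem jac_map (φ : B →+* C) (h : PolyEnd n B) : (h.map φ).jac = MvPolynomial.map φ h.jac := by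
  rw [jac, jac, jacobianMatrix_map, ← RingHom.map_det]

end PolyEnd

namespace PolyAut

variable {k : Type u} [Field k]

/-- The conjugacy class of `(μ x, μ⁻¹ y)` in the group of all automorphisms of the plane. -/
def conjDiag (μ : kˣ) : Set (PolyAut 2 k) :=
  {h | ∃ g : PolyAut 2 k, h = g * (diagSAut μ : PolyAut 2 k) * g⁻¹}

/-- A family `h` of endomorphisms of the plane over the `k`-algebra `B` is a limit of conjugates of
`(μ x, μ⁻¹ y)` at the point `ev₀` of `Spec B`, if every basic open neighbourhood of `ev₀` contains a
`k`-point at which `h` specializes to a conjugate of `(μ x, μ⁻¹ y)`. -/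
def IsLimitOfConj (μ : kˣ) {B : Type u} [CommRing B] [Algebra k B] (h : PolyEnd 2 B)
    (ev₀ : B →ₐ[k] k) : Prop :=
  ∀ s : B, ev₀ s ≠ 0 → ∃ ev : B →ₐ[k] k, ev s ≠ 0 ∧
    ∃ H ∈ conjDiag μ, h.map (ev : B →+* k) = H.val

variable {μ : kˣ} {B : Type u} [CommRing B] [Algebra k B] {h : PolyEnd 2 B} {ev₀ : B →ₐ[k] k}

theorem IsLimitOfConj.map_eq_zero (hl : IsLimitOfConj μ h ev₀) {σ : Type*} (q : MvPolynomial σ B)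
    (hq : ∀ ev : B →ₐ[k] k, ∀ H ∈ conjDiag μ, h.map (ev : B →+* k) = H.val →
      MvPolynomial.map (ev : B →+* k) q = 0) : MvPolynomial.map (ev₀ : B →+* k) q = 0 := by
  ext m
  by_contra hne
  rw [coeff_map, coeff_zero] at hne
  obtain ⟨ev, hev, H, hH, hh⟩ := hl _ hne
  have := congr_arg (coeff m) (hq ev H hH hh)
  rw [coeff_map, coeff_zero] at this
  exact hev this

theorem jac_eq_one_of_mem_conjDiag {H : PolyAut 2 k} (hH : H ∈ conjDiag μ) : H.val.jac = 1 := by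
  obtain ⟨g, rfl⟩ := hH
  obtain ⟨e, he, hge⟩ := exists_jac_eq_C g
  have h1 : (g * (diagSAut μ : PolyAut 2 k) * g⁻¹ * g).val.jac =
      C e := by
    rw [inv_mul_cancel_right, Units.val_mul, PolyEnd.jac_mul, (diagSAut μ).2, hge, mul_one]
    exact bind₁_C_right _ _
  rw [Units.val_mul, PolyEnd.jac_mul, hge] at h1
  obtain ⟨e', he', hge'⟩ := exists_jac_eq_C (g * (diagSAut μ : PolyAut 2 k) * g⁻¹)
  rw [hge'] at h1 ⊢
  have h2 : (C e' : MvPolynomial (Fin 2) k) * C e = C e := by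
    rw [← h1]; congr 1; exact (bind₁_C_right _ _).symm
  rw [← C_mul] at h2
  rw [mul_eq_right₀ he |>.mp (C_injective _ _ h2), C_1]

theorem rootsPoly_map_algebraMap (Λ : Finset k) (ev : B →ₐ[k] k) :
    ((rootsPoly Λ).map (algebraMap k B)).map (ev : B →+* k) = rootsPoly Λ := by
  rw [Polynomial.map_map, AlgHom.comp_algebraMap, Algebra.algebraMap_self, Polynomial.map_id]

theorem ne_one_of_mem_conjDiag (hμ : μ ≠ 1) {H : PolyAut 2 k} (hH : H ∈ conjDiag μ) : H ≠ 1 := by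
  rintro rfl
  obtain ⟨g, hg⟩ := hH
  apply hμ
  have h1 : (diagSAut μ : PolyAut 2 k) = 1 := by
    have : g⁻¹ * (g * (diagSAut μ : PolyAut 2 k) * g⁻¹) * g = g⁻¹ * 1 * g := by rw [← hg]
    simpa [mul_assoc] using this
  have h2 := congr_arg (fun f : PolyAut 2 k => coeff (Finsupp.single 0 1) (f.val.coord 0)) h1
  rw [coe_diagSAut] at h2
  simp only [coord_diag, coord_one, Matrix.cons_val_zero, coeff_C_mul, coeff_X] at h2
  exact Units.ext (by simpa using h2)

variable [IsAlgClosed k]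

variable (μ h) in
/-- The members of a family over `B` that are conjugate to `(μ x, μ⁻¹ y)` have bounded degree, and
hence an annihilating polynomial in common. -/
theorem exists_rootsPoly_of_family : ∃ Λ : Finset k, ∀ ev : B →ₐ[k] k, ∀ H ∈ conjDiag μ,
    h.map (ev : B →+* k) = H.val →
      ∀ i, Polynomial.aeval H.val.pullback (rootsPoly Λ) (X i) = 0 := by
  obtain ⟨Λ, hΛ⟩ := exists_rootsPoly μ (max (h.coord 0).totalDegree (h.coord 1).totalDegree)
  refine ⟨Λ, fun ev H hH hh i => ?_⟩
  have hd : H.deg ≤ max (h.coord 0).totalDegree (h.coord 1).totalDegree := by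
    rw [deg, ← hh]
    exact max_le_max (totalDegree_map_le _ _) (totalDegree_map_le _ _)
  obtain ⟨g, hg⟩ := hH
  rw [hg] at hd ⊢
  exact hΛ g hd i

/-- A limit of conjugates of a diagonal automorphism is conjugate to a diagonal automorphism,
possibly with other eigenvalues. -/
theorem IsLimitOfConj.exists_mem_conjDiag (hl : IsLimitOfConj μ h ev₀) {H₀ : PolyAut 2 k}
    (hH₀ : h.map (ev₀ : B →+* k) = H₀.val) : ∃ a, H₀ ∈ conjDiag a := by
  obtain ⟨Λ, hΛ⟩ := exists_rootsPoly_of_family μ h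
  have hP : ∀ i, Polynomial.aeval H₀.val.pullback (rootsPoly Λ) (X i) = 0 := by
    intro i
    have := hl.map_eq_zero
      (Polynomial.aeval h.pullback ((rootsPoly Λ).map (algebraMap k B)) (X i)) ?_
    · rwa [PolyEnd.map_aeval_pullback, rootsPoly_map_algebraMap, map_X, hH₀] at this
    · intro ev H hH hh
      rw [PolyEnd.map_aeval_pullback, rootsPoly_map_algebraMap, map_X, hh, hΛ ev H hH hh]
  have hj : H₀.val.jac = 1 := by
    have := hl.map_eq_zero (h.jac - 1) ?_
    · rwa [map_sub, ← PolyEnd.jac_map, map_one, hH₀, sub_eq_zero] at this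
    · intro ev H hH hh
      rw [map_sub, ← PolyEnd.jac_map, map_one, hh, jac_eq_one_of_mem_conjDiag hH, sub_self]
  obtain ⟨g, a, hg⟩ := exists_eq_conj_diagSAut hP hj
  exact ⟨a, g, hg⟩

end PolyAut

/-- If `∏ (φ - l)` annihilates `u ≠ 0`, then some partial product applied to `u` is an
eigenvector. -/
theorem exists_eigenvector_of_aeval_rootsPoly {k V : Type*} [Field k] [AddCommGroup V] [Module k V]
    {φ : Module.End k V} {Λ : Finset k} {u : V} (hu : u ≠ 0)
    (h : Polynomial.aeval φ (rootsPoly Λ) u = 0) :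
    ∃ l ∈ Λ, ∃ Λ' ⊆ Λ, Polynomial.aeval φ (rootsPoly Λ') u ≠ 0 ∧
      φ (Polynomial.aeval φ (rootsPoly Λ') u) = l • Polynomial.aeval φ (rootsPoly Λ') u := by
  classical
  induction Λ using Finset.induction_on with
  | empty => simp [rootsPoly] at h; exact absurd h hu
  | insert a s ha ih =>
    by_cases hs : Polynomial.aeval φ (rootsPoly s) u = 0
    · obtain ⟨l, hl, Λ', hΛ', h1⟩ := ih hs
      exact ⟨l, Finset.mem_insert_of_mem hl, Λ', hΛ'.trans (Finset.subset_insert _ _), h1⟩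
    · refine ⟨a, Finset.mem_insert_self _ _, s, Finset.subset_insert _ _, hs, ?_⟩
      rw [rootsPoly, Finset.prod_insert ha, ← rootsPoly, map_mul, Module.End.mul_apply] at h
      simpa [sub_eq_zero, Module.algebraMap_end_apply] using h

namespace PolyAut

variable {k : Type u} [Field k] [IsAlgClosed k]
variable {μ : kˣ} {B : Type u} [CommRing B] [Algebra k B] {h : PolyEnd 2 B} {ev₀ : B →ₐ[k] k}

/-- The identity is not a limit of conjugates of `(μ x, μ⁻¹ y) ≠ 1`: these have an eigenvector of
bounded degree with an eigenvalue from a finite set that does not contain `1`. -/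
theorem IsLimitOfConj.map_ne_one (hl : IsLimitOfConj μ h ev₀) (hμ : μ ≠ 1) :
    h.map (ev₀ : B →+* k) ≠ 1 := by
  classical
  intro h1
  obtain ⟨Λ, hΛ⟩ := exists_rootsPoly_of_family μ h
  set s : Finset (Fin 2 →₀ ℕ) := (Finset.range (Λ.card + 2)).biUnion fun t =>
    Finset.univ.biUnion fun i => ((h.pullback ^ t) (X i)).support with hs
  -- The operators `h^* - l`, truncated to the span of the monomials in `s`.
  let M : k → Matrix s s B := fun l => Matrix.of fun m m' =>
    coeff m.1 (h.pullback (monomial m'.1 1)) - algebraMap k B l * if m = m' then 1 else 0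
  have hM : ∀ (ev : B →ₐ[k] k) (l : k), ev (M l).det = (Matrix.of fun m m' : s =>
      coeff m.1 ((h.map (ev : B →+* k)).pullback (monomial m'.1 1)) -
        l * if m = m' then 1 else 0).det := by
    intro ev l
    rw [AlgHom.map_det]
    congr 1
    ext m m'
    have h2 := congr_arg (coeff m.1) (PolyEnd.map_pullback (ev : B →+* k) h (monomial m'.1 1))
    rw [coeff_map, map_monomial, map_one (ev : B →+* k)] at h2
    simp only [AlgHom.mapMatrix_apply, Matrix.map_apply, Matrix.of_apply, M, map_sub,
      map_mul, AlgHom.commutes, Algebra.algebraMap_self, RingHom.id_apply]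
    rw [← h2]
    congr 2
    split_ifs <;> simp
  have hD : ev₀ (∏ l ∈ Λ.erase 1, (M l).det) ≠ 0 := by
    rw [map_prod, Finset.prod_ne_zero_iff]
    intro l hl
    rw [hM, h1]
    have h2 : (Matrix.of fun m m' : s =>
      coeff m.1 ((1 : PolyEnd 2 k).pullback (monomial m'.1 1)) - l * if m = m' then 1 else 0) =
        (1 - l) • (1 : Matrix s s k) := by
      ext m m'
      rw [PolyEnd.pullback_one, Matrix.of_apply, Module.End.one_apply, coeff_monomial,
        Matrix.smul_apply, Matrix.one_apply, smul_eq_mul, sub_mul, one_mul]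
      congr 1
      exact if_congr (by rw [Subtype.ext_iff, eq_comm]) rfl rfl
    rw [h2, Matrix.det_smul, Matrix.det_one, mul_one]
    exact pow_ne_zero _ (sub_ne_zero.mpr (Finset.ne_of_mem_erase hl).symm)
  obtain ⟨ev, hev, H, hH, hh⟩ := hl _ hD
  rw [map_prod, Finset.prod_ne_zero_iff] at hev
  obtain ⟨i, hi⟩ : ∃ i, H.val.pullback (X i) - X i ≠ 0 := by
    by_contra! hne
    refine ne_one_of_mem_conjDiag hμ hH (ext_coord fun i => ?_)
    rw [← PolyEnd.pullback_X, sub_eq_zero.mp (hne i), coord_one]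
  have hu : H.val.pullback (X i) - X i =
      Polynomial.aeval H.val.pullback (Polynomial.X - Polynomial.C (1 : k)) (X i) := by
    simp
  have hker : Polynomial.aeval H.val.pullback (rootsPoly (Λ.erase 1))
      (H.val.pullback (X i) - X i) = 0 := by
    rw [hu, ← Module.End.mul_apply, ← map_mul (Polynomial.aeval H.val.pullback)]
    by_cases h1Λ : (1 : k) ∈ Λ
    · rw [mul_comm, ← rootsPoly_eq_mul h1Λ, hΛ ev H hH hh]
    · rw [Finset.erase_eq_of_notMem h1Λ, mul_comm, map_mul, Module.End.mul_apply, hΛ ev H hH hh,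
        map_zero]
  obtain ⟨l, hl, Λ', hΛ', hv0, hv⟩ := exists_eigenvector_of_aeval_rootsPoly hi hker
  refine hev l hl ?_
  set v := Polynomial.aeval H.val.pullback (rootsPoly Λ') (H.val.pullback (X i) - X i) with hvdef
  have hsupp : ∀ m ∉ s, coeff m v = 0 := by
    intro m hm
    rw [hvdef, hu, ← Module.End.mul_apply, ← map_mul (Polynomial.aeval H.val.pullback),
      Polynomial.aeval_eq_sum_range, LinearMap.sum_apply, coeff_sum]
    refine Finset.sum_eq_zero fun t ht => ?_
    rw [LinearMap.smul_apply, coeff_smul, ← hh, ← map_X (ev : B →+* k), ← PolyEnd.map_pullback_pow,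
      coeff_map]
    suffices h0 : coeff m ((h.pullback ^ t) (X i)) = 0 by rw [h0, map_zero, smul_zero]
    rw [← notMem_support_iff]
    refine fun hmem => hm (Finset.mem_biUnion.mpr ⟨t, ?_, Finset.mem_biUnion.mpr
      ⟨i, Finset.mem_univ _, hmem⟩⟩)
    have hd : (rootsPoly Λ' * (Polynomial.X - Polynomial.C 1)).natDegree ≤ Λ.card + 1 := by
      refine Polynomial.natDegree_mul_le.trans (add_le_add ?_ (Polynomial.natDegree_X_sub_C_le _))
      rw [rootsPoly, Polynomial.natDegree_finsetProd_X_sub_C_eq_card]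
      exact Finset.card_le_card (hΛ'.trans (Finset.erase_subset _ _))
    have := Finset.mem_range.mp ht
    exact Finset.mem_range.mpr (by omega)
  rw [hM, ← Matrix.exists_mulVec_eq_zero_iff]
  refine ⟨fun m => coeff m.1 v, fun h0 => hv0 ?_, ?_⟩
  · ext m
    by_cases hm : m ∈ s
    · exact congr_fun h0 ⟨m, hm⟩
    · exact hsupp m hm
  · have hvsum : v = ∑ m : s, coeff m.1 v • monomial m.1 1 := by
      conv_lhs => rw [v.as_sum]
      rw [Finset.sum_coe_sort s fun m => coeff m v • monomial m (1 : k)]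
      simp only [smul_monomial, smul_eq_mul, mul_one]
      refine Finset.sum_subset (fun m hm => ?_) fun m _ hm => ?_
      · by_contra hms
        exact mem_support_iff.mp hm (hsupp m hms)
      · rw [notMem_support_iff.mp hm, monomial_zero]
    funext m
    rw [Matrix.mulVec, dotProduct]
    have h2 := congr_arg (coeff m.1) hv
    conv_lhs at h2 => rw [hvsum, map_sum]
    simp only [map_smul, coeff_sum, coeff_smul, smul_eq_mul] at h2
    simp only [Matrix.of_apply, sub_mul, Finset.sum_sub_distrib, hh, Pi.zero_apply]
    rw [sub_eq_zero]
    simp only [mul_comm (coeff m.1 _) (coeff _ v)]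
    rw [h2]
    simp

end PolyAut

/-! ### Nondegenerate solutions of polynomial systems persist under specialization -/

section Etale

variable {B : Type u} [CommRing B] {ι : Type} [Finite ι]

/-- The ring `B[x] / (v)` localized at the Jacobian determinant is flat and of finite presentation
over `B`, being étale. -/
theorem flat_localization_jacobian (v : ι → MvPolynomial ι B) :
    let P := Algebra.PreSubmersivePresentation.naive (v := v) id Function.injective_id
    Module.Flat B (Localization.Away P.jacobian) ∧
      Algebra.FinitePresentation B (Localization.Away P.jacobian) := by
  intro P
  let Q : Algebra.PreSubmersivePresentation B (Localization.Away P.jacobian) _ _ :=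
    (Algebra.PreSubmersivePresentation.localizationAway
      (Localization.Away P.jacobian) P.jacobian).comp P
  have hQ : IsUnit Q.jacobian := by
    rw [Algebra.PreSubmersivePresentation.comp_jacobian_eq_jacobian_smul_jacobian,
      Algebra.PreSubmersivePresentation.localizationAway_jacobian, Algebra.smul_def]
    exact (IsLocalization.Away.algebraMap_isUnit _).mul (IsLocalization.Away.algebraMap_isUnit _)
  have : Algebra.IsStandardSmooth B (Localization.Away P.jacobian) :=
    (⟨Q, hQ⟩ : Algebra.SubmersivePresentation B (Localization.Away P.jacobian) _ _).isStandardSmooth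
  exact ⟨inferInstance, inferInstance⟩

variable {k : Type u} [Field k] [Algebra k B]

/-- A nondegenerate solution `ξ₀` of a square system `v`, with coefficients specialized at a point
`ev₀` of `Spec B`, extends to all points in a neighbourhood of `ev₀`, and so does the inequation
`q(ξ₀) ≠ 0`: étale maps are open. -/
theorem exists_solution_of_nondegenerate [Fintype ι] [DecidableEq ι] (v : ι → MvPolynomial ι B)
    (q : MvPolynomial ι B) (ev₀ : B →ₐ[k] k) (ξ₀ : ι → k)
    (hv : ∀ i, eval₂ (ev₀ : B →+* k) ξ₀ (v i) = 0) (hq : eval₂ (ev₀ : B →+* k) ξ₀ q ≠ 0)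
    (hJ : eval₂ (ev₀ : B →+* k) ξ₀ (Matrix.of fun i j => pderiv i (v j)).det ≠ 0) :
    ∃ s : B, ev₀ s ≠ 0 ∧ ∀ ev : B →ₐ[k] k, ev s ≠ 0 →
      ∃ (K : Type u) (_ : Field K) (φ : k →+* K) (ξ : ι → K),
        (∀ i, eval₂ (φ.comp (ev : B →+* k)) ξ (v i) = 0) ∧
          eval₂ (φ.comp (ev : B →+* k)) ξ q ≠ 0 := by
  set P := Algebra.PreSubmersivePresentation.naive (v := v) id Function.injective_id with hP
  let S := MvPolynomial ι B ⧸ Ideal.span (Set.range v)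
  let T := Localization.Away P.jacobian
  obtain ⟨hflat, hfp⟩ := flat_localization_jacobian v
  change Module.Flat B T at hflat
  change Algebra.FinitePresentation B T at hfp
  have hjac : P.jacobian =
      Ideal.Quotient.mk (Ideal.span (Set.range v)) (Matrix.of fun i j => pderiv i (v j)).det := by
    rw [Algebra.PreSubmersivePresentation.jacobian_eq_jacobiMatrix_det]
    have : P.jacobiMatrix = Matrix.of fun i j => pderiv i (v j) := by
      ext1 i j
      exact Algebra.PreSubmersivePresentation.jacobiMatrix_naive _ _ _ _ i j
    rw [this]
    rfl
  -- the homomorphism `T → k` given by the solution `ξ₀`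
  let e₁ : S →+* k := Ideal.Quotient.lift _ (eval₂Hom (ev₀ : B →+* k) ξ₀) (by
    intro p hp
    have : Ideal.span (Set.range v) ≤ RingHom.ker (eval₂Hom (ev₀ : B →+* k) ξ₀) := by
      rw [Ideal.span_le]
      rintro _ ⟨i, rfl⟩
      exact hv i
    exact this hp)
  have he₁ : ∀ p, e₁ (Ideal.Quotient.mk _ p) = eval₂ (ev₀ : B →+* k) ξ₀ p := fun p => rfl
  have hu : IsUnit (e₁ P.jacobian) := by
    rw [hjac, he₁]; exact isUnit_iff_ne_zero.mpr hJ
  let e : T →+* k := IsLocalization.Away.lift P.jacobian hu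
  have he : ∀ p : S, e (algebraMap S T p) = e₁ p := fun p => IsLocalization.Away.lift_eq _ hu p
  let τ : MvPolynomial ι B →+* T := (algebraMap S T).comp (Ideal.Quotient.mk _)
  have hτ : ∀ b, τ (C b) = algebraMap B T b := fun b => by
    rw [IsScalarTower.algebraMap_apply B S T]; rfl
  have heτ : ∀ p, e (τ p) = eval₂ (ev₀ : B →+* k) ξ₀ p := fun p => (he _).trans (he₁ p)
  have hopen := (PrimeSpectrum.isOpenMap_comap_of_hasGoingDown_of_finitePresentation
    (R := B) (S := T)) _ (PrimeSpectrum.basicOpen (τ q)).isOpen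
  let x₀ : PrimeSpectrum B := ⟨RingHom.ker (ev₀ : B →+* k), RingHom.ker_isPrime _⟩
  have hx₀ : x₀ ∈ PrimeSpectrum.comap (algebraMap B T) ''
      (PrimeSpectrum.basicOpen (τ q) : Set _) := by
    refine ⟨⟨RingHom.ker e, RingHom.ker_isPrime _⟩, ?_, ?_⟩
    · change τ q ∉ RingHom.ker e
      rw [RingHom.mem_ker, heτ]
      exact hq
    · ext b
      change e (algebraMap B T b) = 0 ↔ ev₀ b = 0
      rw [← hτ, heτ, eval₂_C]
      rfl
  obtain ⟨_, ⟨s, rfl⟩, hs, hsub⟩ :=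
    PrimeSpectrum.isTopologicalBasis_basic_opens.exists_subset_of_mem_open hx₀ hopen
  refine ⟨s, hs, fun ev hev => ?_⟩
  obtain ⟨𝔮, h𝔮, hcomap⟩ := hsub (show (⟨RingHom.ker (ev : B →+* k), RingHom.ker_isPrime _⟩ :
    PrimeSpectrum B) ∈ PrimeSpectrum.basicOpen s from hev)
  let K := 𝔮.asIdeal.ResidueField
  let ρ : T →+* K := algebraMap T K
  have hρ : ∀ t, ρ t = 0 ↔ t ∈ 𝔮.asIdeal := fun t => Ideal.algebraMap_residueField_eq_zero
  let φ : k →+* K := (ρ.comp (algebraMap B T)).comp (algebraMap k B)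
  have hφ : ∀ b, φ (ev b) = ρ (algebraMap B T b) := by
    intro b
    have h1 : algebraMap k B (ev b) - b ∈ RingHom.ker (ev : B →+* k) := by
      rw [RingHom.mem_ker]
      change ev _ = 0
      rw [map_sub, ev.commutes, Algebra.algebraMap_self, RingHom.id_apply, sub_self]
    have h2 : algebraMap B T (algebraMap k B (ev b) - b) ∈ 𝔮.asIdeal := by
      have h3 : algebraMap k B (ev b) - b ∈ (PrimeSpectrum.comap (algebraMap B T) 𝔮).asIdeal :=
        hcomap ▸ h1
      exact h3
    rw [← hρ, map_sub, map_sub, sub_eq_zero] at h2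
    exact h2
  have hev : ∀ p, eval₂ (φ.comp (ev : B →+* k)) (fun i => ρ (τ (X i))) p = ρ (τ p) := by
    intro p
    have : eval₂Hom (φ.comp (ev : B →+* k)) (fun i => ρ (τ (X i))) = ρ.comp τ := by
      refine ringHom_ext (fun b => ?_) fun i => ?_
      · rw [coe_eval₂Hom, eval₂_C]
        exact (hφ b).trans (by rw [← hτ]; rfl)
      · rw [coe_eval₂Hom, eval₂_X]; rfl
    exact DFunLike.congr_fun this p
  refine ⟨K, inferInstance, φ, fun i => ρ (τ (X i)), fun i => ?_, ?_⟩
  · rw [hev]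
    have : Ideal.Quotient.mk (Ideal.span (Set.range v)) (v i) = 0 :=
      Ideal.Quotient.eq_zero_iff_mem.mpr (Ideal.subset_span ⟨i, rfl⟩)
    change ρ (algebraMap S T (Ideal.Quotient.mk _ (v i))) = 0
    rw [this, map_zero, map_zero]
  · rw [hev, Ne, hρ]
    exact h𝔮

end Etale

/-! ### Multipliers at fixed points -/

namespace PolyEnd

variable {n : ℕ} {k : Type u} [CommRing k]

theorem jacobianMatrix_mul (f g : PolyEnd n k) :
    (f * g).jacobianMatrix = g.comap.mapMatrix f.jacobianMatrix * g.jacobianMatrix := by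
  ext1 i j
  simp only [jacobianMatrix, Matrix.of_apply, Matrix.mul_apply, coord_mul, pderiv_comap]
  rfl

variable {K : Type u} [CommRing K]

/-- The image of the `K`-point `ξ` under an endomorphism of affine space. -/
def evalAt (φ : k →+* K) (f : PolyEnd n k) (ξ : Fin n → K) : Fin n → K :=
  fun i => eval₂ φ ξ (f.coord i)

theorem eval₂_comap (φ : k →+* K) (f : PolyEnd n k) (ξ : Fin n → K) (p : MvPolynomial (Fin n) k) :
    eval₂ φ ξ (f.comap p) = eval₂ φ (f.evalAt φ ξ) p := by
  rw [comap, ← coe_eval₂Hom, eval₂Hom_bind₁]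
  rfl

theorem evalAt_mul (φ : k →+* K) (f g : PolyEnd n k) (ξ : Fin n → K) :
    (f * g).evalAt φ ξ = f.evalAt φ (g.evalAt φ ξ) :=
  funext fun i => eval₂_comap φ g ξ (f.coord i)

theorem evalAt_one (φ : k →+* K) (ξ : Fin n → K) : (1 : PolyEnd n k).evalAt φ ξ = ξ :=
  funext fun i => eval₂_X _ _ i

/-- The Jacobian matrix of an endomorphism at a `K`-point. -/
def jacobianMatrixAt (φ : k →+* K) (f : PolyEnd n k) (ξ : Fin n → K) : Matrix (Fin n) (Fin n) K :=
  f.jacobianMatrix.map (eval₂ φ ξ)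

theorem jacobianMatrixAt_mul (φ : k →+* K) (f g : PolyEnd n k) (ξ : Fin n → K) :
    (f * g).jacobianMatrixAt φ ξ =
      f.jacobianMatrixAt φ (g.evalAt φ ξ) * g.jacobianMatrixAt φ ξ := by
  rw [jacobianMatrixAt, jacobianMatrix_mul, ← coe_eval₂Hom, Matrix.map_mul]
  congr 1
  ext1 i j
  exact eval₂_comap φ g ξ _

end PolyEnd

namespace PolyAut

variable {k : Type u} [Field k] {K : Type u} [Field K]

/-- Conjugate automorphisms have similar Jacobian matrices at corresponding fixed points. -/
theorem exists_jacobianMatrixAt_conj (φ : k →+* K) (f g : PolyAut 2 k) {η : Fin 2 → K}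
    (hη : f.val.evalAt φ η = η) : ∃ A : Matrix (Fin 2) (Fin 2) K, IsUnit A.det ∧
      (g * f * g⁻¹).val.jacobianMatrixAt φ (g.val.evalAt φ η) =
        A * f.val.jacobianMatrixAt φ η * A⁻¹ := by
  obtain ⟨e, he, hge⟩ := exists_jac_eq_C g
  have hA : IsUnit (g.val.jacobianMatrixAt φ η).det := by
    have : (g.val.jacobianMatrixAt φ η).det = eval₂ φ η g.val.jac := by
      rw [PolyEnd.jacobianMatrixAt, PolyEnd.jac, ← coe_eval₂Hom, RingHom.map_det]
      rfl
    rw [this, hge, eval₂_C]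
    exact isUnit_iff_ne_zero.mpr ((map_ne_zero φ).mpr he)
  refine ⟨g.val.jacobianMatrixAt φ η, hA, ?_⟩
  have h1 : (g * f * g⁻¹).val * g.val = g.val * f.val := by
    rw [← Units.val_mul, inv_mul_cancel_right, Units.val_mul]
  have h2 := PolyEnd.jacobianMatrixAt_mul φ (g * f * g⁻¹).val g.val η
  rw [h1, PolyEnd.jacobianMatrixAt_mul, hη] at h2
  rw [h2, Matrix.mul_nonsing_inv_cancel_right _ _ hA]

theorem jacobianMatrixAt_diagSAut (φ : k →+* K) (a : kˣ) (η : Fin 2 → K) :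
    (diagSAut a : PolyAut 2 k).val.jacobianMatrixAt φ η =
      Matrix.diagonal ![φ a, φ (a⁻¹ : kˣ)] := by
  rw [coe_diagSAut]
  ext i j
  fin_cases i <;> fin_cases j <;>
    simp [PolyEnd.jacobianMatrixAt, PolyEnd.jacobianMatrix, coord_diag]

theorem trace_jacobianMatrixAt {a : kˣ} {H : PolyAut 2 k} (hH : H ∈ conjDiag a) (φ : k →+* K)
    {ξ : Fin 2 → K} (hξ : H.val.evalAt φ ξ = ξ) :
    (H.val.jacobianMatrixAt φ ξ).trace = φ (a + (a⁻¹ : kˣ)) := by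
  obtain ⟨g, rfl⟩ := hH
  set f : PolyAut 2 k := (diagSAut a : PolyAut 2 k) with hf
  have hg : g.val.evalAt φ ((g⁻¹).val.evalAt φ ξ) = ξ := by
    rw [← PolyEnd.evalAt_mul, ← Units.val_mul, mul_inv_cancel, Units.val_one, PolyEnd.evalAt_one]
  have hη : f.val.evalAt φ ((g⁻¹).val.evalAt φ ξ) = (g⁻¹).val.evalAt φ ξ := by
    conv_rhs => rw [← hξ]
    rw [← PolyEnd.evalAt_mul, ← PolyEnd.evalAt_mul, ← Units.val_mul, ← Units.val_mul]
    congr 2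
    group
  obtain ⟨A, hA, h⟩ := exists_jacobianMatrixAt_conj φ f g hη
  rw [hg] at h
  rw [h, Matrix.trace_mul_cycle, Matrix.nonsing_inv_mul _ hA, one_mul, hf,
    jacobianMatrixAt_diagSAut, Matrix.trace_diagonal, Fin.sum_univ_two, map_add]
  rfl

/-- A conjugate of `(a x, a⁻¹ y) ≠ 1` has a nondegenerate fixed point, over `k`. -/
theorem exists_fixedPoint {a : kˣ} (ha : a ≠ 1) {H : PolyAut 2 k} (hH : H ∈ conjDiag a) :
    ∃ ξ : Fin 2 → k, H.val.evalAt (RingHom.id k) ξ = ξ ∧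
      (H.val.jacobianMatrixAt (RingHom.id k) ξ - 1).det ≠ 0 := by
  obtain ⟨g, rfl⟩ := hH
  set f : PolyAut 2 k := (diagSAut a : PolyAut 2 k) with hf
  have hη : f.val.evalAt (RingHom.id k) 0 = 0 := by
    funext i
    rw [hf, coe_diagSAut, PolyEnd.evalAt, coord_diag]
    fin_cases i <;> simp
  obtain ⟨A, hA, h⟩ := exists_jacobianMatrixAt_conj (RingHom.id k) f g hη
  refine ⟨g.val.evalAt (RingHom.id k) 0, ?_, ?_⟩
  · rw [← PolyEnd.evalAt_mul, ← Units.val_mul, inv_mul_cancel_right, Units.val_mul,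
      PolyEnd.evalAt_mul, hη]
  · have h1 : A * f.val.jacobianMatrixAt (RingHom.id k) 0 * A⁻¹ - 1 =
        A * (f.val.jacobianMatrixAt (RingHom.id k) 0 - 1) * A⁻¹ := by
      rw [mul_sub, sub_mul, mul_one, Matrix.mul_nonsing_inv _ hA]
    rw [h, h1, Matrix.det_conj ((Matrix.isUnit_iff_isUnit_det A).mpr hA), hf,
      jacobianMatrixAt_diagSAut, Matrix.det_fin_two]
    have h2 : (a : k) ≠ 1 := fun h => ha (Units.ext h)
    simpa [sub_eq_zero] using h2

end PolyAut

/-! ### Limits of conjugates are conjugates -/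

namespace PolyAut

variable {k : Type u} [Field k]
variable {μ : kˣ} {B : Type u} [CommRing B] [Algebra k B] {h : PolyEnd 2 B} {ev₀ : B →ₐ[k] k}

theorem eval₂_trace_sub {n : ℕ} {C K : Type u} [CommRing C] [CommRing K] (φ : C →+* K)
    (f : PolyEnd n C) (ξ : Fin n → K) (c : C) :
    eval₂ φ ξ (f.jacobianMatrix.trace - MvPolynomial.C c) =
      (f.jacobianMatrixAt φ ξ).trace - φ c := by
  rw [← coe_eval₂Hom, map_sub, PolyEnd.jacobianMatrixAt, ← coe_eval₂Hom, AddMonoidHom.map_trace,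
    coe_eval₂Hom, eval₂_C]

/-- If `H₀ ≠ 1` is a limit of conjugates of `(μ x, μ⁻¹ y)` and conjugate to `(a x, a⁻¹ y)`, then
nearby members of the family have a fixed point near that of `H₀`, and the trace of the Jacobian
matrix there is constant. -/
theorem IsLimitOfConj.add_inv_eq (hl : IsLimitOfConj μ h ev₀) {H₀ : PolyAut 2 k}
    (hH₀ : h.map (ev₀ : B →+* k) = H₀.val) {a : kˣ} (ha : a ≠ 1) (hmem : H₀ ∈ conjDiag a) :
    (a : k) + (a⁻¹ : kˣ) = μ + (μ⁻¹ : kˣ) := by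
  by_contra hne
  obtain ⟨ξ₀, hfix, hdet⟩ := exists_fixedPoint ha hmem
  let v : Fin 2 → MvPolynomial (Fin 2) B := fun i => h.coord i - X i
  let q : MvPolynomial (Fin 2) B :=
    h.jacobianMatrix.trace - C (algebraMap k B (μ + (μ⁻¹ : kˣ)))
  -- evaluation at a `K`-point of the specialization along `ev`
  have hspec : ∀ (ev : B →ₐ[k] k) {K : Type u} [Field K] (φ : k →+* K) (ξ : Fin 2 → K) p,
      eval₂ (φ.comp (ev : B →+* k)) ξ p = eval₂ φ ξ (MvPolynomial.map (ev : B →+* k) p) :=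
    fun ev K _ φ ξ p => (eval₂_map _ _ _ _).symm
  have hspec₀ : ∀ p, eval₂ (ev₀ : B →+* k) ξ₀ p =
      eval₂ (RingHom.id k) ξ₀ (MvPolynomial.map (ev₀ : B →+* k) p) :=
    fun p => hspec ev₀ (RingHom.id k) ξ₀ p
  have hv : ∀ (ev : B →ₐ[k] k) (i : Fin 2), MvPolynomial.map (ev : B →+* k) (v i) =
      (h.map (ev : B →+* k)).coord i - X i := fun ev i => by
    rw [map_sub, map_X]; rfl
  have hq : ∀ ev : B →ₐ[k] k, MvPolynomial.map (ev : B →+* k) q =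
      (h.map (ev : B →+* k)).jacobianMatrix.trace - C (μ + (μ⁻¹ : kˣ) : k) := fun ev => by
    rw [map_sub, map_C, PolyEnd.jacobianMatrix_map, AddMonoidHom.map_trace]
    congr 2
    exact ev.commutes _
  obtain ⟨s, hs, hsol⟩ := exists_solution_of_nondegenerate v q ev₀ ξ₀ (fun i => by
      rw [hspec₀, hv, hH₀, ← coe_eval₂Hom, map_sub, coe_eval₂Hom, eval₂_X, sub_eq_zero]
      exact congr_fun hfix i) (by
      rw [hspec₀, hq, hH₀, eval₂_trace_sub, trace_jacobianMatrixAt hmem _ hfix, ← map_sub]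
      exact sub_ne_zero.mpr hne) (by
      have h1 : (Matrix.of fun i j => pderiv i (v j)) = (h.jacobianMatrix - 1).transpose := by
        ext1 i j
        simp only [v, Matrix.of_apply, map_sub, pderiv_X, Matrix.transpose_apply, Matrix.sub_apply,
          PolyEnd.jacobianMatrix, Matrix.one_apply, Pi.single_apply]
      rw [h1, Matrix.det_transpose, hspec₀, RingHom.map_det, map_sub, ← PolyEnd.jacobianMatrix_map,
        hH₀, map_one, ← coe_eval₂Hom, RingHom.map_det, map_sub, map_one]
      exact hdet)
  obtain ⟨ev, hev, H, hH, hh⟩ := hl s hs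
  obtain ⟨K, _, φ, ξ, h1, h2⟩ := hsol ev hev
  refine h2 ?_
  have hξ : H.val.evalAt φ ξ = ξ := by
    funext i
    have h3 := h1 i
    rw [hspec, hv, hh, ← coe_eval₂Hom, map_sub, coe_eval₂Hom, eval₂_X, sub_eq_zero] at h3
    exact h3
  rw [hspec, hq, hh, eval₂_trace_sub, trace_jacobianMatrixAt hH _ hξ, sub_self]

theorem conjDiag_inv (μ : kˣ) : conjDiag μ⁻¹ = conjDiag μ := by
  have key : ∀ μ : kˣ, conjDiag μ⁻¹ ⊆ conjDiag μ := by
    rintro μ _ ⟨g, rfl⟩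
    refine ⟨g * swap k, ?_⟩
    have h1 : swap k * (diagSAut μ : PolyAut 2 k) = (diagSAut μ⁻¹ : PolyAut 2 k) * swap k := by
      refine ext_coord fun i => ?_
      rw [coord_mul, coord_mul, coe_diagSAut, coe_diagSAut, coord_diag, coord_diag, coord_swap]
      fin_cases i <;> simp
    rw [mul_assoc g (swap k), h1, mul_inv_rev]
    group
  refine (key μ).antisymm ?_
  have := key μ⁻¹
  rwa [inv_inv] at this

variable [IsAlgClosed k]

theorem IsLimitOfConj.mem_conjDiag (hl : IsLimitOfConj μ h ev₀) {H₀ : PolyAut 2 k}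
    (hH₀ : h.map (ev₀ : B →+* k) = H₀.val) : H₀ ∈ conjDiag μ := by
  obtain ⟨a, ha⟩ := hl.exists_mem_conjDiag hH₀
  have hdiag : (diagSAut (1 : kˣ) : PolyAut 2 k) = 1 := by
    rw [coe_diagSAut]
    refine ext_coord fun i => ?_
    rw [coord_diag, coord_one]
    fin_cases i <;> simp
  by_cases hμ : μ = 1
  · have h1 : H₀ = 1 := by
      refine ext_coord fun i => ?_
      have := hl.map_eq_zero (h.coord i - X i) ?_
      · rwa [map_sub, map_X, ← PolyEnd.coord_map, hH₀, sub_eq_zero] at this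
      · rintro ev _ ⟨g, rfl⟩ hh
        rw [map_sub, map_X, ← PolyEnd.coord_map, hh, hμ, hdiag, mul_one, mul_inv_cancel,
          sub_eq_zero]
        rfl
    exact ⟨1, by rw [h1, hμ, hdiag]; simp⟩
  · have ha1 : a ≠ 1 := by
      rintro rfl
      obtain ⟨g, hg⟩ := ha
      rw [hdiag, mul_one, mul_inv_cancel] at hg
      exact hl.map_ne_one hμ (by rw [hH₀, hg]; rfl)
    have h1 := hl.add_inv_eq hH₀ ha1 ha
    have h2 : ((a : k) - μ) * (1 - (a⁻¹ : kˣ) * (μ⁻¹ : kˣ)) = 0 := by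
      have e1 : (a : k) * (a⁻¹ : kˣ) = 1 := a.mul_inv
      have e2 : (μ : k) * (μ⁻¹ : kˣ) = 1 := μ.mul_inv
      linear_combination h1 - ((μ⁻¹ : kˣ) : k) * e1 + ((a⁻¹ : kˣ) : k) * e2
    rcases mul_eq_zero.mp h2 with h3 | h3
    · have : a = μ := Units.ext (sub_eq_zero.mp h3)
      rwa [← this]
    · have h4 : a⁻¹ * μ⁻¹ = 1 := Units.ext (sub_eq_zero.mp h3).symm
      have : a = μ⁻¹ := by
        rw [← inv_inj]; exact eq_inv_of_mul_eq_one_left h4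
      rwa [← conjDiag_inv, ← this]

end PolyAut

/-! ### Morphisms from varieties as families over affine opens -/

namespace AlgVariety

variable {k : Type u} [Field k]

/-- A `k`-point whose image lies in an affine open `Spec B ⟶ A` comes from a homomorphism
`B ⟶ k`. -/
theorem exists_hom_of_mem_range {A : AlgVariety k} {B : CommRingCat.{u}} (j : Spec B ⟶ A.scheme)
    [IsOpenImmersion j] (a : A.Point) (ha : a.1 (IsLocalRing.closedPoint k) ∈ Set.range j) :
    ∃ e : B ⟶ CommRingCat.of k, Spec.map e ≫ j = a.1 := by
  have hr : Set.range a.1 ⊆ Set.range j := by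
    rintro _ ⟨x, rfl⟩
    have hx : x = IsLocalRing.closedPoint k := Subsingleton.elim (α := PrimeSpectrum k) _ _
    rwa [hx]
  refine ⟨Spec.preimage (IsOpenImmersion.lift j a.1 hr), ?_⟩
  rw [Spec.map_preimage, IsOpenImmersion.lift_fac]

/-- The projection `A × 𝔸ⁿ ⟶ 𝔸ⁿ`. -/
def projAffine (A : AlgVariety k) (n : ℕ) :
    A.prodAffine n ⟶ Spec (CommRingCat.of (MvPolynomial (Fin n) k)) :=
  Limits.pullback.snd A.str (affineStr n k)

theorem fibreIncl_proj (A : AlgVariety k) (n : ℕ) (a : A.Point) :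
    A.fibreIncl n a ≫ A.proj n = affineStr n k ≫ a.1 :=
  Limits.pullback.lift_fst _ _ _

theorem fibreIncl_projAffine (A : AlgVariety k) (n : ℕ) (a : A.Point) :
    A.fibreIncl n a ≫ A.projAffine n = 𝟙 _ :=
  Limits.pullback.lift_snd _ _ _

theorem prodAffine_hom_ext {A : AlgVariety k} {n : ℕ} {T : Scheme.{u}} {f g : T ⟶ A.prodAffine n}
    (h₁ : f ≫ A.proj n = g ≫ A.proj n) (h₂ : f ≫ A.projAffine n = g ≫ A.projAffine n) : f = g :=
  Limits.pullback.hom_ext h₁ h₂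

/-- The morphism `𝔸ⁿ_B ⟶ A × 𝔸ⁿ` induced by a morphism `Spec B ⟶ A`. -/
theorem exists_hom_prodAffine (A : AlgVariety k) (n : ℕ) {B : CommRingCat.{u}}
    (j : Spec B ⟶ A.scheme) (c : CommRingCat.of k ⟶ B) (hc : Spec.map c = j ≫ A.str) :
    ∃ Ψ : Spec (CommRingCat.of (MvPolynomial (Fin n) B)) ⟶ A.prodAffine n,
      Ψ ≫ A.proj n = Spec.map (CommRingCat.ofHom C) ≫ j ∧
        Ψ ≫ A.projAffine n = Spec.map (CommRingCat.ofHom (MvPolynomial.map c.hom)) := by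
  refine ⟨Limits.pullback.lift (Spec.map (CommRingCat.ofHom C) ≫ j)
    (Spec.map (CommRingCat.ofHom (MvPolynomial.map c.hom))) ?_, Limits.pullback.lift_fst _ _ _,
    Limits.pullback.lift_snd _ _ _⟩
  rw [Category.assoc, ← hc, affineStr, ← Spec.map_comp, ← Spec.map_comp]
  congr 1
  exact CommRingCat.hom_ext (RingHom.ext fun x => (map_C c.hom x).symm)

/-- A morphism from a variety to the group of automorphisms is given, over an affine open `Spec B`,
by an endomorphism of affine space over `B`. -/
theorem exists_polyEnd_of_isMorphismToAut {A : AlgVariety k} {n : ℕ} {F : A.Point → PolyAut n k}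
    (hF : A.IsMorphismToAut n F) {B : CommRingCat.{u}} (j : Spec B ⟶ A.scheme)
    (c : CommRingCat.of k ⟶ B) (hc : Spec.map c = j ≫ A.str) :
    ∃ h : PolyEnd n B, ∀ (a : A.Point) (e : B ⟶ CommRingCat.of k), Spec.map e ≫ j = a.1 →
      h.map e.hom = (F a).val := by
  obtain ⟨φ, -, hφ⟩ := hF
  obtain ⟨Ψ, hΨ₁, hΨ₂⟩ := A.exists_hom_prodAffine n j c hc
  let θ : CommRingCat.of (MvPolynomial (Fin n) k) ⟶ CommRingCat.of (MvPolynomial (Fin n) B) :=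
    Spec.preimage (Ψ ≫ φ.hom ≫ A.projAffine n)
  refine ⟨⟨fun i => θ.hom (X i)⟩, fun a e he => ?_⟩
  have hce : c ≫ e = 𝟙 _ := by
    apply Spec.map_injective
    rw [Spec.map_comp, hc, ← Category.assoc, he, a.2, Spec.map_id]
  have hΨ : Spec.map (CommRingCat.ofHom (MvPolynomial.map e.hom)) ≫ Ψ = A.fibreIncl n a := by
    apply prodAffine_hom_ext
    · rw [Category.assoc, hΨ₁, fibreIncl_proj, ← Category.assoc, ← Spec.map_comp, ← he, affineStr,
        ← Category.assoc, ← Spec.map_comp]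
      congr 2
      exact CommRingCat.hom_ext (RingHom.ext fun x => map_C e.hom x)
    · rw [Category.assoc, hΨ₂, fibreIncl_projAffine, ← Spec.map_comp, ← CommRingCat.ofHom_comp]
      have : (MvPolynomial.map (σ := Fin n) e.hom).comp (MvPolynomial.map c.hom) =
          RingHom.id _ := by
        have h1 : e.hom.comp c.hom = RingHom.id k := by
          rw [← CommRingCat.hom_comp, hce]; rfl
        refine MvPolynomial.ringHom_ext (fun x => ?_) fun i => ?_
        · rw [RingHom.comp_apply, map_C, map_C]
          exact congr_arg C (DFunLike.congr_fun h1 x)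
        · rw [RingHom.comp_apply, map_X, map_X]
          rfl
      rw [this]
      exact Spec.map_id _
  have hθ : θ ≫ CommRingCat.ofHom (MvPolynomial.map e.hom) =
      CommRingCat.ofHom (F a).val.comap.toRingHom := by
    apply Spec.map_injective
    rw [Spec.map_comp, Spec.map_preimage, ← Category.assoc, hΨ, ← Category.assoc, hφ a,
      Category.assoc, fibreIncl_projAffine, Category.comp_id]
    rfl
  ext1
  funext i
  have h1 := congr_arg (fun f => f.hom (X i)) hθ
  exact h1.trans (PolyEnd.pullback_X (F a).val i)

end AlgVariety

namespace PolyAut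

variable {k : Type u} [Field k]

theorem isClosed_iff {n : ℕ} {S : Set (PolyAut n k)} : IsClosed S ↔
    ∀ (A : AlgVariety k) (F : A.Point → PolyAut n k), A.IsMorphismToAut n F →
      IsClosed (F ⁻¹' S) := by
  rw [← isOpen_compl_iff]
  change Sᶜᶜ ∈ {C | _} ↔ _
  rw [compl_compl]
  rfl

theorem isClosed_conjDiag [IsAlgClosed k] (μ : kˣ) : IsClosed (conjDiag μ) := by
  rw [isClosed_iff]
  intro A F hF
  rw [← closure_subset_iff_isClosed]
  intro a₀ ha₀
  rw [mem_closure_iff] at ha₀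
  obtain ⟨U, hU, hx, -⟩ := exists_isAffineOpen_mem_and_subset
    (show a₀.1 (IsLocalRing.closedPoint k) ∈ (⊤ : A.scheme.Opens) from trivial)
  set j := hU.fromSpec with hj
  set c := Spec.preimage (j ≫ A.str) with hc
  obtain ⟨h, hh⟩ := AlgVariety.exists_polyEnd_of_isMorphismToAut hF j c (Spec.map_preimage _)
  let : Algebra k Γ(A.scheme, U) := c.hom.toAlgebra
  have hpt : ∀ a : A.Point, a.1 (IsLocalRing.closedPoint k) ∈ Set.range j →
      ∃ ev : Γ(A.scheme, U) →ₐ[k] k, h.map (ev : Γ(A.scheme, U) →+* k) = (F a).val ∧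
        a.1 (IsLocalRing.closedPoint k) =
          j (Spec.map (CommRingCat.ofHom (ev : Γ(A.scheme, U) →+* k))
            (IsLocalRing.closedPoint k)) := by
    intro a ha
    obtain ⟨e, he⟩ := AlgVariety.exists_hom_of_mem_range j a ha
    have hce : c ≫ e = 𝟙 _ := by
      apply Spec.map_injective
      rw [Spec.map_comp, hc, Spec.map_preimage, ← Category.assoc, he, a.2, Spec.map_id]
    let ev : Γ(A.scheme, U) →ₐ[k] k :=
      { e.hom with commutes' := fun x => congr_arg (fun f => f.hom x) hce }
    refine ⟨ev, hh a e he, ?_⟩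
    rw [← he]
    rfl
  have hrange : Set.range j = U := hU.range_fromSpec
  obtain ⟨ev₀, hev₀, hx₀⟩ := hpt a₀ (hrange ▸ hx)
  refine IsLimitOfConj.mem_conjDiag (h := h) (ev₀ := ev₀) (fun s hs => ?_) hev₀
  -- the points of `A` in the basic open set defined by `s`
  have hmem : ∀ ev : Γ(A.scheme, U) →ₐ[k] k,
      Spec.map (CommRingCat.ofHom (ev : Γ(A.scheme, U) →+* k)) (IsLocalRing.closedPoint k) ∈
        PrimeSpectrum.basicOpen s ↔ ev s ≠ 0 := by
    intro ev
    change ¬ (ev s ∈ IsLocalRing.maximalIdeal k) ↔ _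
    rw [IsLocalRing.maximalIdeal_eq_bot]
    rfl
  obtain ⟨a, ⟨y, hy, hya⟩, haF⟩ := ha₀
    ((fun a : A.Point => a.1 (IsLocalRing.closedPoint k)) ⁻¹'
      (j '' (PrimeSpectrum.basicOpen s : Set (PrimeSpectrum Γ(A.scheme, U)))))
    (continuous_induced_dom.isOpen_preimage _
      (j.isOpenEmbedding.isOpenMap _ (PrimeSpectrum.basicOpen s).isOpen))
    ⟨Spec.map (CommRingCat.ofHom (ev₀ : Γ(A.scheme, U) →+* k)) (IsLocalRing.closedPoint k),
      (hmem ev₀).mpr hs, hx₀.symm⟩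
  obtain ⟨ev, hev, hxa⟩ := hpt a ⟨y, hya⟩
  refine ⟨ev, ?_, F a, haF, hev⟩
  rw [← hmem, ← j.isOpenEmbedding.injective (hya.trans hxa)]
  exact hy

end PolyAut

end

theorem mainTheorem5 {k : Type u} [Field k] [IsAlgClosed k] (μ : kˣ) :
    {h : PolyAut 2 k | ∃ g : PolyAut 2 k, h = g * (diagSAut μ : PolyAut 2 k) * g⁻¹} =
      {h : PolyAut 2 k | ∃ g ∈ SAut 2 k, h = g * (diagSAut μ : PolyAut 2 k) * g⁻¹} ∧
    IsClosed {h : SAut 2 k | ∃ g : SAut 2 k, h = g * diagSAut μ * g⁻¹} := by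
  have key : ∀ h : PolyAut 2 k, h ∈ PolyAut.conjDiag μ →
      ∃ g ∈ SAut 2 k, h = g * (diagSAut μ : PolyAut 2 k) * g⁻¹ := by
    rintro h ⟨g, rfl⟩
    obtain ⟨e, he, hge⟩ := PolyAut.exists_jac_eq_C g
    -- `d` commutes with diagonal automorphisms, and `g * d` has Jacobian `1`.
    set d : PolyAut 2 k := PolyAut.diag (Units.mk0 e he)⁻¹ 1 with hd
    have hcomm : d * (diagSAut μ : PolyAut 2 k) = (diagSAut μ : PolyAut 2 k) * d := by
      refine PolyAut.ext_coord fun i => ?_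
      rw [PolyAut.coord_mul, PolyAut.coord_mul, PolyAut.coe_diagSAut, hd, PolyAut.coord_diag,
        PolyAut.coord_diag]
      fin_cases i
      · simp; ring
      · simp
    refine ⟨g * d, ?_, ?_⟩
    · change (g * d).val.jac = 1
      rw [Units.val_mul, PolyEnd.jac_mul, hge, hd, PolyAut.jac_diag, PolyEnd.comap, bind₁_C_right,
        ← C_mul]
      simp [he]
    · rw [mul_assoc g d, hcomm, mul_inv_rev]
      group
  refine ⟨Set.Subset.antisymm key ?_, ?_⟩
  · rintro h ⟨g, -, hg⟩
    exact ⟨g, hg⟩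
  · have hpre : {h : SAut 2 k | ∃ g : SAut 2 k, h = g * diagSAut μ * g⁻¹} =
        Subtype.val ⁻¹' (PolyAut.conjDiag μ) := by
      ext h
      constructor
      · rintro ⟨g, rfl⟩
        exact ⟨g, rfl⟩
      · intro hh
        obtain ⟨g, hg, h1⟩ := key h hh
        exact ⟨⟨g, hg⟩, Subtype.ext h1⟩
    rw [hpre]
    exact (PolyAut.isClosed_conjDiag μ).preimage continuous_subtype_val
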